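/- Let $\Omega=(0,1)\times\mathbb R$ with points $(x,v)$. For $t\ge 0$ let $U_t=\Omega\times(0,t)$ and $\gamma_t^+=\{0\}\times(-\infty,0)\times(0,t)\,\cup\,\{1\}\times(0,\infty)\times(0,t)$. A test function on $U_t$ is a continuous function $\psi$ on $[0,1]\times\mathbb R\times[0,t]$ whose partial derivatives $\psi_x,\psi_v,\psi_{vv},\psi_s$ exist in $U_t$ and extend continuously to $[0,1]\times\mathbb R\times[0,t]$, and for which there is an $R>0$ such that $\psi(x,v,s)=0$ whenever $|v|>R$. Let $T>0$. Given $f_0\in L^1\cap L^\infty(\Omega)$, a weak solution on $[0,T]$ of $$f_t+vf_x=f_{vv}\ \text{ in }\Omega,\qquad f(x,v,0)=f_0(x,v),$$ $$f(0,v,t)=0\ \text{ for } v>0,\qquad f(1,v,t)=0\ \text{ for } v<0,$$ is a function $f\in L^\infty([0,T];L^1\cap L^\infty(\Omega))$, defined for every time $t\in[0,T]$ with $f(t)=f(\cdot,\cdot,t)\in L^1\cap L^\infty(\Omega)$ and $f(0)=f_0$ a.e. in $\Omega$, such that (a) $t\mapsto\int_\Omega f(x,v,t)\psi(x,v,t)\,dx\,dv$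 is continuous on $[0,T]$ for every test function $\psi$ on $U_T$; (b) for every $t\in[0,T]$ and every test function $\psi$ on $U_t$ with $\psi=0$ on $\gamma_t^+$, $$\int_\Omega f(x,v,t)\psi(x,v,t)\,dx\,dv-\int_\Omega f(x,v,0)\psi(x,v,0)\,dx\,dv=\int_{U_t}f\,[\psi_s+v\psi_x+\psi_{vv}]\,dx\,dv\,ds .$$ **Theorem.** Let $T>0$ and $f_0\in L^1\cap L^\infty(\Omega)$ with $f_0\ge 0$ a.e. Then there is a weak solution $f$ on $[0,T]$ with initial datum $f_0$, and it is unique: any weak solution $g$ with the same datum satisfies $g(t)=f(t)$ a.e. in $\Omega$ for every $t\in[0,T]$. Moreover, for every $t\in[0,T]$, $f(t)\ge 0$ a.e. in $\Omega$ and $$\|f(t)\|_{L^\infty(\Omega)}\le\|f_0\|_{L^\infty(\Omega)},\qquad \|f(t)\|_{L^1(\Omega)}\le\|f_0\|_{L^1(\Omega)} .$$ -/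

import Mathlib

open MeasureTheory Set
open scoped ENNReal NNReal

namespace FokkerPlanck

/-- The phase space `Ω = (0,1) × ℝ` of pairs `(x, v)`. -/
def strip : Set (ℝ × ℝ) := Ioo 0 1 ×ˢ univ

/-- Lebesgue measure on `Ω`. -/
noncomputable def stripMeasure : Measure (ℝ × ℝ) := volume.restrict strip

/-- The open set `U_t = Ω × (0,t)` of triples `(x, v, s)`. -/
def cyl (t : ℝ) : Set (ℝ × ℝ × ℝ) := Ioo 0 1 ×ˢ univ ×ˢ Ioo 0 t

/-- The set `[0,1] × ℝ × [0,t]`, which is the closure of `U_t` if `0 < t`. -/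
def closedCyl (t : ℝ) : Set (ℝ × ℝ × ℝ) := Icc 0 1 ×ˢ univ ×ˢ Icc 0 t

/-- The outgoing boundary `γ_t⁺`: `x = 0` and `v < 0`, or `x = 1` and `v > 0`. -/
def outgoing (t : ℝ) : Set (ℝ × ℝ × ℝ) :=
  ({0} ×ˢ Iio 0 ×ˢ Ioo 0 t) ∪ ({1} ×ˢ Ioi 0 ×ˢ Ioo 0 t)

/-- The slice `(x, v) ↦ f (x, v, t)`. -/
def atTime (f : ℝ × ℝ × ℝ → ℝ) (t : ℝ) : ℝ × ℝ → ℝ := fun z => f (z.1, z.2, t)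

/-- Partial derivative in the position `x`. -/
noncomputable def dx (ψ : ℝ × ℝ × ℝ → ℝ) (p : ℝ × ℝ × ℝ) : ℝ :=
  deriv (fun y => ψ (y, p.2.1, p.2.2)) p.1

/-- Partial derivative in the velocity `v`. -/
noncomputable def dv (ψ : ℝ × ℝ × ℝ → ℝ) (p : ℝ × ℝ × ℝ) : ℝ :=
  deriv (fun w => ψ (p.1, w, p.2.2)) p.2.1

/-- Partial derivative in the time. -/
noncomputable def dt (ψ : ℝ × ℝ × ℝ → ℝ) (p : ℝ × ℝ × ℝ) : ℝ :=
  deriv (fun r => ψ (p.1, p.2.1, r)) p.2.2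

/-- `ψ` is of class `C^{1,2,1}` in `(x, v, s)` on `U_t` up to the boundary: `ψ` is continuous on
`[0,1] × ℝ × [0,t]`, the partial derivatives `ψ_x`, `ψ_v`, `ψ_vv`, `ψ_s` exist in `U_t`, and they
extend continuously to `[0,1] × ℝ × [0,t]`. -/
def IsC121 (t : ℝ) (ψ : ℝ × ℝ × ℝ → ℝ) : Prop :=
  ContinuousOn ψ (closedCyl t) ∧
  ∃ ψx ψv ψvv ψs : ℝ × ℝ × ℝ → ℝ,
    ContinuousOn ψx (closedCyl t) ∧ ContinuousOn ψv (closedCyl t) ∧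
    ContinuousOn ψvv (closedCyl t) ∧ ContinuousOn ψs (closedCyl t) ∧
    ∀ x v s : ℝ, (x, v, s) ∈ cyl t →
      HasDerivAt (fun y => ψ (y, v, s)) (ψx (x, v, s)) x ∧
      HasDerivAt (fun w => ψ (x, w, s)) (ψv (x, v, s)) v ∧
      HasDerivAt (fun w => ψv (x, w, s)) (ψvv (x, v, s)) v ∧
      HasDerivAt (fun r => ψ (x, v, r)) (ψs (x, v, s)) s

/-- A test function on `U_t`: of class `C^{1,2,1}` up to the boundary, and there is an `R > 0` such
that `ψ (·, ·, s)` is supported in `[0,1] × [-R, R]` for all `s`. -/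
def IsTest (t : ℝ) (ψ : ℝ × ℝ × ℝ → ℝ) : Prop :=
  IsC121 t ψ ∧ ∃ R : ℝ, 0 < R ∧ ∀ p ∈ closedCyl t, R < |p.2.1| → ψ p = 0

/-- `f` belongs to `L^∞([0,T]; L¹ ∩ L^∞(Ω))`. The function is given at every time in `[0,T]`. -/
structure MemLinfty (T : ℝ) (f : ℝ × ℝ × ℝ → ℝ) : Prop where
  aestronglyMeasurable : AEStronglyMeasurable f (volume.restrict (cyl T))
  memLp_one : ∀ t ∈ Icc 0 T, MemLp (atTime f t) 1 stripMeasure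
  memLp_top : ∀ t ∈ Icc 0 T, MemLp (atTime f t) ∞ stripMeasure
  bounded : ∃ C : ℝ≥0, ∀ᵐ t ∂(volume.restrict (Icc 0 T)),
    eLpNorm (atTime f t) 1 stripMeasure ≤ C ∧ eLpNorm (atTime f t) ∞ stripMeasure ≤ C

/-- `f` is a weak solution on `[0,T]` of `f_t + v f_x = f_vv` in `Ω` with initial datum `f₀` and
the absorbing boundary conditions `f (0, v, t) = 0` for `v > 0`, `f (1, v, t) = 0` for `v < 0`. -/
structure IsWeakSolution (T : ℝ) (f₀ : ℝ × ℝ → ℝ) (f : ℝ × ℝ × ℝ → ℝ) : Prop where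
  mem : MemLinfty T f
  initial : atTime f 0 =ᵐ[stripMeasure] f₀
  weakly_continuous : ∀ ψ : ℝ × ℝ × ℝ → ℝ, IsTest T ψ →
    ContinuousOn (fun t => ∫ z, atTime f t z * atTime ψ t z ∂stripMeasure) (Icc 0 T)
  weak_form : ∀ t ∈ Icc 0 T, ∀ ψ : ℝ × ℝ × ℝ → ℝ, IsTest t ψ → (∀ p ∈ outgoing t, ψ p = 0) →
    (∫ z, atTime f t z * atTime ψ t z ∂stripMeasure)
        - (∫ z, atTime f 0 z * atTime ψ 0 z ∂stripMeasure)
      = ∫ p in cyl t, f p * (dt ψ p + p.2.1 * dx ψ p + dv (dv ψ) p)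

end FokkerPlanck

namespace FokkerPlanck

open Filter Topology

/-! ### Test functions as restrictions of uniformly continuous functions -/

/-! Existence comes from a splitting scheme. One step of length `h` is free transport with
absorption at the walls, followed by a jump of the velocity by `±√(2h)` with equal probabilities.
The step preserves nonnegativity, the bound `M` and the strip, and does not increase the mass. Its
transpose acts on a test function `ψ` as the identity plus `h (ψ_s + v ψ_x + ψ_vv)` up to `o(h)`,
except at points that exit during the step. There `ψ` itself is `O(h)`, because it vanishes on the
outgoing wall, and these points form a set of measure `O(h)`. Hence the iterates satisfy the weak
formulation up to an error that tends to zero (`IsTestJet.step_error`, `IsTestJet.scheme_error`).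

The iterates are bounded in `L²`, so Banach-Alaoglu along one fixed ultrafilter gives a weak limit
`G t` at every time simultaneously, and a weak limit `F` in space-time (`exists_weak_limit`). The
weak formulation passes to the limit in terms of both. Testing it with `φ` and with `s φ` shows that
almost every slice of `F` is `G t` (`LimitWeakForm.ae_slice`). Bounds and sign survive weak limits.

Uniqueness is by duality. The difference `D` of two solutions is bounded and has zero datum; for a
bump `φ ≥ 0` one wants a test function close to `φ` at time `t`, vanishing on the outgoing boundary,
and with `L ψ = ψ_s + v ψ_x + ψ_vv` small in `L¹`. Such functions are built from a parameter `δ`: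

- The whole-space Kolmogorov semigroup, which has an explicit Gaussian formula, is run for short
periods `τ`; between periods the function is multiplied by a cutoff equal to one on `[0,1]`. The
result `F` solves the backward equation exactly inside the strip. On the outgoing wall with `|v| ≥
δ` it is `O(τ / δ²)`, since a particle that leaves at speed at least `δ` rarely comes back before it
is killed (`exists_isKilled`).

- At the corners `|v| ≤ δ` of the outgoing wall `F` need not be small. A function `W ≥ F` there is
subtracted, supported on the kinetic scale `|v| ~ δ`, distance `~ δ³`, so that its generator has
`L¹` norm `O(δ)` (`exists_isCorner`).

- With `Z = F(t - s) - W ≤ δ²` on the outgoing boundary, a convex truncation `β` that vanishes up to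
`δ²` gives the test function `β(Z)`. The price is the term `β''(Z) Z_v² ≥ 0`, for which no pointwise
bound is needed: the same term occurs with the opposite sign in `L (Z - β(Z))`, whose integral over
the cylinder reduces by integration by parts to values of `Z - β(Z)`, and these have mass `O(δ)`
(`Field.HasTime.abs_integral_le`, `Field.Solves.exists_test`).

Then `∫ D(t) φ = O(δ)` for all small `δ`, so it vanishes. -/

lemma isOpen_cyl (t : ℝ) : IsOpen (cyl t) :=
  isOpen_Ioo.prod (isOpen_univ.prod isOpen_Ioo)

lemma measurableSet_cyl (t : ℝ) : MeasurableSet (cyl t) := (isOpen_cyl t).measurableSet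

lemma isOpen_strip : IsOpen strip := isOpen_Ioo.prod isOpen_univ

lemma measurableSet_strip : MeasurableSet strip := isOpen_strip.measurableSet

lemma mem_strip {z : ℝ × ℝ} : z ∈ strip ↔ 0 < z.1 ∧ z.1 < 1 := by
  simp [strip]

lemma mem_cyl {t : ℝ} {p : ℝ × ℝ × ℝ} :
    p ∈ cyl t ↔ (0 < p.1 ∧ p.1 < 1) ∧ (0 < p.2.2 ∧ p.2.2 < t) := by
  simp [cyl]

lemma mem_closedCyl {t : ℝ} {p : ℝ × ℝ × ℝ} :
    p ∈ closedCyl t ↔ (0 ≤ p.1 ∧ p.1 ≤ 1) ∧ (0 ≤ p.2.2 ∧ p.2.2 ≤ t) := by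
  simp [closedCyl]

lemma cyl_subset_closedCyl (t : ℝ) : cyl t ⊆ closedCyl t := by
  intro p hp
  rw [mem_cyl] at hp
  rw [mem_closedCyl]
  exact ⟨⟨hp.1.1.le, hp.1.2.le⟩, hp.2.1.le, hp.2.2.le⟩

lemma closedCyl_subset_closure {t : ℝ} (ht : 0 < t) : closedCyl t ⊆ closure (cyl t) := by
  unfold closedCyl cyl
  rw [closure_prod_eq, closure_prod_eq, closure_Ioo zero_ne_one, closure_Ioo ht.ne, closure_univ]

/-- The projection of `ℝ³` onto the box `[0,1] × [-(R+1), R+1] × [0,t]`. -/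
def boxProj (R t : ℝ) (p : ℝ × ℝ × ℝ) : ℝ × ℝ × ℝ :=
  (max 0 (min 1 p.1), max (-(R + 1)) (min (R + 1) p.2.1), max 0 (min t p.2.2))

lemma boxProj_uniformContinuous (R t : ℝ) : UniformContinuous (boxProj R t) := by
  have h : ∀ a b : ℝ, UniformContinuous fun x : ℝ => max a (min b x) := fun a b =>
    ((LipschitzWith.id.const_min b).const_max a).uniformContinuous
  exact ((h _ _).comp uniformContinuous_fst).prodMk
    (((h _ _).comp (uniformContinuous_fst.comp uniformContinuous_snd)).prodMk
      ((h _ _).comp (uniformContinuous_snd.comp uniformContinuous_snd)))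

/-- A continuous function on the closed cylinder, supported in `|v| ≤ R`, is the restriction of a
bounded, uniformly continuous function on `ℝ³`. -/
lemma exists_uniformContinuous_extension {t R : ℝ} (ht : 0 < t) (hR : 0 < R)
    {G : ℝ × ℝ × ℝ → ℝ} (hG : ContinuousOn G (closedCyl t))
    (hG0 : ∀ p ∈ closedCyl t, R < |p.2.1| → G p = 0) :
    ∃ G' : ℝ × ℝ × ℝ → ℝ, UniformContinuous G' ∧ EqOn G' G (closedCyl t) ∧
      (∀ p, R < |p.2.1| → G' p = 0) ∧ ∃ C, ∀ p, |G' p| ≤ C := by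
  set K : Set (ℝ × ℝ × ℝ) := Icc 0 1 ×ˢ Icc (-(R + 1)) (R + 1) ×ˢ Icc 0 t with hK
  have hKc : IsCompact K := isCompact_Icc.prod (isCompact_Icc.prod isCompact_Icc)
  have hKs : K ⊆ closedCyl t := by
    rintro ⟨x, v, s⟩ ⟨hx, -, hs⟩
    exact ⟨hx, mem_univ _, hs⟩
  have hmem : ∀ p, boxProj R t p ∈ K := by
    intro p
    refine ⟨⟨le_max_left _ _, max_le zero_le_one (min_le_left _ _)⟩,
      ⟨le_max_left _ _, max_le (by linarith) (min_le_left _ _)⟩,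
      ⟨le_max_left _ _, max_le ht.le (min_le_left _ _)⟩⟩
  have hcont : ContinuousOn G K := hG.mono hKs
  -- Clamping at `R + 1` rather than `R` keeps large velocities strictly beyond `R`, where the
  -- function vanishes.
  have hbig : ∀ v : ℝ, R < |v| → R < |max (-(R + 1)) (min (R + 1) v)| := by
    intro v hv
    rcases lt_abs.1 hv with h | h
    · exact lt_abs.2 (Or.inl (lt_max_of_lt_right (lt_min (by linarith) h)))
    · refine lt_abs.2 (Or.inr ?_)
      rw [lt_neg, max_lt_iff]
      exact ⟨by linarith, min_lt_of_right_lt (by linarith)⟩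
  have hzero : ∀ p, R < |p.2.1| → G (boxProj R t p) = 0 := fun p hp =>
    hG0 _ (hKs (hmem p)) (hbig _ hp)
  refine ⟨fun p => G (boxProj R t p), ?_, ?_, hzero, ?_⟩
  · have h1 := hKc.uniformContinuousOn_of_continuous hcont
    rw [Metric.uniformContinuous_iff]
    rw [Metric.uniformContinuousOn_iff] at h1
    intro ε hε
    obtain ⟨δ, hδ, h2⟩ := h1 ε hε
    obtain ⟨η, hη, h3⟩ := Metric.uniformContinuous_iff.1 (boxProj_uniformContinuous R t) δ hδ
    exact ⟨η, hη, fun a b hab => h2 _ (hmem a) _ (hmem b) (h3 hab)⟩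
  · intro p hp
    rcases lt_or_ge R |p.2.1| with h | h
    · simp only [hzero p h, hG0 p hp h]
    · have h' := abs_le.1 h
      have : boxProj R t p = p := by
        rw [mem_closedCyl] at hp
        ext
        · simp [boxProj, hp.1.1, hp.1.2]
        · simp only [boxProj]
          rw [min_eq_right (by linarith), max_eq_right (by linarith)]
        · simp [boxProj, hp.2.1, hp.2.2]
      simp only [this]
  · obtain ⟨C, hC⟩ := hKc.exists_bound_of_continuousOn hcont
    exact ⟨C, fun p => hC _ (hmem p)⟩

/-- The functions `Ψ, Ψx, Ψv, Ψvv, Ψs` on `ℝ³` are bounded by `C`, uniformly continuous, supported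
in `|v| ≤ R`, and the last four are the indicated derivatives of the first one in `U_t`. -/
structure IsTestJet (t R C : ℝ) (Ψ Ψx Ψv Ψvv Ψs : ℝ × ℝ × ℝ → ℝ) : Prop where
  uc : UniformContinuous Ψ
  uc_x : UniformContinuous Ψx
  uc_v : UniformContinuous Ψv
  uc_vv : UniformContinuous Ψvv
  uc_s : UniformContinuous Ψs
  supp : ∀ p, R < |p.2.1| → Ψ p = 0
  supp_x : ∀ p, R < |p.2.1| → Ψx p = 0
  supp_vv : ∀ p, R < |p.2.1| → Ψvv p = 0
  supp_s : ∀ p, R < |p.2.1| → Ψs p = 0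
  bdd : ∀ p, |Ψ p| ≤ C
  bdd_x : ∀ p, |Ψx p| ≤ C
  bdd_vv : ∀ p, |Ψvv p| ≤ C
  bdd_s : ∀ p, |Ψs p| ≤ C
  deriv_x : ∀ x v s, (x, v, s) ∈ cyl t → HasDerivAt (fun y => Ψ (y, v, s)) (Ψx (x, v, s)) x
  deriv_v : ∀ x v s, (x, v, s) ∈ cyl t → HasDerivAt (fun w => Ψ (x, w, s)) (Ψv (x, v, s)) v
  deriv_vv : ∀ x v s, (x, v, s) ∈ cyl t → HasDerivAt (fun w => Ψv (x, w, s)) (Ψvv (x, v, s)) v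
  deriv_s : ∀ x v s, (x, v, s) ∈ cyl t → HasDerivAt (fun r => Ψ (x, v, r)) (Ψs (x, v, s)) s

/-- The backward operator `ψ_s + v ψ_x + ψ_vv` in terms of the derivatives. -/
def backwardOp (Ψx Ψvv Ψs : ℝ × ℝ × ℝ → ℝ) (p : ℝ × ℝ × ℝ) : ℝ := Ψs p + p.2.1 * Ψx p + Ψvv p

lemma eventually_mem_cyl {t x v s : ℝ} (h : (x, v, s) ∈ cyl t) :
    (∀ᶠ y in 𝓝 x, (y, v, s) ∈ cyl t) ∧ (∀ w, (x, w, s) ∈ cyl t) ∧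
      ∀ᶠ r in 𝓝 s, (x, v, r) ∈ cyl t := by
  rw [mem_cyl] at h
  refine ⟨?_, ?_, ?_⟩
  · filter_upwards [Ioo_mem_nhds h.1.1 h.1.2] with y hy
    exact mem_cyl.2 ⟨hy, h.2⟩
  · intro w
    exact mem_cyl.2 ⟨h.1, h.2⟩
  · filter_upwards [Ioo_mem_nhds h.2.1 h.2.2] with y hy
    exact mem_cyl.2 ⟨h.1, hy⟩

/-- Since `{R < |v|}` is open, its part in the closed cylinder lies in the closure of its part in
the open one, and the zero set of a continuous function is closed there. The continuous extensions
of the derivatives thereby inherit the velocity support. -/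
lemma vanish_closedCyl {t R : ℝ} (ht : 0 < t) {G : ℝ × ℝ × ℝ → ℝ}
    (hG : ContinuousOn G (closedCyl t))
    (hG0 : ∀ p ∈ cyl t, R < |p.2.1| → G p = 0) :
    ∀ p ∈ closedCyl t, R < |p.2.1| → G p = 0 := by
  set V : Set (ℝ × ℝ × ℝ) := {p | R < |p.2.1|} with hV
  have hVo : IsOpen V := isOpen_lt continuous_const (by fun_prop)
  have h1 : EqOn G (fun _ => 0) (V ∩ closedCyl t) := by
    refine Set.EqOn.of_subset_closure (s := V ∩ cyl t) (fun p hp => hG0 p hp.2 hp.1)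
      (hG.mono inter_subset_right) continuousOn_const
      (inter_subset_inter_right _ (cyl_subset_closedCyl t)) ?_
    exact (inter_subset_inter_right _ (closedCyl_subset_closure ht)).trans hVo.inter_closure
  exact fun p hp hpR => h1 ⟨hpR, hp⟩

/-- Compact velocity support makes all derivatives uniformly continuous and bounded once they are
extended to the whole space; this is what makes consistency of the scheme uniform in the starting
point. The differential relations themselves hold only in the open cylinder. -/
lemma IsTest.exists_jet {t : ℝ} (ht : 0 < t) {ψ : ℝ × ℝ × ℝ → ℝ} (hψ : IsTest t ψ) :
    ∃ R C : ℝ, ∃ Ψ Ψx Ψv Ψvv Ψs : ℝ × ℝ × ℝ → ℝ, 0 < R ∧ IsTestJet t R C Ψ Ψx Ψv Ψvv Ψs ∧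
      EqOn Ψ ψ (closedCyl t) ∧
      ∀ p ∈ cyl t, dt ψ p + p.2.1 * dx ψ p + dv (dv ψ) p = backwardOp Ψx Ψvv Ψs p := by
  obtain ⟨⟨hc, ψx, ψv, ψvv, ψs, hcx, hcv, hcvv, hcs, hd⟩, R, hR, hsupp⟩ := hψ
  have hbig : ∀ v : ℝ, R < |v| → ∀ᶠ w in 𝓝 v, R < |w| := fun v hv =>
    (isOpen_lt continuous_const continuous_abs).mem_nhds hv
  have sx : ∀ p ∈ cyl t, R < |p.2.1| → ψx p = 0 := by
    rintro ⟨x, v, s⟩ hp hv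
    refine (hd x v s hp).1.unique ((hasDerivAt_const x (0 : ℝ)).congr_of_eventuallyEq ?_)
    filter_upwards [(eventually_mem_cyl hp).1] with y hy
    exact hsupp _ (cyl_subset_closedCyl _ hy) hv
  have sv : ∀ p ∈ cyl t, R < |p.2.1| → ψv p = 0 := by
    rintro ⟨x, v, s⟩ hp hv
    refine (hd x v s hp).2.1.unique ((hasDerivAt_const v (0 : ℝ)).congr_of_eventuallyEq ?_)
    filter_upwards [hbig v hv] with w hw
    exact hsupp _ (cyl_subset_closedCyl _ ((eventually_mem_cyl hp).2.1 w)) hw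
  have svv : ∀ p ∈ cyl t, R < |p.2.1| → ψvv p = 0 := by
    rintro ⟨x, v, s⟩ hp hv
    refine (hd x v s hp).2.2.1.unique ((hasDerivAt_const v (0 : ℝ)).congr_of_eventuallyEq ?_)
    filter_upwards [hbig v hv] with w hw
    exact sv _ ((eventually_mem_cyl hp).2.1 w) hw
  have ss : ∀ p ∈ cyl t, R < |p.2.1| → ψs p = 0 := by
    rintro ⟨x, v, s⟩ hp hv
    refine (hd x v s hp).2.2.2.unique ((hasDerivAt_const s (0 : ℝ)).congr_of_eventuallyEq ?_)
    filter_upwards [(eventually_mem_cyl hp).2.2] with y hy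
    exact hsupp _ (cyl_subset_closedCyl _ hy) hv
  obtain ⟨Ψ, u0, e0, z0, C0, b0⟩ := exists_uniformContinuous_extension ht hR hc hsupp
  obtain ⟨Ψx, u1, e1, z1, C1, b1⟩ :=
    exists_uniformContinuous_extension ht hR hcx (vanish_closedCyl ht hcx sx)
  obtain ⟨Ψv, u2, e2, -, -⟩ :=
    exists_uniformContinuous_extension ht hR hcv (vanish_closedCyl ht hcv sv)
  obtain ⟨Ψvv, u3, e3, z3, C3, b3⟩ :=
    exists_uniformContinuous_extension ht hR hcvv (vanish_closedCyl ht hcvv svv)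
  obtain ⟨Ψs, u4, e4, z4, C4, b4⟩ :=
    exists_uniformContinuous_extension ht hR hcs (vanish_closedCyl ht hcs ss)
  have hsub := cyl_subset_closedCyl t
  have hjet : IsTestJet t R (max (max C0 C1) (max C3 C4)) Ψ Ψx Ψv Ψvv Ψs := by
    refine ⟨u0, u1, u2, u3, u4, z0, z1, z3, z4, fun p => (b0 p).trans (by simp),
      fun p => (b1 p).trans (by simp), fun p => (b3 p).trans (by simp),
      fun p => (b4 p).trans (by simp), ?_, ?_, ?_, ?_⟩
    · intro x v s hp
      rw [e1 (hsub hp)]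
      refine (hd x v s hp).1.congr_of_eventuallyEq ?_
      filter_upwards [(eventually_mem_cyl hp).1] with y hy using e0 (hsub hy)
    · intro x v s hp
      rw [e2 (hsub hp)]
      refine (hd x v s hp).2.1.congr_of_eventuallyEq (.of_forall fun w => ?_)
      exact e0 (hsub ((eventually_mem_cyl hp).2.1 w))
    · intro x v s hp
      rw [e3 (hsub hp)]
      refine (hd x v s hp).2.2.1.congr_of_eventuallyEq (.of_forall fun w => ?_)
      exact e2 (hsub ((eventually_mem_cyl hp).2.1 w))
    · intro x v s hp
      rw [e4 (hsub hp)]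
      refine (hd x v s hp).2.2.2.congr_of_eventuallyEq ?_
      filter_upwards [(eventually_mem_cyl hp).2.2] with y hy using e0 (hsub hy)
  refine ⟨R, _, Ψ, Ψx, Ψv, Ψvv, Ψs, hR, hjet, e0, ?_⟩
  rintro ⟨x, v, s⟩ hp
  have h1 : dt ψ (x, v, s) = ψs (x, v, s) := (hd x v s hp).2.2.2.deriv
  have h2 : dx ψ (x, v, s) = ψx (x, v, s) := (hd x v s hp).1.deriv
  -- The cylinder is unbounded in `v`, so `dv ψ` agrees with `ψv` on the whole velocity line and may
  -- be differentiated again.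
  have h3 : dv (dv ψ) (x, v, s) = ψvv (x, v, s) := by
    have : (fun w => dv ψ (x, w, s)) = fun w => ψv (x, w, s) := by
      funext w
      exact (hd x w s ((eventually_mem_cyl hp).2.1 w)).2.1.deriv
    unfold dv at this ⊢
    simp only at this ⊢
    rw [this]
    exact (hd x v s hp).2.2.1.deriv
  rw [h1, h2, h3, backwardOp, e1 (hsub hp), e3 (hsub hp), e4 (hsub hp)]

/-! ### Fubini on the cylinder -/

lemma measurePreserving_cyl (t : ℝ) :
    MeasurePreserving (MeasurableEquiv.prodAssoc : (ℝ × ℝ) × ℝ ≃ᵐ ℝ × ℝ × ℝ)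
      (stripMeasure.prod (volume.restrict (Ioo 0 t))) (volume.restrict (cyl t)) := by
  have h := (volume_preserving_prodAssoc (α₁ := ℝ) (β₁ := ℝ) (γ₁ := ℝ)).restrict_preimage
    (measurableSet_cyl t)
  have : (MeasurableEquiv.prodAssoc : (ℝ × ℝ) × ℝ ≃ᵐ ℝ × ℝ × ℝ) ⁻¹' cyl t
      = strip ×ˢ Ioo 0 t := by
    ext ⟨⟨x, v⟩, s⟩
    simp [MeasurableEquiv.prodAssoc, cyl, strip]
  rw [this] at h
  rw [stripMeasure, Measure.prod_restrict]
  exact h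

instance : SigmaFinite stripMeasure := by unfold stripMeasure; infer_instance

instance : SFinite stripMeasure := inferInstance

end FokkerPlanck

namespace FokkerPlanck

open Filter Topology

/-! ### The splitting scheme -/

/-- Free transport during time `h`, absorbing at the boundary. -/
noncomputable def transport (h : ℝ) (q : ℝ × ℝ → ℝ) : ℝ × ℝ → ℝ :=
  strip.indicator fun z => q (z.1 - h * z.2, z.2)

/-- One step of the splitting scheme: transport followed by a symmetric random jump of the
velocity, of variance `2h`. -/
noncomputable def step (h : ℝ) (q : ℝ × ℝ → ℝ) (z : ℝ × ℝ) : ℝ :=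
  (transport h q (z + (0, √(2 * h))) + transport h q (z - (0, √(2 * h)))) / 2

/-- The transpose of `step`. -/
noncomputable def stepDual (h : ℝ) (φ : ℝ × ℝ → ℝ) (z : ℝ × ℝ) : ℝ :=
  strip.indicator (fun y => (φ (y + (0, √(2 * h))) + φ (y - (0, √(2 * h)))) / 2)
    (z.1 + h * z.2, z.2)

/-- `q` is a nonnegative density on the strip, bounded by `M`, of mass at most `A`. -/
structure IsDensity (M A : ℝ) (q : ℝ × ℝ → ℝ) : Prop where
  meas : Measurable q
  nonneg : ∀ z, 0 ≤ q z
  le : ∀ z, q z ≤ M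
  zero : ∀ z ∉ strip, q z = 0
  int : Integrable q
  mass : ∫ z, q z ≤ A

/-- The shear `(x, v) ↦ (x + h v, v)`. -/
def shear (h : ℝ) : ℝ × ℝ ≃ᵐ ℝ × ℝ where
  toFun z := (z.1 + h * z.2, z.2)
  invFun z := (z.1 - h * z.2, z.2)
  left_inv z := by simp
  right_inv z := by simp
  measurable_toFun := by
    change Measurable fun z : ℝ × ℝ => (z.1 + h * z.2, z.2)
    fun_prop
  measurable_invFun := by
    change Measurable fun z : ℝ × ℝ => (z.1 - h * z.2, z.2)
    fun_prop

lemma measurePreserving_shear (h : ℝ) : MeasurePreserving (shear h) := by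
  have h1 : MeasurePreserving (fun p : ℝ × ℝ => (p.1, p.2 + h * p.1))
      (volume.prod volume) (volume.prod volume) := by
    refine (MeasurePreserving.id (volume : Measure ℝ)).skew_product
      (g := fun v x => x + h * v) (by fun_prop) (.of_forall fun v => ?_)
    exact (measurePreserving_add_right volume (h * v)).map_eq
  have h2 := (Measure.measurePreserving_swap (μ := (volume : Measure ℝ))
    (ν := (volume : Measure ℝ)))
  exact (h2.comp h1).comp h2

lemma measurePreserving_shear_symm (h : ℝ) : MeasurePreserving (shear h).symm :=
  (measurePreserving_shear h).symm _

lemma IsDensity.transport_integrable {M A h : ℝ} {q : ℝ × ℝ → ℝ} (hq : IsDensity M A q) :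
    Integrable (transport h q) := by
  have := (measurePreserving_shear_symm h).integrable_comp_of_integrable hq.int
  exact this.indicator measurableSet_strip

lemma integral_transport_mul {h : ℝ} {q : ℝ × ℝ → ℝ} (φ : ℝ × ℝ → ℝ) :
    ∫ z, transport h q z * φ z
      = ∫ z, q z * strip.indicator φ (z.1 + h * z.2, z.2) := by
  rw [← (measurePreserving_shear h).integral_comp' (fun z => transport h q z * φ z)]
  refine integral_congr_ae (.of_forall fun z => ?_)
  change transport h q (z.1 + h * z.2, z.2) * φ (z.1 + h * z.2, z.2) = _
  by_cases hz : (z.1 + h * z.2, z.2) ∈ strip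
  · simp [transport, hz]
  · simp [transport, hz]

lemma IsDensity.transport_measurable {M A h : ℝ} {q : ℝ × ℝ → ℝ} (hq : IsDensity M A q) :
    Measurable (transport h q) :=
  (hq.meas.comp (by fun_prop : Measurable fun z : ℝ × ℝ => (z.1 - h * z.2, z.2))).indicator
    measurableSet_strip

lemma IsDensity.step_measurable {M A h : ℝ} {q : ℝ × ℝ → ℝ} (hq : IsDensity M A q) :
    Measurable (step h q) := by
  have := hq.transport_measurable (h := h)
  unfold step
  exact ((this.comp (measurable_id.add_const _)).add
    (this.comp (measurable_id.sub_const _))).div_const _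

/-- Translations and the shear preserve Lebesgue measure, so jump and transport both move onto `φ`.
All later analysis of the scheme acts on smooth `φ` instead of the rough density. -/
lemma IsDensity.integral_step_mul {M A h : ℝ} {q : ℝ × ℝ → ℝ} (hq : IsDensity M A q)
    {φ : ℝ × ℝ → ℝ} (hφ : Measurable φ) {B : ℝ} (hB : ∀ z, |φ z| ≤ B) :
    ∫ z, step h q z * φ z = ∫ z, q z * stepDual h φ z := by
  set e : ℝ × ℝ := (0, √(2 * h)) with he
  have hI := hq.transport_integrable (h := h)
  have i1 : Integrable fun z => transport h q (z + e) * φ z :=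
    (hI.comp_add_right e).mul_bdd hφ.aestronglyMeasurable (.of_forall hB)
  have i2 : Integrable fun z => transport h q (z - e) * φ z :=
    (hI.comp_sub_right e).mul_bdd hφ.aestronglyMeasurable (.of_forall hB)
  have j1 : Integrable fun z => transport h q z * φ (z - e) :=
    hI.mul_bdd (hφ.comp (measurable_id.sub_const e)).aestronglyMeasurable
      (.of_forall fun z => hB _)
  have j2 : Integrable fun z => transport h q z * φ (z + e) :=
    hI.mul_bdd (hφ.comp (measurable_id.add_const e)).aestronglyMeasurable
      (.of_forall fun z => hB _)
  have k1 : ∫ z, transport h q (z + e) * φ z = ∫ z, transport h q z * φ (z - e) := by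
    rw [← integral_add_right_eq_self (fun z => transport h q z * φ (z - e)) e]
    simp
  have k2 : ∫ z, transport h q (z - e) * φ z = ∫ z, transport h q z * φ (z + e) := by
    rw [← integral_sub_right_eq_self (fun z => transport h q z * φ (z + e)) e]
    simp
  have : ∫ z, step h q z * φ z
      = ∫ z, transport h q z * ((φ (z + e) + φ (z - e)) / 2) := by
    calc ∫ z, step h q z * φ z
        = ∫ z, (transport h q (z + e) * φ z + transport h q (z - e) * φ z) / 2 := by
          refine integral_congr_ae (.of_forall fun z => ?_)
          simp only [step, ← he]; ring
      _ = ∫ z, (transport h q z * φ (z - e) + transport h q z * φ (z + e)) / 2 := by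
          rw [integral_div, integral_div, integral_add i1 i2, integral_add j1 j2, k1, k2]
      _ = _ := by
          refine integral_congr_ae (.of_forall fun z => ?_)
          simp only; ring
  rw [this, integral_transport_mul]
  rfl

lemma IsDensity.step {M A h : ℝ} (hM : 0 ≤ M) {q : ℝ × ℝ → ℝ} (hq : IsDensity M A q) :
    IsDensity M A (step h q) := by
  have h0 : ∀ z, 0 ≤ transport h q z := fun z => indicator_nonneg (fun _ _ => hq.nonneg _) _
  have h1 : ∀ z, transport h q z ≤ M := fun z =>
    indicator_le' (fun _ _ => hq.le _) (fun _ _ => hM) z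
  have hint : Integrable (FokkerPlanck.step h q) := by
    have hI := hq.transport_integrable (h := h)
    exact ((hI.comp_add_right _).add (hI.comp_sub_right _)).div_const 2
  refine ⟨hq.step_measurable, fun z => ?_, fun z => ?_, fun z hz => ?_, hint, ?_⟩
  · have := h0 (z + (0, √(2 * h)))
    have := h0 (z - (0, √(2 * h)))
    unfold FokkerPlanck.step; linarith
  · have := h1 (z + (0, √(2 * h)))
    have := h1 (z - (0, √(2 * h)))
    unfold FokkerPlanck.step; linarith
  · have a1 : z + (0, √(2 * h)) ∉ strip := by
      rw [mem_strip] at hz ⊢; simpa using hz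
    have a2 : z - (0, √(2 * h)) ∉ strip := by
      rw [mem_strip] at hz ⊢; simpa using hz
    unfold FokkerPlanck.step transport
    rw [indicator_of_notMem a1, indicator_of_notMem a2]
    simp
  -- Mass is the pairing with `1`, and the transpose sends `1` to an indicator, hence to something
  -- at most `1`.
  · have := hq.integral_step_mul (h := h) (φ := fun _ => 1) measurable_const (B := 1) (by simp)
    simp only [mul_one] at this
    rw [this]
    refine le_trans (integral_mono_of_nonneg (.of_forall fun z => ?_) hq.int
      (.of_forall fun z => ?_)) hq.mass
    · exact mul_nonneg (hq.nonneg _) (indicator_nonneg (by intros; norm_num) _)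
    · refine mul_le_of_le_one_right (hq.nonneg _) ?_
      exact indicator_le' (f := fun _ => ((1 : ℝ) + 1) / 2) (g := fun _ => 1)
        (fun _ _ => by norm_num) (fun _ _ => zero_le_one) _

/-! ### Local consistency of the scheme -/

/-- The derivatives of a test function are available only for `0 < s < t`, whereas the scheme also
evaluates at the end times; continuity extends the estimates there. -/
lemma le_Icc_of_le_Ioo {t : ℝ} (ht : 0 < t) {f g : ℝ → ℝ} (hf : Continuous f) (hg : Continuous g)
    (h : ∀ s, 0 < s → s < t → f s ≤ g s) {s : ℝ} (h0 : 0 ≤ s) (h1 : s ≤ t) : f s ≤ g s := by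
  have : s ∈ closure (Ioo 0 t) := by rw [closure_Ioo ht.ne]; exact ⟨h0, h1⟩
  exact le_on_closure (s := Ioo 0 t) (fun x hx => h x hx.1 hx.2) hf.continuousOn hg.continuousOn
    this

section Consistency

variable {t R C : ℝ} {Ψ Ψx Ψv Ψvv Ψs : ℝ × ℝ × ℝ → ℝ}

/-- The symmetric second difference minus `w² Ψvv` and its first `w`-derivative vanish at `w = 0`,
and its second derivative is at most `2ω`. Two applications of the mean value inequality suffice,
using only the modulus of continuity of `Ψvv`. -/
lemma IsTestJet.second_difference (hj : IsTestJet t R C Ψ Ψx Ψv Ψvv Ψs) (ht : 0 < t)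
    {a ω : ℝ} (ha : 0 ≤ a)
    (hω : ∀ x v s w, |w| ≤ a → |Ψvv (x, v + w, s) - Ψvv (x, v, s)| ≤ ω)
    {x v s : ℝ} (hx : 0 < x ∧ x < 1) (hs0 : 0 ≤ s) (hst : s ≤ t) :
    |Ψ (x, v + a, s) + Ψ (x, v - a, s) - 2 * Ψ (x, v, s) - a ^ 2 * Ψvv (x, v, s)|
      ≤ 2 * ω * a ^ 2 := by
  have c0 := hj.uc.continuous
  have c3 := hj.uc_vv.continuous
  refine le_Icc_of_le_Ioo ht
    (f := fun s => |Ψ (x, v + a, s) + Ψ (x, v - a, s) - 2 * Ψ (x, v, s) - a ^ 2 * Ψvv (x, v, s)|)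
    (g := fun _ => 2 * ω * a ^ 2)
    (by fun_prop) continuous_const ?_ hs0 hst
  intro s hs0 hst
  have hm : ∀ w, (x, w, s) ∈ cyl t := fun w => mem_cyl.2 ⟨hx, hs0, hst⟩
  set b := Ψvv (x, v, s) with hb
  have d1 : ∀ w, HasDerivAt (fun w => Ψv (x, v + w, s) - Ψv (x, v - w, s) - 2 * w * b)
      (Ψvv (x, v + w, s) + Ψvv (x, v - w, s) - 2 * b) w := by
    intro w
    have e1 := (hj.deriv_vv x (v + w) s (hm _)).comp w ((hasDerivAt_id w).const_add v)
    have e2 := (hj.deriv_vv x (v - w) s (hm _)).comp w ((hasDerivAt_id w).const_sub v)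
    have e3 := ((hasDerivAt_id w).const_mul 2).mul_const b
    convert! (e1.sub e2).sub e3 using 1
    ring
  have d0 : ∀ w, HasDerivAt
      (fun w => Ψ (x, v + w, s) + Ψ (x, v - w, s) - 2 * Ψ (x, v, s) - w ^ 2 * b)
      (Ψv (x, v + w, s) - Ψv (x, v - w, s) - 2 * w * b) w := by
    intro w
    have e1 := (hj.deriv_v x (v + w) s (hm _)).comp w ((hasDerivAt_id w).const_add v)
    have e2 := (hj.deriv_v x (v - w) s (hm _)).comp w ((hasDerivAt_id w).const_sub v)
    have e3 := ((hasDerivAt_id w).pow 2).mul_const b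
    convert! ((e1.add e2).sub_const (2 * Ψ (x, v, s))).sub e3 using 1
    simp
    ring
  have b1 : ∀ w ∈ Icc 0 a, |Ψv (x, v + w, s) - Ψv (x, v - w, s) - 2 * w * b| ≤ 2 * ω * a := by
    intro w hw
    have := (convex_Icc 0 a).norm_image_sub_le_of_norm_hasDerivWithin_le
      (C := 2 * ω) (fun y _ => (d1 y).hasDerivWithinAt) (fun y hy => ?_)
      (left_mem_Icc.2 ha) hw
    · simp only [add_zero, sub_zero, sub_self, mul_zero, zero_mul, Real.norm_eq_abs] at this
      refine this.trans ?_
      have hω0 : 0 ≤ ω := (abs_nonneg _).trans (hω 0 0 0 0 (by simpa using ha))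
      rw [abs_of_nonneg hw.1]
      exact mul_le_mul_of_nonneg_left hw.2 (by positivity)
    · have u1 := hω x v s y (by rw [abs_of_nonneg hy.1]; exact hy.2)
      have u2 := hω x v s (-y) (by rw [abs_neg, abs_of_nonneg hy.1]; exact hy.2)
      rw [← sub_eq_add_neg] at u2
      rw [Real.norm_eq_abs, abs_le]
      rw [abs_le] at u1 u2
      constructor <;> linarith [u1.1, u1.2, u2.1, u2.2]
  have := (convex_Icc 0 a).norm_image_sub_le_of_norm_hasDerivWithin_le
      (fun y _ => (d0 y).hasDerivWithinAt) (fun y hy => b1 y hy)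
      (left_mem_Icc.2 ha) (right_mem_Icc.2 ha)
  simp only [add_zero, sub_zero, Real.norm_eq_abs, abs_of_nonneg ha] at this
  convert! this using 1
  · congr 1; ring
  · ring

lemma IsTestJet.x_difference (hj : IsTestJet t R C Ψ Ψx Ψv Ψvv Ψs) (ht : 0 < t)
    {ω x y v s : ℝ} (hω : ∀ y', |y' - x| ≤ |y - x| → ∀ s, |Ψx (y', v, s) - Ψx (x, v, s)| ≤ ω)
    (hx : 0 < x ∧ x < 1) (hy : 0 < y ∧ y < 1) (hs0 : 0 ≤ s) (hst : s ≤ t) :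
    |Ψ (y, v, s) - Ψ (x, v, s) - (y - x) * Ψx (x, v, s)| ≤ ω * |y - x| := by
  have c0 := hj.uc.continuous
  have c1 := hj.uc_x.continuous
  refine le_Icc_of_le_Ioo ht
    (f := fun s => |Ψ (y, v, s) - Ψ (x, v, s) - (y - x) * Ψx (x, v, s)|)
    (g := fun _ => ω * |y - x|) (by fun_prop) continuous_const ?_ hs0 hst
  intro s hs0 hst
  have hm : ∀ w ∈ uIcc x y, (w, v, s) ∈ cyl t := by
    intro w hw
    refine mem_cyl.2 ⟨⟨lt_of_lt_of_le (lt_min hx.1 hy.1) hw.1,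
      lt_of_le_of_lt hw.2 (max_lt hx.2 hy.2)⟩, hs0, hst⟩
  have d : ∀ w ∈ uIcc x y, HasDerivWithinAt (fun w => Ψ (w, v, s) - w * Ψx (x, v, s))
      (Ψx (w, v, s) - Ψx (x, v, s)) (uIcc x y) w := by
    intro w hw
    have := (hj.deriv_x w v s (hm w hw)).sub ((hasDerivAt_id w).mul_const (Ψx (x, v, s)))
    rw [one_mul] at this
    exact this.hasDerivWithinAt
  have := (convex_uIcc x y).norm_image_sub_le_of_norm_hasDerivWithin_le (C := ω) d
    (fun w hw => hω w (abs_sub_left_of_mem_uIcc hw) s) left_mem_uIcc right_mem_uIcc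
  rw [Real.norm_eq_abs, Real.norm_eq_abs] at this
  convert! this using 2
  ring

lemma IsTestJet.s_difference (hj : IsTestJet t R C Ψ Ψx Ψv Ψvv Ψs)
    {ω h x v s : ℝ} (hh : 0 < h) (hω : ∀ r, |r - s| ≤ h → |Ψs (x, v, r) - Ψs (x, v, s)| ≤ ω)
    (hx : 0 < x ∧ x < 1) (hs0 : 0 ≤ s) (hst : s + h ≤ t) :
    |Ψ (x, v, s + h) - Ψ (x, v, s) - h * Ψs (x, v, s)| ≤ ω * h := by
  have c0 := hj.uc.continuous
  obtain ⟨c, hc, hc'⟩ := exists_hasDerivAt_eq_slope (fun r => Ψ (x, v, r))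
    (fun r => Ψs (x, v, r)) (lt_add_of_pos_right s hh) (by fun_prop)
    (fun r hr => hj.deriv_s x v r (mem_cyl.2 ⟨hx, hs0.trans_lt hr.1, hr.2.trans_le hst⟩))
  simp only [add_sub_cancel_left] at hc'
  have e : Ψ (x, v, s + h) - Ψ (x, v, s) = Ψs (x, v, c) * h := by
    rw [hc', div_mul_cancel₀ _ hh.ne']
  rw [e, mul_comm h, ← sub_mul, abs_mul, abs_of_pos hh]
  refine mul_le_mul_of_nonneg_right (hω c ?_) hh.le
  rw [abs_of_pos (sub_pos.2 hc.1)]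
  linarith [hc.2]

/-- A point that exits within time `h` is at distance at most `h |v|` from the wall it moves
towards. There `Ψ` vanishes, and `|Ψx| ≤ C` in between. -/
lemma IsTestJet.exit_bound (hj : IsTestJet t R C Ψ Ψx Ψv Ψvv Ψs) (ht : 0 < t)
    (hout : ∀ p ∈ outgoing t, Ψ p = 0) {h x v s : ℝ} (hh : 0 < h)
    (hx : 0 < x ∧ x < 1) (hexit : ¬ (0 < x + h * v ∧ x + h * v < 1))
    (hs0 : 0 ≤ s) (hst : s ≤ t) :
    |Ψ (x, v, s)| ≤ C * (h * |v|) := by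
  have c0 := hj.uc.continuous
  have hC : 0 ≤ C := (abs_nonneg _).trans (hj.bdd 0)
  refine le_Icc_of_le_Ioo ht (f := fun s => |Ψ (x, v, s)|)
    (g := fun _ => C * (h * |v|)) (by fun_prop) continuous_const ?_ hs0 hst
  intro s hs0 hst
  have hm : ∀ y, 0 < y → y < 1 → (y, v, s) ∈ cyl t := fun y h0 h1 =>
    mem_cyl.2 ⟨⟨h0, h1⟩, hs0, hst⟩
  rcases lt_trichotomy v 0 with hv | hv | hv
  · have hle : x ≤ h * |v| := by
      rw [abs_of_neg hv]
      by_contra hcon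
      exact hexit ⟨by nlinarith, by nlinarith⟩
    have hz : Ψ (0, v, s) = 0 := hout _ (Or.inl (by simp [hv, hs0, hst]))
    obtain ⟨c, hc, hc'⟩ := exists_hasDerivAt_eq_slope (fun y => Ψ (y, v, s))
      (fun y => Ψx (y, v, s)) hx.1 (by fun_prop)
      (fun y hy => hj.deriv_x y v s (hm y hy.1 (hy.2.trans hx.2)))
    rw [hz, sub_zero, sub_zero] at hc'
    have : Ψ (x, v, s) = Ψx (c, v, s) * x := by rw [hc', div_mul_cancel₀ _ hx.1.ne']
    simp only [this, abs_mul, abs_of_pos hx.1]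
    exact mul_le_mul (hj.bdd_x _) hle hx.1.le hC
  · subst hv
    exact absurd (by simpa using hx) hexit
  · have hle : 1 - x ≤ h * |v| := by
      rw [abs_of_pos hv]
      by_contra hcon
      exact hexit ⟨by nlinarith [mul_pos hh hv], by nlinarith⟩
    have hz : Ψ (1, v, s) = 0 := hout _ (Or.inr (by simp [hv, hs0, hst]))
    obtain ⟨c, hc, hc'⟩ := exists_hasDerivAt_eq_slope (fun y => Ψ (y, v, s))
      (fun y => Ψx (y, v, s)) hx.2 (by fun_prop)
      (fun y hy => hj.deriv_x y v s (hm y (hx.1.trans hy.1) hy.2))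
    rw [hz, zero_sub] at hc'
    have h1x : 0 < 1 - x := sub_pos.2 hx.2
    have : Ψ (x, v, s) = -(Ψx (c, v, s) * (1 - x)) := by rw [hc', div_mul_cancel₀ _ h1x.ne', neg_neg]
    simp only [this, abs_neg, abs_mul, abs_of_pos h1x]
    exact mul_le_mul (hj.bdd_x _) hle h1x.le hC

end Consistency

end FokkerPlanck

namespace FokkerPlanck

open Filter Topology

section Consistency

variable {t R C : ℝ} {Ψ Ψx Ψv Ψvv Ψs : ℝ × ℝ × ℝ → ℝ}

/-- Starting points `(x, v)`, `|v| ≤ V`, that leave the strip under free transport of duration `h`. -/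
def exitSet (h V : ℝ) : Set (ℝ × ℝ) :=
  {z | (0 < z.1 ∧ z.1 < 1) ∧ |z.2| ≤ V ∧ ¬ (0 < z.1 + h * z.2 ∧ z.1 + h * z.2 < 1)}

lemma measurableSet_exitSet (h V : ℝ) : MeasurableSet (exitSet h V) := by
  refine MeasurableSet.inter (MeasurableSet.inter ?_ ?_) (MeasurableSet.inter ?_ ?_)
  · exact measurableSet_lt measurable_const measurable_fst
  · exact measurableSet_lt measurable_fst measurable_const
  · exact measurableSet_le (f := fun z : ℝ × ℝ => |z.2|) (by fun_prop) measurable_const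
  · refine MeasurableSet.compl (MeasurableSet.inter ?_ ?_)
    · exact measurableSet_lt (g := fun z : ℝ × ℝ => z.1 + h * z.2) measurable_const (by fun_prop)
    · exact measurableSet_lt (f := fun z : ℝ × ℝ => z.1 + h * z.2) (by fun_prop) measurable_const

/-- Exiting points lie within `hV` of a wall, that is in two rectangles. The consistency error there
is only `O(h)`, so this extra factor `h` is what makes their contribution `O(h²)` against a bounded
density. -/
lemma volume_exitSet_le {h V : ℝ} (hh : 0 < h) (hV : 0 ≤ V) :
    volume (exitSet h V) ≤ ENNReal.ofReal (4 * h * V ^ 2) := by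
  have hsub : exitSet h V ⊆
      Icc 0 (h * V) ×ˢ Icc (-V) V ∪ Icc (1 - h * V) 1 ×ˢ Icc (-V) V := by
    rintro ⟨x, v⟩ ⟨⟨h0, h1⟩, hv, hex⟩
    simp only at h0 h1 hv hex
    have hv' := abs_le.1 hv
    by_cases hc : 0 < x + h * v
    · right
      have : 1 ≤ x + h * v := by
        by_contra hcon
        exact hex ⟨hc, not_le.1 hcon⟩
      exact ⟨⟨by nlinarith, h1.le⟩, hv'⟩
    · left
      exact ⟨⟨h0.le, by nlinarith⟩, hv'⟩
  refine (measure_mono hsub).trans ((measure_union_le _ _).trans ?_)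
  have h1 : 0 ≤ h * V := by positivity
  have h2 : 0 ≤ h * V * V := by positivity
  rw [Measure.volume_eq_prod, Measure.prod_prod, Measure.prod_prod, Real.volume_Icc,
    Real.volume_Icc, Real.volume_Icc, ← ENNReal.ofReal_mul (by linarith),
    ← ENNReal.ofReal_mul (by linarith), ← ENNReal.ofReal_add (by linarith) (by linarith)]
  exact ENNReal.ofReal_le_ofReal (by linarith)

lemma IsTestJet.exists_modulus (hj : IsTestJet t R C Ψ Ψx Ψv Ψvv Ψs) {ω : ℝ} (hω : 0 < ω) :
    ∃ η > 0, ∀ p q, dist p q ≤ η →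
      |Ψx p - Ψx q| ≤ ω ∧ |Ψvv p - Ψvv q| ≤ ω ∧ |Ψs p - Ψs q| ≤ ω := by
  obtain ⟨a, ha, h1⟩ := Metric.uniformContinuous_iff.1 hj.uc_x ω hω
  obtain ⟨b, hb, h2⟩ := Metric.uniformContinuous_iff.1 hj.uc_vv ω hω
  obtain ⟨c, hc, h3⟩ := Metric.uniformContinuous_iff.1 hj.uc_s ω hω
  refine ⟨min a (min b c) / 2, by positivity, fun p q hpq => ?_⟩
  have hlt : dist p q < min a (min b c) := lt_of_le_of_lt hpq (half_lt_self (by positivity))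
  rw [lt_min_iff, lt_min_iff] at hlt
  exact ⟨(h1 hlt.1).le, (h2 hlt.2.1).le, (h3 hlt.2.2).le⟩

lemma IsTestJet.supp_backwardOp (hj : IsTestJet t R C Ψ Ψx Ψv Ψvv Ψs) {p : ℝ × ℝ × ℝ}
    (hp : R < |p.2.1|) : backwardOp Ψx Ψvv Ψs p = 0 := by
  simp [backwardOp, hj.supp_x p hp, hj.supp_vv p hp, hj.supp_s p hp]

lemma IsTestJet.continuous_backwardOp (hj : IsTestJet t R C Ψ Ψx Ψv Ψvv Ψs) :
    Continuous (backwardOp Ψx Ψvv Ψs) := by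
  have := hj.uc_x.continuous
  have := hj.uc_vv.continuous
  have := hj.uc_s.continuous
  unfold backwardOp
  fun_prop

lemma IsTestJet.backwardOp_bdd (hj : IsTestJet t R C Ψ Ψx Ψv Ψvv Ψs) (hR : 0 < R)
    (p : ℝ × ℝ × ℝ) : |backwardOp Ψx Ψvv Ψs p| ≤ C * (R + 2) := by
  have hC : 0 ≤ C := (abs_nonneg _).trans (hj.bdd p)
  rcases lt_or_ge R |p.2.1| with h | h
  · rw [hj.supp_backwardOp h, abs_zero]; positivity
  · have h1 := hj.bdd_x p
    have h2 := hj.bdd_vv p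
    have h3 := hj.bdd_s p
    have h4 : |p.2.1 * Ψx p| ≤ R * C := by
      rw [abs_mul]
      exact mul_le_mul h h1 (abs_nonneg _) hR.le
    unfold backwardOp
    calc _ ≤ |Ψs p| + |p.2.1 * Ψx p| + |Ψvv p| := abs_add_three _ _ _
      _ ≤ _ := by linarith

/-- Pointwise consistency of one step of the scheme. -/
lemma IsTestJet.stepDual_error (hj : IsTestJet t R C Ψ Ψx Ψv Ψvv Ψs) (ht : 0 < t) (hR : 0 < R)
    (hout : ∀ p ∈ outgoing t, Ψ p = 0) {h ω η : ℝ} (hω0 : 0 ≤ ω)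
    (hη : ∀ p q, dist p q ≤ η →
      |Ψx p - Ψx q| ≤ ω ∧ |Ψvv p - Ψvv q| ≤ ω ∧ |Ψs p - Ψs q| ≤ ω)
    (hh : 0 < h) (hh1 : √(2 * h) ≤ 1) (hhη : √(2 * h) ≤ η) (hhη' : h * (R + 2) ≤ η)
    {s : ℝ} (hs0 : 0 ≤ s) (hst : s + h ≤ t) {z : ℝ × ℝ} (hz : z ∈ strip) :
    |stepDual h (fun y => Ψ (y.1, y.2, s + h)) z - Ψ (z.1, z.2, s)
        - h * backwardOp Ψx Ψvv Ψs (z.1, z.2, s)|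
      ≤ h * (ω * (2 * R + 6)) + (exitSet h (R + 1)).indicator (fun _ => h * (C * (2 * R + 3))) z := by
  obtain ⟨x, v⟩ := z
  rw [mem_strip] at hz
  simp only at hz
  have hC : 0 ≤ C := (abs_nonneg _).trans (hj.bdd 0)
  set a := √(2 * h) with ha
  have ha0 : 0 ≤ a := Real.sqrt_nonneg _
  have ha2 : a ^ 2 = 2 * h := Real.sq_sqrt (by positivity)
  have hη0 : 0 ≤ η := ha0.trans hhη
  have hpos : 0 ≤ h * (ω * (2 * R + 6)) := by positivity
  have hind : 0 ≤ (exitSet h (R + 1)).indicator (fun _ => h * (C * (2 * R + 3))) (x, v) :=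
    indicator_nonneg (fun _ _ => by positivity) _
  -- Three cases: for `|v| > R + 1` a jump of size at most one stays outside the support and
  -- everything vanishes; otherwise the point either stays in the strip, where Taylor expansion
  -- applies, or exits, where all terms are `O(h)`.
  rcases lt_or_ge (R + 1) |v| with hv | hv
  · have hb : ∀ w : ℝ, |w| ≤ 1 → R < |v + w| := by
      intro w hw
      have := abs_sub_abs_le_abs_sub v (-w)
      rw [abs_neg, sub_neg_eq_add] at this
      linarith
    have e1 : stepDual h (fun y => Ψ (y.1, y.2, s + h)) (x, v) = 0 := by
      unfold stepDual
      refine indicator_apply_eq_zero.2 fun _ => ?_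
      have u1 := hj.supp (x + h * v, v + a, s + h) (hb a (by rwa [abs_of_nonneg ha0]))
      have u2 := hj.supp (x + h * v, v - a, s + h)
        (by
          have := hb (-a) (by rwa [abs_neg, abs_of_nonneg ha0])
          rwa [← sub_eq_add_neg] at this)
      simp [← ha, u1, u2]
    have hRv : R < |v| := by linarith
    rw [e1, hj.supp (x, v, s) hRv, hj.supp_backwardOp (p := (x, v, s)) hRv]
    simp only [sub_zero, mul_zero, abs_zero]
    linarith
  by_cases hex : 0 < x + h * v ∧ x + h * v < 1
  · have hD : stepDual h (fun y => Ψ (y.1, y.2, s + h)) (x, v)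
        = (Ψ (x + h * v, v + a, s + h) + Ψ (x + h * v, v - a, s + h)) / 2 := by
      unfold stepDual
      rw [indicator_of_mem (mem_strip.2 hex)]
      simp [← ha]
    have hhv : |h * v| ≤ η := by
      rw [abs_mul, abs_of_pos hh]
      nlinarith
    have hhle : h ≤ η := by nlinarith
    -- The expansion goes through the intermediate points `(x + hv, v, s + h)` and `(x, v, s + h)`,
    -- so one variable moves at a time; the last two estimates carry `Ψvv` and `Ψx` back to `(x, v,
    -- s)`.
    have t1 := hj.second_difference ht (a := a) (ω := ω) ha0
      (fun x v s w hw => (hη _ _ (by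
        simp only [Prod.dist_eq, dist_self, Real.dist_eq, add_sub_cancel_left]
        exact max_le hη0 (max_le (hw.trans hhη) hη0))).2.1) hex (s := s + h) (v := v)
      (by linarith) hst
    have t2 := hj.x_difference ht (ω := ω) (x := x) (y := x + h * v) (v := v) (s := s + h)
      (fun y' hy' r => (hη _ _ (by
        simp only [Prod.dist_eq, dist_self, Real.dist_eq]
        rw [add_sub_cancel_left] at hy'
        exact max_le (hy'.trans hhv) (by simpa using hη0))).1) hz hex (by linarith) hst
    have t3 := hj.s_difference (ω := ω) (x := x) (v := v) (s := s) hh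
      (fun r hr => (hη _ _ (by
        simp only [Prod.dist_eq, dist_self, Real.dist_eq]
        exact max_le hη0 (max_le hη0 (hr.trans hhle)))).2.2) hz hs0 hst
    have t4 := (hη (x + h * v, v, s + h) (x, v, s) (by
        simp only [Prod.dist_eq, dist_self, Real.dist_eq, add_sub_cancel_left]
        exact max_le hhv (max_le hη0 (by rwa [abs_of_pos hh])))).2.1
    have t5 := (hη (x, v, s + h) (x, v, s) (by
        simp only [Prod.dist_eq, dist_self, Real.dist_eq, add_sub_cancel_left]
        exact max_le hη0 (max_le hη0 (by rwa [abs_of_pos hh])))).1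
    rw [add_sub_cancel_left] at t2
    rw [ha2] at t1
    rw [hD]
    unfold backwardOp
    simp only
    have t2' : ω * |h * v| ≤ ω * (h * (R + 1)) := by
      rw [abs_mul, abs_of_pos hh]; gcongr
    have t4' : |h * (Ψvv (x + h * v, v, s + h) - Ψvv (x, v, s))| ≤ h * ω := by
      rw [abs_mul, abs_of_pos hh]; gcongr
    have t5' : |h * v * (Ψx (x, v, s + h) - Ψx (x, v, s))| ≤ h * (R + 1) * ω := by
      rw [abs_mul, abs_mul, abs_of_pos hh]; gcongr
    -- The errors, in units of `hω`, are `2` (half of the second difference), `R + 1`, `1`, `1` and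
    -- `R + 1`: in total `2R + 6`.
    rw [abs_le] at t1 t2 t3 t4' t5' ⊢
    constructor <;> linarith [t1.1, t1.2, t2.1, t2.2, t3.1, t3.2, t4'.1, t4'.2, t5'.1, t5'.2]
  · have hD : stepDual h (fun y => Ψ (y.1, y.2, s + h)) (x, v) = 0 := by
      unfold stepDual
      exact indicator_of_notMem (fun hm => hex (mem_strip.1 hm)) _
    have hmem : (x, v) ∈ exitSet h (R + 1) := ⟨hz, hv, hex⟩
    rw [hD, indicator_of_mem hmem, zero_sub]
    have u1 := hj.exit_bound ht hout hh hz hex hs0 (by linarith)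
    have u2 := hj.backwardOp_bdd hR (x, v, s)
    have u3 : C * (h * |v|) ≤ C * (h * (R + 1)) := by gcongr
    calc _ ≤ |Ψ (x, v, s)| + |h * backwardOp Ψx Ψvv Ψs (x, v, s)| := by
          rw [← abs_neg (Ψ (x, v, s))]; exact abs_sub _ _
      _ ≤ C * (h * (R + 1)) + h * (C * (R + 2)) := by
          rw [abs_mul, abs_of_pos hh]
          gcongr
          exact u1.trans u3
      _ ≤ _ := by nlinarith

lemma IsDensity.integrable_mul {M A : ℝ} {q : ℝ × ℝ → ℝ} (hq : IsDensity M A q)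
    {φ : ℝ × ℝ → ℝ} (hφ : Measurable φ) {B : ℝ} (hB : ∀ z, |φ z| ≤ B) :
    Integrable fun z => q z * φ z :=
  hq.int.mul_bdd hφ.aestronglyMeasurable (.of_forall hB)

lemma IsDensity.continuous_integral {M A : ℝ} {q : ℝ × ℝ → ℝ} (hq : IsDensity M A q)
    {Φ : ℝ × ℝ × ℝ → ℝ} (hΦ : Continuous Φ) {B : ℝ} (hB : ∀ z, |Φ z| ≤ B) :
    Continuous fun r => ∫ z, q z * Φ (z.1, z.2, r) := by
  refine continuous_of_dominated (bound := fun z => q z * B) (fun r => ?_) (fun r => ?_)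
    (hq.int.mul_const B) (.of_forall fun z => by fun_prop)
  · exact (hq.meas.mul (by fun_prop)).aestronglyMeasurable
  · refine .of_forall fun z => ?_
    rw [Real.norm_eq_abs, abs_mul, abs_of_nonneg (hq.nonneg z)]
    exact mul_le_mul_of_nonneg_left (hB _) (hq.nonneg z)

/-- Consistency of the scheme, uniformly in the density. -/
lemma IsTestJet.step_error (hj : IsTestJet t R C Ψ Ψx Ψv Ψvv Ψs) (ht : 0 < t) (hR : 0 < R)
    (hout : ∀ p ∈ outgoing t, Ψ p = 0) {M A : ℝ} (hM : 0 ≤ M) (hA : 0 ≤ A) {ε : ℝ} (hε : 0 < ε) :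
    ∃ h₀ > 0, ∀ h, 0 < h → h ≤ h₀ → ∀ s, 0 ≤ s → s + h ≤ t → ∀ q, IsDensity M A q →
      |(∫ z, step h q z * Ψ (z.1, z.2, s + h)) - (∫ z, q z * Ψ (z.1, z.2, s))
        - ∫ r in s..s + h, ∫ z, q z * backwardOp Ψx Ψvv Ψs (z.1, z.2, r)| ≤ ε * h := by
  have hC : 0 ≤ C := (abs_nonneg _).trans (hj.bdd 0)
  -- The modulus enters with coefficient `A ((2R + 6) + (R + 2))`, from Taylor expansion and from
  -- freezing the time in the integral. This choice spends at most `ε / 2` on it.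
  set ω := ε / (2 * (A * (3 * R + 8) + 1)) with hω
  have hω0 : 0 < ω := by positivity
  obtain ⟨η, hη0, hη⟩ := hj.exists_modulus hω0
  -- Exiting points cost at most `h² K`: the density is at most `M`, the pointwise error at most `h
  -- C (2R + 3)`, the measure at most `4h (R + 1)²`. The last constraint on the step makes `h K ≤ ε
  -- / 2`.
  set K := M * C * (2 * R + 3) * (4 * (R + 1) ^ 2) with hK
  have hK0 : 0 ≤ K := by positivity
  refine ⟨min (min (1 / 2) (η ^ 2 / 2)) (min (η / (R + 2)) (ε / (2 * (K + 1)))), by positivity, ?_⟩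
  intro h hh hle s hs0 hst q hq
  rw [le_min_iff, le_min_iff, le_min_iff] at hle
  obtain ⟨⟨hl1, hl2⟩, hl3, hl4⟩ := hle
  have hh1 : √(2 * h) ≤ 1 := Real.sqrt_le_one.2 (by linarith)
  have hhη : √(2 * h) ≤ η := by
    rw [Real.sqrt_le_left hη0.le]; linarith
  have hhη' : h * (R + 2) ≤ η := by rwa [le_div_iff₀ (by positivity)] at hl3
  have cΨ := hj.uc.continuous
  have cΛ := hj.continuous_backwardOp
  set Λ := backwardOp Ψx Ψvv Ψs with hΛ
  have bΛ : ∀ p, |Λ p| ≤ C * (R + 2) := hj.backwardOp_bdd hR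
  have mΨ : ∀ r, Measurable fun z : ℝ × ℝ => Ψ (z.1, z.2, r) := fun r =>
    (by fun_prop : Continuous fun z : ℝ × ℝ => Ψ (z.1, z.2, r)).measurable
  have mΛ : ∀ r, Measurable fun z : ℝ × ℝ => Λ (z.1, z.2, r) := fun r =>
    (by fun_prop : Continuous fun z : ℝ × ℝ => Λ (z.1, z.2, r)).measurable
  have cG := hq.continuous_integral cΛ bΛ
  set G : ℝ → ℝ := fun r => ∫ z, q z * Λ (z.1, z.2, r) with hG
  set D := stepDual h (fun y => Ψ (y.1, y.2, s + h)) with hD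
  have mD : Measurable D := by
    have : Measurable (strip.indicator fun y : ℝ × ℝ =>
        (Ψ ((y + (0, √(2 * h))).1, (y + (0, √(2 * h))).2, s + h)
          + Ψ ((y - (0, √(2 * h))).1, (y - (0, √(2 * h))).2, s + h)) / 2) := by
      refine Measurable.indicator ?_ measurableSet_strip
      exact ((by fun_prop : Continuous fun y : ℝ × ℝ => (Ψ ((y + (0, √(2 * h))).1,
        (y + (0, √(2 * h))).2, s + h) + Ψ ((y - (0, √(2 * h))).1,
        (y - (0, √(2 * h))).2, s + h)) / 2)).measurable
    exact this.comp (by fun_prop : Measurable fun z : ℝ × ℝ => (z.1 + h * z.2, z.2))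
  have bD : ∀ z, |D z| ≤ C := by
    intro z
    rw [hD]; unfold stepDual
    by_cases hm : (z.1 + h * z.2, z.2) ∈ strip
    · rw [indicator_of_mem hm, abs_div, abs_two, div_le_iff₀ two_pos]
      refine (abs_add_le _ _).trans ?_
      linarith [hj.bdd (((z.1 + h * z.2, z.2) + ((0 : ℝ), √(2 * h))).1,
          ((z.1 + h * z.2, z.2) + ((0 : ℝ), √(2 * h))).2, s + h),
        hj.bdd (((z.1 + h * z.2, z.2) - ((0 : ℝ), √(2 * h))).1,
          ((z.1 + h * z.2, z.2) - ((0 : ℝ), √(2 * h))).2, s + h)]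
    · rw [indicator_of_notMem hm, abs_zero]
      exact hC
  have e1 : ∫ z, step h q z * Ψ (z.1, z.2, s + h) = ∫ z, q z * D z :=
    hq.integral_step_mul (mΨ _) (fun z => hj.bdd _)
  have i1 := hq.integrable_mul mD bD
  have i2 := hq.integrable_mul (mΨ s) (fun z => hj.bdd _)
  have i3 := hq.integrable_mul (mΛ s) (fun z => bΛ _)
  have mE := measurableSet_exitSet h (R + 1)
  have vE := volume_exitSet_le hh (by positivity : 0 ≤ R + 1)
  have fE : volume (exitSet h (R + 1)) ≠ ∞ := (vE.trans_lt ENNReal.ofReal_lt_top).ne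
  have iE : Integrable ((exitSet h (R + 1)).indicator fun _ => M * (h * (C * (2 * R + 3)))) :=
    (integrable_indicator_iff mE).2 (integrableOn_const fE)
  have est1 : |(∫ z, q z * D z) - (∫ z, q z * Ψ (z.1, z.2, s)) - h * G s|
      ≤ h * (ω * (2 * R + 6)) * A + h * h * K := by
    have : (∫ z, q z * D z) - (∫ z, q z * Ψ (z.1, z.2, s)) - h * G s
        = ∫ z, q z * (D z - Ψ (z.1, z.2, s) - h * Λ (z.1, z.2, s)) := by
      rw [hG]
      simp only
      rw [← integral_const_mul, ← integral_sub i1 i2, ← integral_sub (f := fun z => q z * D z - q z * Ψ (z.1, z.2, s))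
        (i1.sub i2) (i3.const_mul h)]
      refine integral_congr_ae (.of_forall fun z => ?_)
      simp only; ring
    rw [this, ← Real.norm_eq_abs]
    refine (norm_integral_le_of_norm_le (g := fun z => q z * (h * (ω * (2 * R + 6)))
      + (exitSet h (R + 1)).indicator (fun _ => M * (h * (C * (2 * R + 3)))) z)
      ((hq.int.mul_const _).add iE) (.of_forall fun z => ?_)).trans ?_
    · by_cases hz : z ∈ strip
      · have := hj.stepDual_error ht hR hout hω0.le hη hh hh1 hhη hhη' hs0 hst hz
        rw [norm_mul, Real.norm_eq_abs, Real.norm_eq_abs, abs_of_nonneg (hq.nonneg z)]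
        refine (mul_le_mul_of_nonneg_left this (hq.nonneg z)).trans ?_
        rw [mul_add]
        gcongr
        by_cases hzE : z ∈ exitSet h (R + 1)
        · rw [indicator_of_mem hzE, indicator_of_mem hzE]
          exact mul_le_mul_of_nonneg_right (hq.le z) (by positivity)
        · rw [indicator_of_notMem hzE, indicator_of_notMem hzE, mul_zero]
      · rw [hq.zero z hz]
        simp only [zero_mul, norm_zero, zero_add]
        exact indicator_nonneg (fun _ _ => by positivity) _
    · rw [integral_add (hq.int.mul_const _) iE, integral_mul_const, integral_indicator mE,
        setIntegral_const, smul_eq_mul]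
      have r1 : (∫ z, q z) * (h * (ω * (2 * R + 6))) ≤ A * (h * (ω * (2 * R + 6))) :=
        mul_le_mul_of_nonneg_right hq.mass (by positivity)
      have r2 : volume.real (exitSet h (R + 1)) ≤ 4 * h * (R + 1) ^ 2 :=
        ENNReal.toReal_le_of_le_ofReal (by positivity) vE
      have r3 : volume.real (exitSet h (R + 1)) * (M * (h * (C * (2 * R + 3))))
          ≤ 4 * h * (R + 1) ^ 2 * (M * (h * (C * (2 * R + 3)))) :=
        mul_le_mul_of_nonneg_right r2 (by positivity)
      have : 4 * h * (R + 1) ^ 2 * (M * (h * (C * (2 * R + 3)))) = h * h * K := by rw [hK]; ring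
      linarith
  have est2 : |(∫ r in s..s + h, G r) - h * G s| ≤ ω * (R + 2) * A * h := by
    have : (∫ r in s..s + h, G r) - h * G s = ∫ r in s..s + h, (G r - G s) := by
      rw [intervalIntegral.integral_sub (cG.intervalIntegrable _ _) intervalIntegrable_const,
        intervalIntegral.integral_const]
      simp
    rw [this, ← Real.norm_eq_abs]
    refine (intervalIntegral.norm_integral_le_of_norm_le_const (C := ω * (R + 2) * A) ?_).trans ?_
    · intro r hr
      rw [uIoc_of_le (by linarith)] at hr
      have hd : dist r s ≤ η := by
        rw [Real.dist_eq, abs_of_pos (sub_pos.2 hr.1)]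
        nlinarith [hr.2]
      have ir := hq.integrable_mul (mΛ r) (fun z => bΛ _)
      rw [hG]
      simp only
      rw [← integral_sub ir i3]
      refine (norm_integral_le_of_norm_le (g := fun z => q z * (ω * (R + 2)))
        (hq.int.mul_const _) (.of_forall fun z => ?_)).trans ?_
      · rw [← mul_sub, norm_mul, Real.norm_eq_abs, Real.norm_eq_abs, abs_of_nonneg (hq.nonneg z)]
        refine mul_le_mul_of_nonneg_left ?_ (hq.nonneg z)
        rcases lt_or_ge R |z.2| with hv | hv
        · rw [hΛ, hj.supp_backwardOp (p := (z.1, z.2, r)) hv,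
            hj.supp_backwardOp (p := (z.1, z.2, s)) hv, sub_zero, abs_zero]
          positivity
        · obtain ⟨w1, w2, w3⟩ := hη (z.1, z.2, r) (z.1, z.2, s) (by
            simp only [Prod.dist_eq, dist_self]
            exact max_le hη0.le (max_le hη0.le hd))
          have : Λ (z.1, z.2, r) - Λ (z.1, z.2, s)
              = (Ψs (z.1, z.2, r) - Ψs (z.1, z.2, s))
                + z.2 * (Ψx (z.1, z.2, r) - Ψx (z.1, z.2, s))
                + (Ψvv (z.1, z.2, r) - Ψvv (z.1, z.2, s)) := by
            simp only [hΛ, backwardOp]; ring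
          rw [this]
          refine (abs_add_three _ _ _).trans ?_
          rw [abs_mul]
          have : |z.2| * |Ψx (z.1, z.2, r) - Ψx (z.1, z.2, s)| ≤ R * ω := by gcongr
          linarith
      · rw [integral_mul_const, mul_comm]
        exact mul_le_mul_of_nonneg_left hq.mass (by positivity)
    · simp [abs_of_pos hh]
  rw [e1]
  have fin : h * (ω * (2 * R + 6)) * A + h * h * K + ω * (R + 2) * A * h ≤ ε * h := by
    have f1 : ω * (2 * (A * (3 * R + 8) + 1)) = ε := by
      rw [hω, div_mul_cancel₀ _ (by positivity)]
    have f2 : h * (2 * (K + 1)) ≤ ε := by rwa [le_div_iff₀ (by positivity)] at hl4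
    have f3 : h * (h * (2 * (K + 1))) ≤ h * ε := mul_le_mul_of_nonneg_left f2 hh.le
    have f4 : h * (ω * (2 * R + 6)) * A + ω * (R + 2) * A * h = h * (ω * (A * (3 * R + 8))) := by
      ring
    have f5 : h * (ω * (2 * (A * (3 * R + 8) + 1))) = h * ε := by rw [f1]
    nlinarith [mul_pos hh hh, mul_pos hh hω0]
  rw [abs_le] at est1 est2 ⊢
  constructor <;> linarith [est1.1, est1.2, est2.1, est2.2]

end Consistency

end FokkerPlanck

/-! ### Iterating the scheme: global consistency, and weak compactness -/

namespace FokkerPlanck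

open Filter Topology

/-- The approximate solution produced by the splitting scheme with time step `h`. -/
noncomputable def approx (h : ℝ) (q : ℝ × ℝ → ℝ) (s : ℝ) : ℝ × ℝ → ℝ := (step h)^[⌊s / h⌋₊] q

lemma IsDensity.iterate {M A h : ℝ} (hM : 0 ≤ M) {q : ℝ × ℝ → ℝ} (hq : IsDensity M A q) (n : ℕ) :
    IsDensity M A ((FokkerPlanck.step h)^[n] q) := by
  induction n with
  | zero => exact hq
  | succ n ih =>
    rw [Function.iterate_succ_apply']
    exact ih.step hM

lemma IsDensity.approx {M A h : ℝ} (hM : 0 ≤ M) {q : ℝ × ℝ → ℝ} (hq : IsDensity M A q) (s : ℝ) :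
    IsDensity M A (approx h q s) := hq.iterate hM _

lemma IsDensity.measurable_approx {M A h : ℝ} (hM : 0 ≤ M) {q : ℝ × ℝ → ℝ}
    (hq : IsDensity M A q) :
    Measurable fun p : (ℝ × ℝ) × ℝ => FokkerPlanck.approx h q p.2 p.1 := by
  have h1 : Measurable fun p : ℕ × (ℝ × ℝ) => (FokkerPlanck.step h)^[p.1] q p.2 :=
    measurable_from_prod_countable_right fun n => (hq.iterate hM n).meas
  have h2 : Measurable fun p : (ℝ × ℝ) × ℝ => (⌊p.2 / h⌋₊, p.1) :=
    (Nat.measurable_floor.comp (measurable_snd.div_const h)).prodMk measurable_fst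
  exact h1.comp h2

lemma approx_eq_iterate {h s : ℝ} (hh : 0 < h) {q : ℝ × ℝ → ℝ} {k : ℕ}
    (h0 : k * h ≤ s) (h1 : s < (k + 1) * h) : approx h q s = (step h)^[k] q := by
  have : ⌊s / h⌋₊ = k := by
    rw [Nat.floor_eq_iff (div_nonneg ((by positivity : (0 : ℝ) ≤ k * h).trans h0) hh.le)]
    exact ⟨(le_div_iff₀ hh).2 h0, (div_lt_iff₀ hh).2 h1⟩
  rw [approx, this]

lemma IsDensity.abs_integral_mul_le {M A : ℝ} {q : ℝ × ℝ → ℝ} (hq : IsDensity M A q)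
    {φ : ℝ × ℝ → ℝ} {B : ℝ} (hB0 : 0 ≤ B) (hB : ∀ z, |φ z| ≤ B) :
    |∫ z, q z * φ z| ≤ A * B := by
  rw [← Real.norm_eq_abs]
  refine (norm_integral_le_of_norm_le (g := fun z => q z * B)
    (hq.int.mul_const _) (.of_forall fun z => ?_)).trans ?_
  · rw [norm_mul, Real.norm_eq_abs, Real.norm_eq_abs, abs_of_nonneg (hq.nonneg z)]
    exact mul_le_mul_of_nonneg_left (hB z) (hq.nonneg z)
  · rw [integral_mul_const]
    exact mul_le_mul_of_nonneg_right hq.mass hB0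

section Consistency

variable {t R C : ℝ} {Ψ Ψx Ψv Ψvv Ψs : ℝ × ℝ × ℝ → ℝ}

lemma IsDensity.intervalIntegrable_approx {M A h : ℝ} (hM : 0 ≤ M) {q : ℝ × ℝ → ℝ}
    (hq : IsDensity M A q) {Φ : ℝ × ℝ × ℝ → ℝ} (hΦ : Continuous Φ) {B : ℝ}
    (hB : ∀ z, |Φ z| ≤ B) (a b : ℝ) :
    IntervalIntegrable (fun r => ∫ z, FokkerPlanck.approx h q r z * Φ (z.1, z.2, r))
      volume a b := by
  have hB0 : 0 ≤ B := (abs_nonneg _).trans (hB 0)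
  have hm : StronglyMeasurable
      (fun r => ∫ z, FokkerPlanck.approx h q r z * Φ (z.1, z.2, r)) := by
    refine StronglyMeasurable.integral_prod_right (f := fun r (z : ℝ × ℝ) =>
      FokkerPlanck.approx h q r z * Φ (z.1, z.2, r)) ?_
    refine Measurable.stronglyMeasurable ?_
    refine ((hq.measurable_approx hM).comp measurable_swap).mul ?_
    exact (by fun_prop : Continuous fun p : ℝ × ℝ × ℝ => Φ (p.2.1, p.2.2, p.1)).measurable
  refine (intervalIntegrable_const (c := A * B)).mono_fun hm.aestronglyMeasurable ?_
  refine .of_forall fun r => ?_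
  simp only [Real.norm_eq_abs]
  exact ((hq.approx hM r).abs_integral_mul_le hB0 (fun z => hB _)).trans (le_abs_self _)

/-- The approximate solutions satisfy the weak formulation up to a small error. -/
lemma IsTestJet.scheme_error (hj : IsTestJet t R C Ψ Ψx Ψv Ψvv Ψs) (ht : 0 < t) (hR : 0 < R)
    (hout : ∀ p ∈ outgoing t, Ψ p = 0) {M A : ℝ} (hM : 0 ≤ M) (hA : 0 ≤ A) {ε : ℝ} (hε : 0 < ε) :
    ∃ h₀ > 0, ∀ h, 0 < h → h ≤ h₀ → ∀ q, IsDensity M A q →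
      |(∫ z, approx h q t z * Ψ (z.1, z.2, t)) - (∫ z, q z * Ψ (z.1, z.2, 0))
        - ∫ r in 0..t, ∫ z, approx h q r z * backwardOp Ψx Ψvv Ψs (z.1, z.2, r)| ≤ ε := by
  have hC : 0 ≤ C := (abs_nonneg _).trans (hj.bdd 0)
  obtain ⟨h₁, h₁0, H1⟩ := hj.step_error ht hR hout hM hA (ε := ε / (3 * t)) (by positivity)
  obtain ⟨h₂, h₂0, H2⟩ := Metric.uniformContinuous_iff.1 hj.uc (ε / (3 * (A + 1))) (by positivity)
  refine ⟨min h₁ (min (h₂ / 2) (ε / (3 * (A * (C * (R + 2)) + 1)))), by positivity, ?_⟩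
  intro h hh hle q hq
  rw [le_min_iff, le_min_iff] at hle
  obtain ⟨hl1, hl2, hl3⟩ := hle
  have cΨ := hj.uc.continuous
  have cΛ := hj.continuous_backwardOp
  have bΛ := hj.backwardOp_bdd hR
  set Λ := backwardOp Ψx Ψvv Ψs with hΛ
  have mΨ : ∀ r, Measurable fun z : ℝ × ℝ => Ψ (z.1, z.2, r) := fun r =>
    (by fun_prop : Continuous fun z : ℝ × ℝ => Ψ (z.1, z.2, r)).measurable
  have iG := hq.intervalIntegrable_approx (h := h) hM cΛ bΛ
  set G : ℝ → ℝ := fun r => ∫ z, approx h q r z * Λ (z.1, z.2, r) with hG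
  -- Telescoping: at most `t / h` steps, each with error `ε h / (3t)`, give `ε / 3`. The remaining
  -- two thirds pay for the incomplete step between `n h` and `t`.
  have key : ∀ k : ℕ, k * h ≤ t →
      |(∫ z, (step h)^[k] q z * Ψ (z.1, z.2, k * h)) - (∫ z, q z * Ψ (z.1, z.2, 0))
        - ∫ r in 0..(k * h), G r| ≤ k * (ε / (3 * t) * h) := by
    intro k
    induction k with
    | zero => intro _; simp
    | succ k ih =>
      intro hk
      push_cast at hk ⊢
      have hk' : k * h ≤ t := by linarith
      have e1 := ih hk'
      have e2 := H1 h hh hl1 (k * h) (by positivity) (by linarith) _ (hq.iterate (h := h) hM k)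
      have hkk : (k + 1 : ℝ) * h = k * h + h := by ring
      rw [Function.iterate_succ_apply', hkk]
      have e3 : ∫ r in (k * h)..(k * h + h), ∫ z, (step h)^[k] q z * Λ (z.1, z.2, r)
          = ∫ r in (k * h)..(k * h + h), G r := by
        refine intervalIntegral.integral_congr_ae ?_
        -- The approximate solution is the `k`-th iterate on a half-open interval; the right
        -- endpoint is a null set.
        filter_upwards [Measure.ae_ne volume (k * h + h)] with r hr hr'
        rw [uIoc_of_le (by linarith)] at hr'
        rw [hG]
        simp only
        rw [approx_eq_iterate hh hr'.1.le (by rw [hkk]; exact lt_of_le_of_ne hr'.2 hr)]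
      rw [e3] at e2
      rw [← intervalIntegral.integral_add_adjacent_intervals (iG 0 (k * h)) (iG (k * h) (k * h + h))]
      rw [abs_le] at e1 e2 ⊢
      constructor <;> linarith [e1.1, e1.2, e2.1, e2.2]
  set n := ⌊t / h⌋₊ with hn
  have hn0 : n * h ≤ t := by
    rw [← le_div_iff₀ hh]; exact Nat.floor_le (by positivity)
  have hn1 : t < (n + 1) * h := by
    rw [← div_lt_iff₀ hh]; exact Nat.lt_floor_add_one _
  have ap : approx h q t = (step h)^[n] q := rfl
  have hqn := hq.iterate (h := h) hM n
  have E1 := key n hn0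
  have E2 : |(∫ z, (step h)^[n] q z * Ψ (z.1, z.2, t))
      - ∫ z, (step h)^[n] q z * Ψ (z.1, z.2, n * h)| ≤ A * (ε / (3 * (A + 1))) := by
    rw [← integral_sub (hqn.integrable_mul (mΨ _) (fun z => hj.bdd _))
      (hqn.integrable_mul (mΨ _) (fun z => hj.bdd _))]
    have : ∀ z : ℝ × ℝ, |Ψ (z.1, z.2, t) - Ψ (z.1, z.2, n * h)| ≤ ε / (3 * (A + 1)) := by
      intro z
      refine (H2 (a := (z.1, z.2, t)) (b := (z.1, z.2, n * h)) ?_).le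
      simp only [Prod.dist_eq, dist_self]
      refine max_lt h₂0 (max_lt h₂0 ?_)
      rw [Real.dist_eq, abs_of_nonneg (by linarith)]
      nlinarith
    have := hqn.abs_integral_mul_le (by positivity) this
    simpa only [mul_sub] using this
  have E3 : |∫ r in (n * h)..t, G r| ≤ A * (C * (R + 2)) * h := by
    rw [← Real.norm_eq_abs]
    refine (intervalIntegral.norm_integral_le_of_norm_le_const (C := A * (C * (R + 2))) ?_).trans ?_
    · intro r _
      exact (hq.approx hM r).abs_integral_mul_le (by positivity) (fun z => bΛ _)
    · rw [abs_of_nonneg (by linarith)]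
      exact mul_le_mul_of_nonneg_left (by linarith) (by positivity)
  rw [ap, ← intervalIntegral.integral_add_adjacent_intervals (iG 0 (n * h)) (iG (n * h) t)]
  have F1 : n * (ε / (3 * t) * h) ≤ ε / 3 := by
    have : n * (ε / (3 * t) * h) = (n * h) * (ε / (3 * t)) := by ring
    rw [this]
    refine (mul_le_mul_of_nonneg_right hn0 (by positivity)).trans (le_of_eq ?_)
    field_simp
  have F2 : A * (ε / (3 * (A + 1))) ≤ ε / 3 := by
    rw [mul_div_assoc', div_le_div_iff₀ (by positivity) (by positivity)]
    nlinarith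
  have F3 : A * (C * (R + 2)) * h ≤ ε / 3 := by
    rw [le_div_iff₀ (by positivity)] at hl3
    linarith
  rw [abs_le] at E1 E2 E3 ⊢
  constructor <;> linarith [E1.1, E1.2, E2.1, E2.2, E3.1, E3.2]

end Consistency

/-! ### Weak limits along an ultrafilter -/

lemma memLp_two_of_bounded {α : Type*} [MeasurableSpace α] {μ : Measure α} {f : α → ℝ} {M : ℝ}
    (hm : Measurable f) (h0 : ∀ a, 0 ≤ f a) (hM : ∀ a, f a ≤ M) (hi : Integrable f μ) :
    MemLp f 2 μ := by
  rw [memLp_two_iff_integrable_sq hm.aestronglyMeasurable]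
  refine (hi.const_mul M).mono' (hm.pow_const 2).aestronglyMeasurable (.of_forall fun a => ?_)
  rw [Real.norm_eq_abs, abs_of_nonneg (sq_nonneg _), sq]
  exact mul_le_mul_of_nonneg_right (hM a) (h0 a)

lemma inner_toLp {α : Type*} [MeasurableSpace α] {μ : Measure α} {f g : α → ℝ}
    (hf : MemLp f 2 μ) (hg : MemLp g 2 μ) :
    inner ℝ (hf.toLp f) (hg.toLp g) = ∫ a, f a * g a ∂μ := by
  rw [MeasureTheory.L2.inner_def]
  refine integral_congr_ae ?_
  filter_upwards [hf.coeFn_toLp, hg.coeFn_toLp] with a h1 h2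
  rw [h1, h2]
  simp [mul_comm]

/-- From `0 ≤ F ≤ M` and mass at most `A` one gets `‖F‖² ≤ M A` in `L²`, so Riesz and Banach-Alaoglu
apply. Convergence along a prescribed ultrafilter needs no subsequence; this permits limits at
uncountably many times at once. Pointwise bounds pass to the limit by testing with indicators of
sets of finite measure. -/
lemma exists_weak_limit {α : Type*} [MeasurableSpace α] (μ : Measure α) [SigmaFinite μ]
    (𝒰 : Ultrafilter ℕ) {F : ℕ → α → ℝ} {M A : ℝ} (hM : 0 ≤ M) (hm : ∀ n, Measurable (F n))
    (h0 : ∀ n a, 0 ≤ F n a) (hle : ∀ n a, F n a ≤ M) (hi : ∀ n, Integrable (F n) μ)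
    (hA : ∀ n, ∫ a, F n a ∂μ ≤ A) :
    ∃ G : α → ℝ, Measurable G ∧ (∀ a, 0 ≤ G a) ∧ (∀ a, G a ≤ M) ∧ Integrable G μ ∧
      ∫ a, G a ∂μ ≤ A ∧
      ∀ ξ, MemLp ξ 2 μ → Tendsto (fun n => ∫ a, F n a * ξ a ∂μ) 𝒰 (𝓝 (∫ a, G a * ξ a ∂μ)) := by
  have hF2 : ∀ n, MemLp (F n) 2 μ := fun n => memLp_two_of_bounded (hm n) (h0 n) (hle n) (hi n)
  set Φ : ℕ → StrongDual ℝ (Lp ℝ 2 μ) := fun n => InnerProductSpace.toDual ℝ _ ((hF2 n).toLp (F n))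
  have hΦ : ∀ n, Φ n ∈ Metric.closedBall (0 : StrongDual ℝ (Lp ℝ 2 μ)) (√(M * A)) := by
    intro n
    rw [mem_closedBall_zero_iff, LinearIsometryEquiv.norm_map]
    refine Real.le_sqrt_of_sq_le ?_
    rw [← real_inner_self_eq_norm_sq, inner_toLp]
    calc ∫ a, F n a * F n a ∂μ ≤ ∫ a, M * F n a ∂μ := by
          refine integral_mono_of_nonneg (.of_forall fun a => mul_nonneg (h0 n a) (h0 n a))
            ((hi n).const_mul M) (.of_forall fun a => ?_)
          exact mul_le_mul_of_nonneg_right (hle n a) (h0 n a)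
      _ ≤ M * A := by
          rw [integral_const_mul]
          exact mul_le_mul_of_nonneg_left (hA n) hM
  obtain ⟨ℓ, -, hℓ⟩ := (WeakDual.isCompact_closedBall
    (0 : StrongDual ℝ (Lp ℝ 2 μ)) (√(M * A))).ultrafilter_le_nhds
    (𝒰.map fun n => StrongDual.toWeakDual (Φ n)) (by
      rw [Ultrafilter.coe_map, le_principal_iff]
      exact Filter.mem_map.2 (univ_mem' hΦ))
  set g : Lp ℝ 2 μ := (InnerProductSpace.toDual ℝ _).symm (WeakDual.toStrongDual ℓ) with hg
  have hlim : ∀ ξ, MemLp ξ 2 μ →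
      Tendsto (fun n => ∫ a, F n a * ξ a ∂μ) 𝒰 (𝓝 (∫ a, g a * ξ a ∂μ)) := by
    intro ξ hξ
    have h1 : Tendsto (fun n => (StrongDual.toWeakDual (Φ n)) (hξ.toLp ξ)) 𝒰
        (𝓝 (ℓ (hξ.toLp ξ))) :=
      ((WeakDual.eval_continuous (𝕜 := ℝ) (hξ.toLp ξ)).tendsto ℓ).comp hℓ
    have h2 : ∀ n, (StrongDual.toWeakDual (Φ n)) (hξ.toLp ξ) = ∫ a, F n a * ξ a ∂μ := by
      intro n
      rw [← inner_toLp (hF2 n) hξ]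
      rfl
    have h3 : ℓ (hξ.toLp ξ) = ∫ a, g a * ξ a ∂μ := by
      have : ℓ (hξ.toLp ξ) = inner ℝ g (hξ.toLp ξ) := by
        rw [hg, InnerProductSpace.toDual_symm_apply]
        rfl
      rw [this, MeasureTheory.L2.inner_def]
      refine integral_congr_ae ?_
      filter_upwards [hξ.coeFn_toLp] with a h1
      rw [h1]
      simp [mul_comm]
    simpa only [h2, h3] using h1
  have hgm : MemLp g 2 μ := Lp.memLp g
  have hset : ∀ s, MeasurableSet s → μ s < ∞ →
      Tendsto (fun n => ∫ a in s, F n a ∂μ) 𝒰 (𝓝 (∫ a in s, g a ∂μ)) := by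
    intro s hs hμs
    have := hlim _ (memLp_indicator_const 2 hs (1 : ℝ) (Or.inr hμs.ne))
    have e : ∀ f : α → ℝ, ∫ a, f a * s.indicator (fun _ => (1 : ℝ)) a ∂μ = ∫ a in s, f a ∂μ := by
      intro f
      rw [← integral_indicator hs]
      refine integral_congr_ae (.of_forall fun a => ?_)
      by_cases ha : a ∈ s <;> simp [ha]
    simpa only [e] using this
  have hgon : ∀ s, MeasurableSet s → μ s < ∞ → IntegrableOn g s μ := by
    intro s hs hμs
    have : IsFiniteMeasure (μ.restrict s) := isFiniteMeasure_restrict.2 hμs.ne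
    exact (hgm.restrict s).integrable (by norm_num)
  have hg0 : 0 ≤ᵐ[μ] g := by
    refine ae_nonneg_of_forall_setIntegral_nonneg_of_sigmaFinite hgon fun s hs hμs => ?_
    exact ge_of_tendsto (hset s hs hμs) (.of_forall fun n =>
      setIntegral_nonneg hs fun a _ => h0 n a)
  have hgM : 0 ≤ᵐ[μ] fun a => M - g a := by
    have hc : ∀ s, μ s < ∞ → IntegrableOn (fun _ => M) s μ := fun s hμs =>
      integrableOn_const hμs.ne
    refine ae_nonneg_of_forall_setIntegral_nonneg_of_sigmaFinite
      (fun s hs hμs => (hc s hμs).sub (hgon s hs hμs)) fun s hs hμs => ?_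
    rw [integral_sub (hc s hμs) (hgon s hs hμs), sub_nonneg]
    refine le_of_tendsto (hset s hs hμs) (.of_forall fun n => ?_)
    exact setIntegral_mono_on (hi n).integrableOn (hc s hμs) hs fun a _ => hle n a
  obtain ⟨g', hg'm, hg'⟩ := hgm.aestronglyMeasurable.aemeasurable
  -- Clamping a measurable representative makes the bounds hold everywhere instead of almost
  -- everywhere.
  have hGg : (fun a => max 0 (min M (g' a))) =ᵐ[μ] g := by
    filter_upwards [hg', hg0, hgM] with a h1 h2 h3
    simp only [Pi.zero_apply, sub_nonneg] at h2 h3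
    rw [← h1, min_eq_right h3, max_eq_right h2]
  -- The constant `1` need not be in `L²`, so the mass is tested on an exhaustion by sets of finite
  -- measure.
  have cover : AECover μ atTop (spanningSets μ) :=
    ⟨.of_forall fun a => by
      filter_upwards [eventually_ge_atTop (spanningSetsIndex μ a)] with i hi'
      exact monotone_spanningSets μ hi' (mem_spanningSetsIndex μ a),
      fun i => measurableSet_spanningSets μ i⟩
  have hbound : ∀ i, ∫ a in spanningSets μ i, max 0 (min M (g' a)) ∂μ ≤ A := by
    intro i
    have : ∫ a in spanningSets μ i, max 0 (min M (g' a)) ∂μ = ∫ a in spanningSets μ i, g a ∂μ :=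
      integral_congr_ae (ae_restrict_of_ae hGg)
    rw [this]
    refine le_of_tendsto (hset _ (measurableSet_spanningSets μ i) (measure_spanningSets_lt_top μ i))
      (.of_forall fun n => ?_)
    exact (setIntegral_le_integral (hi n) (.of_forall (h0 n))).trans (hA n)
  have hint : Integrable (fun a => max 0 (min M (g' a))) μ := by
    refine cover.integrable_of_integral_norm_bounded A (fun i => ?_) (.of_forall fun i => ?_)
    · exact (hgon _ (measurableSet_spanningSets μ i) (measure_spanningSets_lt_top μ i)).congr
        (ae_restrict_of_ae hGg.symm)
    · simpa only [Real.norm_eq_abs, abs_of_nonneg (le_max_left (0 : ℝ) _)] using hbound i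
  refine ⟨fun a => max 0 (min M (g' a)), by fun_prop, fun a => le_max_left _ _,
    fun a => max_le hM (min_le_left _ _), hint, ?_, fun ξ hξ => ?_⟩
  · exact le_of_tendsto (cover.integral_tendsto_of_countably_generated hint) (.of_forall hbound)
  · have : ∫ a, max 0 (min M (g' a)) * ξ a ∂μ = ∫ a, g a * ξ a ∂μ :=
      integral_congr_ae (by filter_upwards [hGg] with a ha; rw [ha])
    rw [this]
    exact hlim ξ hξ

end FokkerPlanck

namespace FokkerPlanck

open Filter Topology
open scoped ContDiff

/-! ### Smooth compactly supported functions on the strip -/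

/-- A smooth function with compact support in the strip. -/
structure IsBump (φ : ℝ × ℝ → ℝ) : Prop where
  smooth : ContDiff ℝ ∞ φ
  compact : HasCompactSupport φ
  supp : tsupport φ ⊆ strip

lemma hasDerivAt_fst_of_contDiff {φ : ℝ × ℝ → ℝ} (h : Differentiable ℝ φ) (x v : ℝ) :
    HasDerivAt (fun y => φ (y, v)) (fderiv ℝ φ (x, v) (1, 0)) x :=
  (h (x, v)).hasFDerivAt.comp_hasDerivAt x ((hasDerivAt_id x).prodMk (hasDerivAt_const x v))

lemma hasDerivAt_snd_of_contDiff {φ : ℝ × ℝ → ℝ} (h : Differentiable ℝ φ) (x v : ℝ) :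
    HasDerivAt (fun w => φ (x, w)) (fderiv ℝ φ (x, v) (0, 1)) v :=
  (h (x, v)).hasFDerivAt.comp_hasDerivAt v ((hasDerivAt_const v x).prodMk (hasDerivAt_id v))

lemma IsBump.zero_off {φ : ℝ × ℝ → ℝ} (hφ : IsBump φ) {z : ℝ × ℝ} (hz : z ∉ strip) : φ z = 0 :=
  image_eq_zero_of_notMem_tsupport fun h => hz (hφ.supp h)

lemma exists_bound_snd {φ : ℝ × ℝ → ℝ} (hφ : HasCompactSupport φ) :
    ∃ R > 0, ∀ z : ℝ × ℝ, R < |z.2| → φ z = 0 := by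
  obtain ⟨R, hR⟩ := hφ.isCompact.isBounded.exists_norm_le
  refine ⟨max R 1, by positivity, fun z hz => image_eq_zero_of_notMem_tsupport fun h => ?_⟩
  have h1 := hR z h
  have h2 : |z.2| ≤ ‖z‖ := norm_snd_le z
  linarith [le_max_left R 1]

/-- Here `ℓ = v φ_x + φ_vv`. Only the time factors `1` and `s` are used later: the first describes
the evolution of averages, the second detects the slices of the space-time limit. The support inside
the open strip gives the boundary condition for free. -/
lemma IsBump.exists_generator {φ : ℝ × ℝ → ℝ} (hφ : IsBump φ) :
    ∃ ℓ : ℝ × ℝ → ℝ, Continuous ℓ ∧ HasCompactSupport ℓ ∧ ∀ α β t : ℝ,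
      IsTest t (fun p => (α + β * p.2.2) * φ (p.1, p.2.1)) ∧
      (∀ p ∈ outgoing t, (α + β * p.2.2) * φ (p.1, p.2.1) = 0) ∧
      ∀ p, dt (fun p => (α + β * p.2.2) * φ (p.1, p.2.1)) p
          + p.2.1 * dx (fun p => (α + β * p.2.2) * φ (p.1, p.2.1)) p
          + dv (dv (fun p => (α + β * p.2.2) * φ (p.1, p.2.1))) p
        = β * φ (p.1, p.2.1) + (α + β * p.2.2) * ℓ (p.1, p.2.1) := by
  have d0 : Differentiable ℝ φ := hφ.smooth.differentiable (by simp)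
  have s1 : ∀ e : ℝ × ℝ, ContDiff ℝ ∞ fun z => fderiv ℝ φ z e := fun e =>
    (hφ.smooth.fderiv_right (m := ∞) (by simp)).clm_apply contDiff_const
  set φx : ℝ × ℝ → ℝ := fun z => fderiv ℝ φ z (1, 0) with hφx
  set φv : ℝ × ℝ → ℝ := fun z => fderiv ℝ φ z (0, 1) with hφv
  have dv' : Differentiable ℝ φv := (s1 (0, 1)).differentiable (by simp)
  have s2 : ContDiff ℝ ∞ fun z => fderiv ℝ φv z (0, 1) :=
    ((s1 (0, 1)).fderiv_right (m := ∞) (by simp)).clm_apply contDiff_const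
  set φvv : ℝ × ℝ → ℝ := fun z => fderiv ℝ φv z (0, 1) with hφvv
  have c0 := hφ.smooth.continuous
  have cx : Continuous φx := (s1 (1, 0)).continuous
  have cv : Continuous φv := (s1 (0, 1)).continuous
  have cvv : Continuous φvv := s2.continuous
  have kx : HasCompactSupport φx := hφ.compact.fderiv_apply ℝ (1, 0)
  have kv : HasCompactSupport φv := hφ.compact.fderiv_apply ℝ (0, 1)
  have kvv : HasCompactSupport φvv := kv.fderiv_apply ℝ (0, 1)
  refine ⟨fun z => z.2 * φx z + φvv z, by fun_prop, (kx.mul_left).add kvv, fun α β t => ?_⟩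
  have e1 : ∀ x v s : ℝ, HasDerivAt (fun y => (α + β * s) * φ (y, v))
      ((α + β * s) * φx (x, v)) x := fun x v s =>
    (hasDerivAt_fst_of_contDiff d0 x v).const_mul _
  have e2 : ∀ x v s : ℝ, HasDerivAt (fun w => (α + β * s) * φ (x, w))
      ((α + β * s) * φv (x, v)) v := fun x v s =>
    (hasDerivAt_snd_of_contDiff d0 x v).const_mul _
  have e3 : ∀ x v s : ℝ, HasDerivAt (fun w => (α + β * s) * φv (x, w))
      ((α + β * s) * φvv (x, v)) v := fun x v s =>
    (hasDerivAt_snd_of_contDiff dv' x v).const_mul _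
  have e4 : ∀ x v s : ℝ, HasDerivAt (fun r => (α + β * r) * φ (x, v))
      (β * φ (x, v)) s := by
    intro x v s
    have := (((hasDerivAt_id s).const_mul β).const_add α).mul_const (φ (x, v))
    simpa using this
  refine ⟨⟨⟨by fun_prop, fun p => (α + β * p.2.2) * φx (p.1, p.2.1),
    fun p => (α + β * p.2.2) * φv (p.1, p.2.1), fun p => (α + β * p.2.2) * φvv (p.1, p.2.1),
    fun p => β * φ (p.1, p.2.1), by fun_prop, by fun_prop, by fun_prop, by fun_prop,
    fun x v s _ => ⟨e1 x v s, e2 x v s, e3 x v s, e4 x v s⟩⟩, ?_⟩, ?_, ?_⟩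
  · obtain ⟨R, hR, h⟩ := exists_bound_snd hφ.compact
    exact ⟨R, hR, fun p _ hp => by simp [h (p.1, p.2.1) hp]⟩
  · rintro ⟨x, v, s⟩ hp
    have : (x, v) ∉ strip := by
      rw [mem_strip]
      rcases hp with hp | hp
      · have : x = 0 := hp.1
        simp [this]
      · have : x = 1 := hp.1
        simp [this]
    simp [hφ.zero_off this]
  · rintro ⟨x, v, s⟩
    have f1 : dt (fun p => (α + β * p.2.2) * φ (p.1, p.2.1)) (x, v, s) = β * φ (x, v) :=
      (e4 x v s).deriv
    have f2 : dx (fun p => (α + β * p.2.2) * φ (p.1, p.2.1)) (x, v, s)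
        = (α + β * s) * φx (x, v) := (e1 x v s).deriv
    have f3 : dv (dv (fun p => (α + β * p.2.2) * φ (p.1, p.2.1))) (x, v, s)
        = (α + β * s) * φvv (x, v) := by
      have : (fun w => dv (fun p => (α + β * p.2.2) * φ (p.1, p.2.1)) (x, w, s))
          = fun w => (α + β * s) * φv (x, w) := by
        funext w
        exact (e2 x w s).deriv
      unfold dv at this ⊢
      simp only at this ⊢
      rw [this]
      exact (e3 x v s).deriv
    rw [f1, f2, f3]
    ring

instance : IsLocallyFiniteMeasure stripMeasure := by unfold stripMeasure; infer_instance

lemma locallyIntegrableOn_strip {d : ℝ × ℝ → ℝ} {p : ℝ≥0∞} (hd : MemLp d p stripMeasure)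
    (hp : 1 ≤ p) : LocallyIntegrableOn d strip := by
  intro z _
  obtain ⟨U, hU, h⟩ := hd.locallyIntegrable hp z
  refine ⟨U ∩ strip, inter_mem (mem_nhdsWithin_of_mem_nhds hU) self_mem_nhdsWithin, ?_⟩
  rwa [IntegrableOn, stripMeasure, Measure.restrict_restrict' measurableSet_strip] at h

/-- Smooth compactly supported functions separate points of `L²` of the strip. -/
lemma ae_eq_zero_of_forall_bump {d : ℝ × ℝ → ℝ} (hd : LocallyIntegrableOn d strip)
    (h : ∀ φ, IsBump φ → ∫ z, d z * φ z ∂stripMeasure = 0) : d =ᵐ[stripMeasure] 0 := by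
  have := isOpen_strip.ae_eq_zero_of_integral_contDiff_smul_eq_zero (μ := volume) hd
    fun φ h1 h2 h3 => ?_
  · rw [stripMeasure, EventuallyEq, ae_restrict_iff' measurableSet_strip]
    exact this
  · have e := h φ ⟨h1, h2, h3⟩
    rw [stripMeasure, setIntegral_eq_integral_of_forall_compl_eq_zero] at e
    · simpa only [smul_eq_mul, mul_comm] using e
    · intro z hz
      rw [IsBump.zero_off ⟨h1, h2, h3⟩ hz, mul_zero]

lemma measure_band_lt_top (R : ℝ) : stripMeasure {z | |z.2| ≤ R} < ⊤ := by
  have hm : MeasurableSet {z : ℝ × ℝ | |z.2| ≤ R} :=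
    measurableSet_le (f := fun z : ℝ × ℝ => |z.2|) (by fun_prop) measurable_const
  rw [stripMeasure, Measure.restrict_apply hm]
  refine (measure_mono (t := Icc 0 1 ×ˢ Icc (-R) R) ?_).trans_lt
    (isCompact_Icc.prod isCompact_Icc).measure_lt_top
  rintro ⟨x, v⟩ ⟨h1, h2⟩
  rw [mem_strip] at h2
  exact ⟨⟨h2.1.le, h2.2.le⟩, abs_le.1 h1⟩

lemma memLp_of_band {φ : ℝ × ℝ → ℝ} (hm : Measurable φ) {R C : ℝ} (h0 : ∀ z, R < |z.2| → φ z = 0)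
    (hC : ∀ z, |φ z| ≤ C) (p : ℝ≥0∞) : MemLp φ p stripMeasure := by
  have hs : MeasurableSet {z : ℝ × ℝ | |z.2| ≤ R} :=
    measurableSet_le (f := fun z : ℝ × ℝ => |z.2|) (by fun_prop) measurable_const
  refine (memLp_indicator_const p hs C (Or.inr (measure_band_lt_top R).ne)).mono
    hm.aestronglyMeasurable (.of_forall fun z => ?_)
  by_cases hz : |z.2| ≤ R
  · rw [indicator_of_mem (by exact hz)]
    exact (hC z).trans (le_abs_self _)
  · rw [h0 z (not_le.1 hz)]
    simp

lemma IsBump.memLp {φ : ℝ × ℝ → ℝ} (hφ : IsBump φ) (p : ℝ≥0∞) : MemLp φ p stripMeasure := by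
  obtain ⟨R, -, h⟩ := exists_bound_snd hφ.compact
  obtain ⟨C, hC⟩ := hφ.compact.exists_bound_of_continuous hφ.smooth.continuous
  exact memLp_of_band hφ.smooth.continuous.measurable h hC p

/-- Bump functions span a dense subspace of `L²` of the strip. -/
lemma topologicalClosure_eq_top_of_bump (V : Submodule ℝ (Lp ℝ 2 stripMeasure))
    (hV : ∀ φ (hφ : IsBump φ), (hφ.memLp 2).toLp φ ∈ V) : V.topologicalClosure = ⊤ := by
  rw [Submodule.topologicalClosure_eq_top_iff, Submodule.eq_bot_iff]
  intro g hg
  have hgm : MemLp g 2 stripMeasure := Lp.memLp g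
  have hz : g =ᵐ[stripMeasure] 0 := by
    refine ae_eq_zero_of_forall_bump (locallyIntegrableOn_strip hgm (by norm_num)) fun φ hφ => ?_
    have h1 := (Submodule.mem_orthogonal' V g).1 hg _ (hV φ hφ)
    have h2 := inner_toLp hgm (hφ.memLp 2)
    rw [Lp.toLp_coeFn] at h2
    rw [← h2, h1]
  exact Lp.eq_zero_iff_ae_eq_zero.2 hz

end FokkerPlanck

/-! ### Passage to the limit in the weak formulation -/

namespace FokkerPlanck

open Filter Topology

/-- The backward operator applied to a test function. -/
noncomputable def testOp (ψ : ℝ × ℝ × ℝ → ℝ) (p : ℝ × ℝ × ℝ) : ℝ :=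
  dt ψ p + p.2.1 * dx ψ p + dv (dv ψ) p

/-- The product measure on `Ω × (0,t)`. -/
noncomputable def cylMeasure (t : ℝ) : Measure ((ℝ × ℝ) × ℝ) :=
  stripMeasure.prod (volume.restrict (Ioo 0 t))

instance (t : ℝ) : SigmaFinite (cylMeasure t) := by unfold cylMeasure; infer_instance

lemma setIntegral_cyl (t : ℝ) (g : ℝ × ℝ × ℝ → ℝ) :
    ∫ p in cyl t, g p = ∫ p, g (p.1.1, p.1.2, p.2) ∂cylMeasure t :=
  ((measurePreserving_cyl t).integral_comp' g).symm

lemma cylMeasure_restrict {s t : ℝ} (hst : s ≤ t) :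
    (cylMeasure t).restrict (univ ×ˢ Ioo 0 s) = cylMeasure s := by
  rw [cylMeasure, ← Measure.prod_restrict, Measure.restrict_univ,
    Measure.restrict_restrict measurableSet_Ioo, inter_eq_left.2 (Ioo_subset_Ioo_right hst),
    cylMeasure]

lemma ae_mem_cyl (t : ℝ) : ∀ᵐ p ∂cylMeasure t, (p.1.1, p.1.2, p.2) ∈ cyl t := by
  have h1 : ∀ᵐ p ∂cylMeasure t, p.1 ∈ strip :=
    Measure.quasiMeasurePreserving_fst.ae (ae_restrict_mem measurableSet_strip)
  have h2 : ∀ᵐ p ∂cylMeasure t, p.2 ∈ Ioo 0 t :=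
    Measure.quasiMeasurePreserving_snd.ae (ae_restrict_mem measurableSet_Ioo)
  filter_upwards [h1, h2] with p h1 h2
  exact mem_cyl.2 ⟨mem_strip.1 h1, h2⟩

lemma memLp_cyl_of_band {g : (ℝ × ℝ) × ℝ → ℝ} (hm : Measurable g) {R C : ℝ}
    (h0 : ∀ p, R < |p.1.2| → g p = 0) (hC : ∀ p, |g p| ≤ C) (q : ℝ≥0∞) (t : ℝ) :
    MemLp g q (cylMeasure t) := by
  have hs : MeasurableSet {z : ℝ × ℝ | |z.2| ≤ R} :=
    measurableSet_le (f := fun z : ℝ × ℝ => |z.2|) (by fun_prop) measurable_const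
  have hfin : cylMeasure t ({z : ℝ × ℝ | |z.2| ≤ R} ×ˢ univ) ≠ ∞ := by
    rw [cylMeasure, Measure.prod_prod]
    exact ENNReal.mul_ne_top (measure_band_lt_top R).ne (by simp)
  refine (memLp_indicator_const q (hs.prod MeasurableSet.univ) C (Or.inr hfin)).mono
    hm.aestronglyMeasurable (.of_forall fun p => ?_)
  by_cases hz : |p.1.2| ≤ R
  · rw [indicator_of_mem (by exact ⟨hz, mem_univ _⟩)]
    exact (hC p).trans (le_abs_self _)
  · rw [h0 p (not_le.1 hz)]
    simp

lemma integral_stripMeasure_of_zero {q φ : ℝ × ℝ → ℝ} (hq : ∀ z ∉ strip, q z = 0) :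
    ∫ z, q z * φ z ∂stripMeasure = ∫ z, q z * φ z := by
  rw [stripMeasure, setIntegral_eq_integral_of_forall_compl_eq_zero]
  intro z hz
  rw [hq z hz, zero_mul]

/-- The time steps of the scheme. -/
noncomputable def timeStep (n : ℕ) : ℝ := 1 / (n + 1)

lemma timeStep_pos (n : ℕ) : 0 < timeStep n := by unfold timeStep; positivity

lemma tendsto_timeStep : Tendsto timeStep atTop (𝓝 0) := tendsto_one_div_add_atTop_nhds_zero_nat

/-- Weak limits of the scheme satisfy the weak formulation. -/
lemma weak_form_of_limit {T M A : ℝ} (hM : 0 ≤ M) (hA : 0 ≤ A) {q : ℝ × ℝ → ℝ}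
    (hq : IsDensity M A q) {G : ℝ → ℝ × ℝ → ℝ} {F : (ℝ × ℝ) × ℝ → ℝ}
    (hG : ∀ t ξ, MemLp ξ 2 stripMeasure →
      Tendsto (fun n => ∫ z, approx (timeStep n) q t z * ξ z ∂stripMeasure) (hyperfilter ℕ)
        (𝓝 (∫ z, G t z * ξ z ∂stripMeasure)))
    (hF : ∀ ξ, MemLp ξ 2 (cylMeasure T) →
      Tendsto (fun n => ∫ p, approx (timeStep n) q p.2 p.1 * ξ p ∂cylMeasure T) (hyperfilter ℕ)
        (𝓝 (∫ p, F p * ξ p ∂cylMeasure T)))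
    {t : ℝ} (ht : 0 < t) (htT : t ≤ T) {ψ : ℝ × ℝ × ℝ → ℝ} (hψ : IsTest t ψ)
    (hout : ∀ p ∈ outgoing t, ψ p = 0) :
    (∫ z, G t z * atTime ψ t z ∂stripMeasure) - (∫ z, q z * atTime ψ 0 z ∂stripMeasure)
      = ∫ p, F p * testOp ψ (p.1.1, p.1.2, p.2) ∂cylMeasure t := by
  obtain ⟨R, C, Ψ, Ψx, Ψv, Ψvv, Ψs, hR, hj, hΨ, hop⟩ := hψ.exists_jet ht
  have hout' : ∀ p ∈ outgoing t, Ψ p = 0 := by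
    intro p hp
    rw [hΨ, hout p hp]
    rw [mem_closedCyl]
    rcases hp with ⟨h1, -, h3⟩ | ⟨h1, -, h3⟩
    · rw [show p.1 = 0 from h1]; exact ⟨by simp, h3.1.le, h3.2.le⟩
    · rw [show p.1 = 1 from h1]; exact ⟨by simp, h3.1.le, h3.2.le⟩
  have cΨ := hj.uc.continuous
  have cΛ := hj.continuous_backwardOp
  have bΛ := hj.backwardOp_bdd hR
  have sΛ : ∀ p : ℝ × ℝ × ℝ, R < |p.2.1| → backwardOp Ψx Ψvv Ψs p = 0 :=
    fun p hp => hj.supp_backwardOp hp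
  set Λ := backwardOp Ψx Ψvv Ψs with hΛ
  set Λ' : (ℝ × ℝ) × ℝ → ℝ := fun p => Λ (p.1.1, p.1.2, p.2) with hΛ'
  have mΛ' : Measurable Λ' := (by fun_prop : Continuous Λ').measurable
  have mΨ : ∀ r, Measurable fun z : ℝ × ℝ => Ψ (z.1, z.2, r) := fun r =>
    (by fun_prop : Continuous fun z : ℝ × ℝ => Ψ (z.1, z.2, r)).measurable
  have slice : ∀ r, 0 ≤ r → r ≤ t → ∀ g : ℝ × ℝ → ℝ,
      ∫ z, g z * atTime ψ r z ∂stripMeasure = ∫ z, g z * Ψ (z.1, z.2, r) ∂stripMeasure := by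
    intro r h0 h1 g
    refine integral_congr_ae ?_
    filter_upwards [ae_restrict_mem measurableSet_strip] with z hz
    rw [mem_strip] at hz
    rw [atTime, hΨ (mem_closedCyl.2 ⟨⟨hz.1.le, hz.2.le⟩, h0, h1⟩)]
  rw [slice t ht.le le_rfl, slice 0 le_rfl ht.le]
  have hLHS : Tendsto (fun n => ∫ z, approx (timeStep n) q t z * Ψ (z.1, z.2, t) ∂stripMeasure)
      (hyperfilter ℕ) (𝓝 (∫ z, G t z * Ψ (z.1, z.2, t) ∂stripMeasure)) :=
    hG t _ (memLp_of_band (mΨ t) (fun z hz => hj.supp _ hz) (fun z => hj.bdd _) 2)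
  have mE : MeasurableSet ((univ : Set (ℝ × ℝ)) ×ˢ Ioo (0 : ℝ) t) :=
    MeasurableSet.univ.prod measurableSet_Ioo
  -- The space-time limit is taken once, on `(0,T)`; the restriction to `(0,t)` is absorbed into the
  -- test function, which need only be in `L²`.
  have restr : ∀ g : (ℝ × ℝ) × ℝ → ℝ,
      ∫ p, g p * (univ ×ˢ Ioo 0 t).indicator Λ' p ∂cylMeasure T
        = ∫ p, g p * Λ' p ∂cylMeasure t := by
    intro g
    rw [← cylMeasure_restrict htT, ← integral_indicator mE]
    refine integral_congr_ae (.of_forall fun p => ?_)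
    by_cases hp : p ∈ (univ : Set (ℝ × ℝ)) ×ˢ Ioo 0 t
    · simp only [indicator_of_mem hp]
    · simp only [indicator_of_notMem hp, mul_zero]
  have hRHS := hF ((univ ×ˢ Ioo 0 t).indicator Λ')
    ((memLp_cyl_of_band mΛ' (fun p hp => sΛ _ hp) (fun p => bΛ _) 2 T).indicator mE)
  simp only [restr] at hRHS
  have eRHS : ∀ n, ∫ p, approx (timeStep n) q p.2 p.1 * Λ' p ∂cylMeasure t
      = ∫ r in 0..t, ∫ z, approx (timeStep n) q r z * Λ (z.1, z.2, r) := by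
    intro n
    have hint : Integrable (fun p : (ℝ × ℝ) × ℝ => approx (timeStep n) q p.2 p.1 * Λ' p)
        (cylMeasure t) := by
      refine Integrable.bdd_mul (c := M) ?_ ?_ ?_
      · exact memLp_one_iff_integrable.1
          (memLp_cyl_of_band mΛ' (fun p hp => sΛ _ hp) (fun p => bΛ _) 1 t)
      · exact (hq.measurable_approx hM).aestronglyMeasurable
      · refine .of_forall fun p => ?_
        rw [Real.norm_eq_abs, abs_of_nonneg ((hq.approx hM _).nonneg _)]
        exact (hq.approx hM _).le _
    rw [cylMeasure] at hint ⊢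
    rw [integral_prod_symm _ hint, intervalIntegral.integral_of_le ht.le,
      integral_Ioc_eq_integral_Ioo]
    refine integral_congr_ae (.of_forall fun r => ?_)
    exact integral_stripMeasure_of_zero (hq.approx hM r).zero
  have eT : ∀ n, ∫ z, approx (timeStep n) q t z * Ψ (z.1, z.2, t) ∂stripMeasure
      = ∫ z, approx (timeStep n) q t z * Ψ (z.1, z.2, t) := fun n =>
    integral_stripMeasure_of_zero (hq.approx hM t).zero
  simp only [eRHS] at hRHS
  simp only [eT] at hLHS
  -- The consistency error tends to zero along the whole sequence, hence along the ultrafilter,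
  -- where the two weak limits are known; uniqueness of limits then gives the identity.
  have hzero : Tendsto (fun n => (∫ z, approx (timeStep n) q t z * Ψ (z.1, z.2, t))
      - (∫ z, q z * Ψ (z.1, z.2, 0))
      - ∫ r in 0..t, ∫ z, approx (timeStep n) q r z * Λ (z.1, z.2, r)) (hyperfilter ℕ) (𝓝 0) := by
    refine Tendsto.mono_left ?_ Nat.hyperfilter_le_atTop
    rw [Metric.tendsto_nhds]
    intro ε hε
    obtain ⟨h₀, h₀0, H⟩ := hj.scheme_error ht hR hout' hM hA (half_pos hε)
    filter_upwards [tendsto_timeStep.eventually (gt_mem_nhds h₀0)] with n hn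
    rw [Real.dist_eq, sub_zero]
    exact (H _ (timeStep_pos n) hn.le q hq).trans_lt (half_lt_self hε)
  have hlim := tendsto_nhds_unique hzero ((hLHS.sub_const _).sub hRHS)
  have e0 : ∫ z, q z * Ψ (z.1, z.2, 0) ∂stripMeasure = ∫ z, q z * Ψ (z.1, z.2, 0) :=
    integral_stripMeasure_of_zero hq.zero
  rw [e0]
  have e1 : ∫ p, F p * testOp ψ (p.1.1, p.1.2, p.2) ∂cylMeasure t
      = ∫ p, F p * Λ' p ∂cylMeasure t := by
    refine integral_congr_ae ?_
    filter_upwards [ae_mem_cyl t] with p hp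
    rw [hΛ', testOp, hop _ hp]
  rw [e1]
  linarith

end FokkerPlanck

/-! ### The space-time limit and the limits at fixed times -/

namespace FokkerPlanck

open Filter Topology

/-- `g` is a nonnegative density for the measure `μ`, bounded by `M` and of mass at most `A`. -/
structure IsDensityFor {α : Type*} [MeasurableSpace α] (μ : Measure α) (M A : ℝ) (g : α → ℝ) :
    Prop where
  meas : Measurable g
  nonneg : ∀ a, 0 ≤ g a
  le : ∀ a, g a ≤ M
  int : Integrable g μ
  mass : ∫ a, g a ∂μ ≤ A

lemma IsDensityFor.memLp_two {α : Type*} [MeasurableSpace α] {μ : Measure α} {M A : ℝ} {g : α → ℝ}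
    (hg : IsDensityFor μ M A g) : MemLp g 2 μ :=
  memLp_two_of_bounded hg.meas hg.nonneg hg.le hg.int

lemma IsDensityFor.norm_toLp_le {α : Type*} [MeasurableSpace α] {μ : Measure α} {M A : ℝ}
    (hM : 0 ≤ M) {g : α → ℝ} (hg : IsDensityFor μ M A g) :
    ‖hg.memLp_two.toLp g‖ ≤ √(M * A) := by
  refine Real.le_sqrt_of_sq_le ?_
  rw [← real_inner_self_eq_norm_sq, inner_toLp]
  calc ∫ a, g a * g a ∂μ ≤ ∫ a, M * g a ∂μ := by
        refine integral_mono_of_nonneg (.of_forall fun a => mul_nonneg (hg.nonneg a) (hg.nonneg a))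
          (hg.int.const_mul M) (.of_forall fun a => ?_)
        exact mul_le_mul_of_nonneg_right (hg.le a) (hg.nonneg a)
    _ ≤ M * A := by
        rw [integral_const_mul]
        exact mul_le_mul_of_nonneg_left hg.mass hM

lemma IsDensityFor.eLpNorm_top_le {α : Type*} [MeasurableSpace α] {μ : Measure α} {M A : ℝ}
    {g : α → ℝ} (hg : IsDensityFor μ M A g) : eLpNorm g ∞ μ ≤ ENNReal.ofReal M := by
  rw [eLpNorm_exponent_top]
  refine eLpNormEssSup_le_of_ae_bound (.of_forall fun a => ?_)
  rw [Real.norm_eq_abs, abs_of_nonneg (hg.nonneg a)]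
  exact hg.le a

lemma IsDensityFor.eLpNorm_one_le {α : Type*} [MeasurableSpace α] {μ : Measure α} {M A : ℝ}
    {g : α → ℝ} (hg : IsDensityFor μ M A g) : eLpNorm g 1 μ ≤ ENNReal.ofReal A := by
  rw [eLpNorm_one_eq_lintegral_enorm]
  have : ∫⁻ a, ‖g a‖ₑ ∂μ = ENNReal.ofReal (∫ a, g a ∂μ) := by
    rw [ofReal_integral_eq_lintegral_ofReal hg.int (.of_forall hg.nonneg)]
    refine lintegral_congr fun a => ?_
    rw [Real.enorm_eq_ofReal (hg.nonneg a)]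
  rw [this]
  exact ENNReal.ofReal_le_ofReal hg.mass

lemma integral_cylMeasure_eq {T t : ℝ} (ht : 0 ≤ t) (htT : t ≤ T) {g : (ℝ × ℝ) × ℝ → ℝ}
    (hg : Integrable g (cylMeasure T)) :
    ∫ p, g p ∂cylMeasure t = ∫ r in 0..t, ∫ z, g (z, r) ∂stripMeasure := by
  have h1 : Integrable g (cylMeasure t) := by
    rw [← cylMeasure_restrict htT]
    exact hg.restrict
  rw [cylMeasure] at h1 ⊢
  rw [integral_prod_symm _ h1, intervalIntegral.integral_of_le ht, integral_Ioc_eq_integral_Ioo]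

lemma intervalIntegrable_slices {T : ℝ} (hT : 0 ≤ T) {g : (ℝ × ℝ) × ℝ → ℝ}
    (hg : Integrable g (cylMeasure T)) :
    IntervalIntegrable (fun r => ∫ z, g (z, r) ∂stripMeasure) volume 0 T := by
  rw [intervalIntegrable_iff_integrableOn_Ioo_of_le hT]
  exact hg.integral_prod_right

section Identification

variable {T M A : ℝ} {q : ℝ × ℝ → ℝ} {G : ℝ → ℝ × ℝ → ℝ} {F : (ℝ × ℝ) × ℝ → ℝ}

/-- The weak formulation, for weak limits `G t` at fixed times and `F` in space-time. -/
def LimitWeakForm (T : ℝ) (q : ℝ × ℝ → ℝ) (G : ℝ → ℝ × ℝ → ℝ) (F : (ℝ × ℝ) × ℝ → ℝ) : Prop :=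
  ∀ t, 0 < t → t ≤ T → ∀ ψ : ℝ × ℝ × ℝ → ℝ, IsTest t ψ → (∀ p ∈ outgoing t, ψ p = 0) →
    (∫ z, G t z * atTime ψ t z ∂stripMeasure) - (∫ z, q z * atTime ψ 0 z ∂stripMeasure)
      = ∫ p, F p * testOp ψ (p.1.1, p.1.2, p.2) ∂cylMeasure t

lemma IsDensityFor.integrable_mul_cyl (hF : IsDensityFor (cylMeasure T) M A F)
    {φ : ℝ × ℝ → ℝ} (hφ : Continuous φ) (hφc : HasCompactSupport φ) :
    Integrable (fun p => F p * φ p.1) (cylMeasure T) := by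
  obtain ⟨C, hC⟩ := hφc.exists_bound_of_continuous hφ
  exact hF.int.mul_bdd (hφ.comp continuous_fst).aestronglyMeasurable (.of_forall fun p => hC _)

lemma IsDensityFor.integrable_smul_mul_cyl (hF : IsDensityFor (cylMeasure T) M A F)
    {φ : ℝ × ℝ → ℝ} (hφ : Continuous φ) (hφc : HasCompactSupport φ) :
    Integrable (fun p => p.2 * (F p * φ p.1)) (cylMeasure T) := by
  refine (hF.integrable_mul_cyl hφ hφc).bdd_mul (c := T) continuous_snd.aestronglyMeasurable ?_
  filter_upwards [ae_mem_cyl T] with p hp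
  rw [mem_cyl] at hp
  rw [Real.norm_eq_abs, abs_of_pos hp.2.1]
  exact hp.2.2.le

/-- Evolution of the averages of a weak limit against bump functions. -/
lemma LimitWeakForm.bump_formulas (hT : 0 < T) (hW : LimitWeakForm T q G F)
    (hF : IsDensityFor (cylMeasure T) M A F) {φ : ℝ × ℝ → ℝ} (hφ : IsBump φ) :
    ∃ a : ℝ → ℝ, IntervalIntegrable a volume 0 T ∧
      (∀ t, 0 < t → t ≤ T → ∫ z, G t z * φ z ∂stripMeasure
        = (∫ z, q z * φ z ∂stripMeasure) + ∫ r in 0..t, a r) ∧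
      IntervalIntegrable (fun r => (∫ z, F (z, r) * φ z ∂stripMeasure) + r * a r) volume 0 T ∧
      ∀ t, 0 < t → t ≤ T → t * ∫ z, G t z * φ z ∂stripMeasure
        = ∫ r in 0..t, ((∫ z, F (z, r) * φ z ∂stripMeasure) + r * a r) := by
  obtain ⟨ℓ, hℓ, hℓc, hgen⟩ := hφ.exists_generator
  have i1 := hF.integrable_mul_cyl hℓ hℓc
  have i2 := hF.integrable_mul_cyl hφ.smooth.continuous hφ.compact
  have i3 := hF.integrable_smul_mul_cyl hℓ hℓc
  have j1 := intervalIntegrable_slices hT.le i1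
  have j2 := intervalIntegrable_slices hT.le i2
  have j3 := intervalIntegrable_slices hT.le i3
  simp only [integral_const_mul] at j3
  refine ⟨fun r => ∫ z, F (z, r) * ℓ z ∂stripMeasure, j1, fun t ht htT => ?_, j2.add j3,
    fun t ht htT => ?_⟩
  -- Test function `φ`, constant in time.
  · obtain ⟨g1, g2, g3⟩ := hgen 1 0 t
    have := hW t ht htT _ g1 g2
    simp only [testOp, g3, atTime] at this
    simp only [zero_mul, add_zero, one_mul, zero_add] at this
    rw [← integral_cylMeasure_eq ht.le htT i1, ← this]
    ring
  -- Test function `s φ`: the initial term disappears and the time derivative brings in the slice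
  -- averages of `F` themselves.
  · obtain ⟨g1, g2, g3⟩ := hgen 0 1 t
    have := hW t ht htT _ g1 g2
    simp only [testOp, g3, atTime] at this
    simp only [zero_mul, one_mul, zero_add, mul_zero, integral_zero, sub_zero] at this
    have e1 : ∫ z, G t z * (t * φ z) ∂stripMeasure = t * ∫ z, G t z * φ z ∂stripMeasure := by
      rw [← integral_const_mul]
      exact integral_congr_ae (.of_forall fun z => by simp only; ring)
    have e2 : ∫ p, F p * (φ p.1 + p.2 * ℓ p.1) ∂cylMeasure t
        = ∫ p, (F p * φ p.1 + p.2 * (F p * ℓ p.1)) ∂cylMeasure t :=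
      integral_congr_ae (.of_forall fun p => by simp only; ring)
    have sub : ∀ r ∈ uIcc 0 t, r ∈ uIcc 0 T := uIcc_subset_uIcc_left
      (by rw [mem_uIcc]; exact Or.inl ⟨ht.le, htT⟩)
    rw [← e1, this]
    simp only [Prod.mk.eta]
    rw [e2]
    have k1 : Integrable (fun p => F p * φ p.1) (cylMeasure t) := by
      rw [← cylMeasure_restrict htT]; exact i2.restrict
    have k2 : Integrable (fun p => p.2 * (F p * ℓ p.1)) (cylMeasure t) := by
      rw [← cylMeasure_restrict htT]; exact i3.restrict
    rw [integral_add k1 k2, integral_cylMeasure_eq ht.le htT i2,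
      integral_cylMeasure_eq ht.le htT i3,
      intervalIntegral.integral_add (j2.mono_set sub) (j3.mono_set sub)]
    simp only [integral_const_mul]

/-- Write `g` and `b` for the averages of `G` and `F` against `φ`. The two formulas say `g' = a` and
`(t g)' = b + t a` almost everywhere; the product rule leaves `g = b`. -/
lemma LimitWeakForm.ae_slice_bump (hT : 0 < T) (hW : LimitWeakForm T q G F)
    (hF : IsDensityFor (cylMeasure T) M A F) {φ : ℝ × ℝ → ℝ} (hφ : IsBump φ) :
    ∀ᵐ t ∂volume.restrict (Ioo 0 T),
      ∫ z, F (z, t) * φ z ∂stripMeasure = ∫ z, G t z * φ z ∂stripMeasure := by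
  obtain ⟨a, ha, h1, hb, h2⟩ := hW.bump_formulas hT hF hφ
  set b : ℝ → ℝ := fun t => ∫ z, F (z, t) * φ z ∂stripMeasure with hbdef
  rw [ae_restrict_iff' measurableSet_Ioo]
  filter_upwards [ha.ae_hasDerivAt_integral, hb.ae_hasDerivAt_integral] with t d1 d2 ht
  have htu : t ∈ uIcc 0 T := by rw [uIcc_of_le hT.le]; exact ⟨ht.1.le, ht.2.le⟩
  replace d1 := d1 htu 0 left_mem_uIcc
  replace d2 := d2 htu 0 left_mem_uIcc
  have d3 := (hasDerivAt_id t).mul (d1.const_add (∫ z, q z * φ z ∂stripMeasure))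
  have heq : (fun s => id s * ((∫ z, q z * φ z ∂stripMeasure) + ∫ r in 0..s, a r))
      =ᶠ[𝓝 t] fun s => ∫ r in 0..s, (b r + r * a r) := by
    filter_upwards [Ioo_mem_nhds ht.1 ht.2] with s hs
    rw [id, ← h1 s hs.1 hs.2.le, h2 s hs.1 hs.2.le]
  have := (d2.congr_of_eventuallyEq heq).unique d3
  simp only [id, one_mul] at this
  rw [h1 t ht.1 ht.2.le]
  linarith

/-- The space-time weak limit has the weak limits at fixed times as slices. -/
lemma LimitWeakForm.ae_slice (hT : 0 < T) (hW : LimitWeakForm T q G F)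
    {A' : ℝ} (hF : IsDensityFor (cylMeasure T) M A' F)
    (hG : ∀ t, IsDensityFor stripMeasure M A (G t)) :
    ∀ᵐ t ∂volume.restrict (Ioo 0 T), (fun z => F (z, t)) =ᵐ[stripMeasure] G t := by
  -- The exceptional null set of times depends on the bump; separability of `L²` reduces to
  -- countably many bumps, so one null set serves for all.
  set S : Set (Lp ℝ 2 stripMeasure) := {ξ | ∃ φ, ∃ hφ : IsBump φ, ξ = (hφ.memLp 2).toLp φ} with hS
  have : Fact ((2 : ℝ≥0∞) ≠ ∞) := ⟨by norm_num⟩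
  obtain ⟨D, hDS, hDc, hDd⟩ :=
    (TopologicalSpace.IsSeparable.of_separableSpace S).exists_countable_dense_subset
  have hD : ∀ᵐ t ∂volume.restrict (Ioo 0 T), ∀ ξ ∈ D,
      ∫ z, F (z, t) * ξ z ∂stripMeasure = ∫ z, G t z * ξ z ∂stripMeasure := by
    rw [ae_ball_iff hDc]
    intro ξ hξ
    obtain ⟨φ, hφ, rfl⟩ := hDS hξ
    filter_upwards [hW.ae_slice_bump hT hF hφ] with t ht
    have e : ∀ g : ℝ × ℝ → ℝ, ∫ z, g z * (hφ.memLp 2).toLp φ z ∂stripMeasure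
        = ∫ z, g z * φ z ∂stripMeasure := fun g => integral_congr_ae (by
      filter_upwards [(hφ.memLp 2).coeFn_toLp] with z hz
      rw [hz])
    rw [e, e, ht]
  have hint : ∀ᵐ t ∂volume.restrict (Ioo 0 T), Integrable (fun z => F (z, t)) stripMeasure :=
    hF.int.prod_left_ae
  filter_upwards [hD, hint] with t h1 h2
  have m1 : MemLp (fun z => F (z, t)) 2 stripMeasure :=
    memLp_two_of_bounded (hF.meas.comp (measurable_id.prodMk measurable_const))
      (fun z => hF.nonneg _) (fun z => hF.le _) h2
  have m2 := (hG t).memLp_two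
  have m3 : MemLp (fun z => F (z, t) - G t z) 2 stripMeasure := m1.sub m2
  have hclosed : IsClosed {ξ : Lp ℝ 2 stripMeasure | inner ℝ (m3.toLp _) ξ = 0} :=
    isClosed_eq (by fun_prop) continuous_const
  have hsub : S ⊆ {ξ : Lp ℝ 2 stripMeasure | inner ℝ (m3.toLp _) ξ = 0} := by
    refine hDd.trans (closure_minimal (fun ξ hξ => ?_) hclosed)
    have hξm : MemLp ξ 2 stripMeasure := Lp.memLp ξ
    have e := inner_toLp m3 hξm
    rw [Lp.toLp_coeFn] at e
    change inner ℝ (m3.toLp _) ξ = 0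
    rw [e]
    simp only [sub_mul]
    rw [integral_sub, h1 ξ hξ, sub_self]
    · exact m1.integrable_mul hξm
    · exact m2.integrable_mul hξm
  have := ae_eq_zero_of_forall_bump (locallyIntegrableOn_strip m3 (by norm_num)) fun φ hφ => by
    rw [← inner_toLp m3 (hφ.memLp 2)]
    exact hsub ⟨φ, hφ, rfl⟩
  filter_upwards [this] with z hz
  simpa [sub_eq_zero] using hz

/-- Weak continuity in time of the weak limits. -/
lemma LimitWeakForm.weak_continuity (hT : 0 < T) (hM : 0 ≤ M) (hW : LimitWeakForm T q G F)
    {A' : ℝ} (hF : IsDensityFor (cylMeasure T) M A' F)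
    (hG : ∀ t, IsDensityFor stripMeasure M A (G t)) (hG0 : G 0 =ᵐ[stripMeasure] q)
    {ξ : ℝ × ℝ → ℝ} (hξ : MemLp ξ 2 stripMeasure) :
    ContinuousOn (fun t => ∫ z, G t z * ξ z ∂stripMeasure) (Icc 0 T) := by
  -- The test elements with continuous pairing form a subspace that contains the bumps, hence is
  -- dense. The uniform bound `√(M A)` on `‖G t‖` makes approximation uniform in time, so continuity
  -- extends to all of `L²`.
  let V : Submodule ℝ (Lp ℝ 2 stripMeasure) :=
    { carrier := {η | ContinuousOn (fun t => inner ℝ ((hG t).memLp_two.toLp (G t)) η) (Icc 0 T)}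
      add_mem' := fun {a b} ha hb => by
        simp only [mem_ofPred_eq, inner_add_right]
        exact ha.add hb
      zero_mem' := by
        simp only [mem_ofPred_eq, inner_zero_right]
        exact continuousOn_const
      smul_mem' := fun c a ha => by
        simp only [mem_ofPred_eq, inner_smul_right]
        exact continuousOn_const.mul ha }
  have hV : ∀ φ (hφ : IsBump φ), (hφ.memLp 2).toLp φ ∈ V := by
    intro φ hφ
    change ContinuousOn (fun t => inner ℝ ((hG t).memLp_two.toLp (G t)) ((hφ.memLp 2).toLp φ))
      (Icc 0 T)
    simp only [inner_toLp]
    obtain ⟨a, ha, h1, -, -⟩ := hW.bump_formulas hT hF hφ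
    have hc : ContinuousOn (fun t => (∫ z, q z * φ z ∂stripMeasure) + ∫ r in 0..t, a r)
        (Icc 0 T) := by
      have := intervalIntegral.continuousOn_primitive_interval (f := a) (μ := volume) (a := 0)
        (b := T) (by
          rw [uIcc_of_le hT.le]
          exact (intervalIntegrable_iff_integrableOn_Icc_of_le hT.le).1 ha)
      rw [uIcc_of_le hT.le] at this
      exact continuousOn_const.add this
    refine hc.congr fun t ht => ?_
    -- The limiting weak formulation is stated for positive times only; at time zero the hypothesis
    -- on the datum is used.
    rcases ht.1.eq_or_lt with h0 | h0
    · subst h0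
      simp only [intervalIntegral.integral_same, add_zero]
      exact integral_congr_ae (by filter_upwards [hG0] with z hz; rw [hz])
    · exact h1 t h0 ht.2
  have htop := topologicalClosure_eq_top_of_bump V hV
  have hcont : ContinuousOn (fun t => inner ℝ ((hG t).memLp_two.toLp (G t)) (hξ.toLp ξ))
      (Icc 0 T) := by
    have hmem : hξ.toLp ξ ∈ closure (V : Set (Lp ℝ 2 stripMeasure)) := by
      rw [← Submodule.topologicalClosure_coe, htop]
      trivial
    refine continuousOn_of_uniform_approx_of_continuousOn fun u hu => ?_
    obtain ⟨ε, hε, hεu⟩ := Metric.mem_uniformity_dist.1 hu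
    obtain ⟨η, hη, hdist⟩ := Metric.mem_closure_iff.1 hmem (ε / (√(M * A) + 1)) (by positivity)
    refine ⟨fun t => inner ℝ ((hG t).memLp_two.toLp (G t)) η, hη, fun t _ => hεu ?_⟩
    rw [Real.dist_eq, ← inner_sub_right]
    refine (abs_real_inner_le_norm _ _).trans_lt ?_
    rw [dist_eq_norm] at hdist
    have := (hG t).norm_toLp_le hM
    calc _ ≤ √(M * A) * ‖hξ.toLp ξ - η‖ := mul_le_mul_of_nonneg_right this (norm_nonneg _)
      _ ≤ (√(M * A) + 1) * ‖hξ.toLp ξ - η‖ :=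
        mul_le_mul_of_nonneg_right (by linarith) (norm_nonneg _)
      _ < ε := by rwa [lt_div_iff₀ (by positivity), mul_comm] at hdist
  simpa only [inner_toLp] using hcont

end Identification

end FokkerPlanck

/-! ### Existence -/

namespace FokkerPlanck

open Filter Topology

/-- Existence of a weak solution, with the bounds on each time slice. -/
theorem exists_isWeakSolution {T M A : ℝ} (hT : 0 < T) (hM : 0 ≤ M) (hA : 0 ≤ A) {q : ℝ × ℝ → ℝ}
    (hq : IsDensity M A q) :
    ∃ f : ℝ × ℝ × ℝ → ℝ, IsWeakSolution T q f ∧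
      ∀ t ∈ Icc 0 T, 0 ≤ᵐ[stripMeasure] atTime f t ∧
        eLpNorm (atTime f t) ∞ stripMeasure ≤ ENNReal.ofReal M ∧
        eLpNorm (atTime f t) 1 stripMeasure ≤ ENNReal.ofReal A := by
  classical
  have hS : ∀ g, IsDensity M A g → ∫ z, g z ∂stripMeasure ≤ A := fun g hg => by
    have := integral_stripMeasure_of_zero (φ := fun _ => 1) hg.zero
    simp only [mul_one] at this
    rw [this]
    exact hg.mass
  have hG : ∀ t : ℝ, ∃ G : ℝ × ℝ → ℝ, IsDensityFor stripMeasure M A G ∧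
      ∀ ξ, MemLp ξ 2 stripMeasure →
        Tendsto (fun n => ∫ z, approx (timeStep n) q t z * ξ z ∂stripMeasure) (hyperfilter ℕ)
          (𝓝 (∫ z, G z * ξ z ∂stripMeasure)) := by
    intro t
    obtain ⟨G, h1, h2, h3, h4, h5, h6⟩ := exists_weak_limit stripMeasure (hyperfilter ℕ)
      (F := fun n => approx (timeStep n) q t) hM (fun n => (hq.approx hM t).meas)
      (fun n => (hq.approx hM t).nonneg) (fun n => (hq.approx hM t).le)
      (fun n => (hq.approx hM t).int.restrict) (fun n => hS _ (hq.approx hM t))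
    exact ⟨G, ⟨h1, h2, h3, h4, h5⟩, h6⟩
  -- The limits are chosen time by time, so nothing is known about measurability of `G` in time; the
  -- space-time limit below supplies it.
  choose G hGd hGlim using hG
  have hFn : ∀ n, Integrable (fun p : (ℝ × ℝ) × ℝ => approx (timeStep n) q p.2 p.1)
      (cylMeasure T) ∧ ∫ p, approx (timeStep n) q p.2 p.1 ∂cylMeasure T ≤ A * T := by
    intro n
    have hm := hq.measurable_approx (h := timeStep n) hM
    have hb : ∀ r, ∫ z, approx (timeStep n) q r z ∂stripMeasure ≤ A := fun r =>
      hS _ (hq.approx hM r)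
    have hb0 : ∀ r, 0 ≤ ∫ z, approx (timeStep n) q r z ∂stripMeasure := fun r =>
      integral_nonneg fun z => (hq.approx hM r).nonneg z
    have hI : Integrable (fun p : (ℝ × ℝ) × ℝ => approx (timeStep n) q p.2 p.1)
        (cylMeasure T) := by
      rw [cylMeasure, integrable_prod_iff' hm.aestronglyMeasurable]
      refine ⟨.of_forall fun r => (hq.approx hM r).int.restrict, ?_⟩
      refine (integrable_const A).mono' ?_ (.of_forall fun r => ?_)
      · exact (StronglyMeasurable.integral_prod_right
          (f := fun r z => ‖approx (timeStep n) q r z‖)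
          (hm.norm.comp measurable_swap).stronglyMeasurable).aestronglyMeasurable
      · rw [Real.norm_eq_abs, abs_of_nonneg (integral_nonneg fun z => norm_nonneg _)]
        simp only [Real.norm_eq_abs, abs_of_nonneg ((hq.approx hM r).nonneg _)]
        exact hb r
    refine ⟨hI, ?_⟩
    rw [cylMeasure] at hI ⊢
    rw [integral_prod_symm _ hI]
    refine (integral_mono_of_nonneg (.of_forall hb0) (integrable_const A)
      (.of_forall hb)).trans (le_of_eq ?_)
    simp [hT.le, mul_comm]
  obtain ⟨F, f1, f2, f3, f4, f5, hFlim⟩ := exists_weak_limit (cylMeasure T) (hyperfilter ℕ)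
    (F := fun n p => approx (timeStep n) q p.2 p.1) hM (fun n => hq.measurable_approx hM)
    (fun n p => (hq.approx hM p.2).nonneg _) (fun n p => (hq.approx hM p.2).le _)
    (fun n => (hFn n).1) (fun n => (hFn n).2)
  have hF : IsDensityFor (cylMeasure T) M (A * T) F := ⟨f1, f2, f3, f4, f5⟩
  have hW : LimitWeakForm T q G F := fun t ht htT ψ hψ hout =>
    weak_form_of_limit hM hA hq hGlim hFlim ht htT hψ hout
  have hqd : IsDensityFor stripMeasure M A q :=
    ⟨hq.meas, hq.nonneg, hq.le, hq.int.restrict, hS q hq⟩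
  -- No step has been made at time zero, so the approximations are constantly `q`.
  have hG0 : G 0 =ᵐ[stripMeasure] q := by
    have m : MemLp (fun z => G 0 z - q z) 2 stripMeasure := (hGd 0).memLp_two.sub hqd.memLp_two
    have := ae_eq_zero_of_forall_bump (locallyIntegrableOn_strip m (by norm_num)) fun φ hφ => by
      have h1 := hGlim 0 φ (hφ.memLp 2)
      have h2 : ∀ n, approx (timeStep n) q 0 = q := fun n => by simp [approx]
      simp only [h2] at h1
      have h3 := tendsto_nhds_unique h1 tendsto_const_nhds
      simp only [sub_mul]
      rw [integral_sub, h3, sub_self]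
      · exact (hGd 0).memLp_two.integrable_mul (hφ.memLp 2)
      · exact hqd.memLp_two.integrable_mul (hφ.memLp 2)
    filter_upwards [this] with z hz
    simpa [sub_eq_zero] using hz
  have hslice := hW.ae_slice hT hF hGd
  -- The solution is `F` at the times where its slice is the right one and `G` at the exceptional
  -- null set of times. It then equals `F` almost everywhere in space-time, hence is measurable, and
  -- has the slice `G t` at every time.
  set P : ℝ → Prop := fun s => (fun z => F (z, s)) =ᵐ[stripMeasure] G s with hP
  set f : ℝ × ℝ × ℝ → ℝ := fun p =>
    if P p.2.2 then F ((p.1, p.2.1), p.2.2) else G p.2.2 (p.1, p.2.1) with hf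
  have hfG : ∀ t, atTime f t =ᵐ[stripMeasure] G t := by
    intro t
    by_cases ht : P t
    · have : atTime f t = fun z => F (z, t) := by
        funext z
        simp [atTime, hf, ht]
      rw [this]
      exact ht
    · have : atTime f t = G t := by
        funext z
        simp [atTime, hf, ht]
      rw [this]
  have hfint : ∀ t (φ : ℝ × ℝ → ℝ), ∫ z, atTime f t z * φ z ∂stripMeasure
      = ∫ z, G t z * φ z ∂stripMeasure := fun t φ =>
    integral_congr_ae (by filter_upwards [hfG t] with z hz; rw [hz])
  have hfF : ∀ t ≤ T, ∀ᵐ p ∂cylMeasure t, f (p.1.1, p.1.2, p.2) = F p := by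
    intro t htT
    have h1 : ∀ᵐ s ∂volume.restrict (Ioo 0 t), P s :=
      ae_restrict_of_ae_restrict_of_subset (Ioo_subset_Ioo_right htT) hslice
    have h2 : ∀ᵐ p ∂cylMeasure t, P p.2 := Measure.quasiMeasurePreserving_snd.ae h1
    filter_upwards [h2] with p hp
    simp [hf, hp]
  have htop : ∀ t, eLpNorm (atTime f t) ∞ stripMeasure ≤ ENNReal.ofReal M := fun t => by
    rw [eLpNorm_congr_ae (hfG t)]; exact (hGd t).eLpNorm_top_le
  have hone : ∀ t, eLpNorm (atTime f t) 1 stripMeasure ≤ ENNReal.ofReal A := fun t => by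
    rw [eLpNorm_congr_ae (hfG t)]; exact (hGd t).eLpNorm_one_le
  have hmeas : ∀ t, AEStronglyMeasurable (atTime f t) stripMeasure := fun t =>
    (hGd t).meas.aestronglyMeasurable.congr (hfG t).symm
  refine ⟨f, ⟨⟨?_, fun t _ => ⟨hmeas t, (hone t).trans_lt ENNReal.ofReal_lt_top⟩,
    fun t _ => ⟨hmeas t, (htop t).trans_lt ENNReal.ofReal_lt_top⟩, ?_⟩, (hfG 0).trans hG0, ?_, ?_⟩,
    fun t _ => ⟨?_, htop t, hone t⟩⟩
  · have hsymm := (measurePreserving_cyl T).symm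
    have h1 := hsymm.quasiMeasurePreserving.ae (hfF T le_rfl)
    refine (f1.comp (MeasurableEquiv.measurable
      (MeasurableEquiv.prodAssoc : (ℝ × ℝ) × ℝ ≃ᵐ ℝ × ℝ × ℝ).symm)).aestronglyMeasurable.congr ?_
    filter_upwards [h1] with p hp
    exact hp.symm
  · refine ⟨max M.toNNReal A.toNNReal, .of_forall fun t => ⟨(hone t).trans ?_, (htop t).trans ?_⟩⟩
    · exact ENNReal.coe_le_coe.2 (le_max_right _ _)
    · exact ENNReal.coe_le_coe.2 (le_max_left _ _)
  · intro ψ hψ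
    obtain ⟨R, C, Ψ, Ψx, Ψv, Ψvv, Ψs, hR, hj, hΨ, -⟩ := hψ.exists_jet hT
    have cΨ := hj.uc.continuous
    have mΨ : ∀ r, Measurable fun z : ℝ × ℝ => Ψ (z.1, z.2, r) := fun r =>
      (by fun_prop : Continuous fun z : ℝ × ℝ => Ψ (z.1, z.2, r)).measurable
    have LΨ : ∀ r p, MemLp (fun z : ℝ × ℝ => Ψ (z.1, z.2, r)) p stripMeasure := fun r p =>
      memLp_of_band (mΨ r) (fun z hz => hj.supp _ hz) (fun z => hj.bdd _) p
    have heq : ∀ t ∈ Icc 0 T, ∫ z, atTime f t z * atTime ψ t z ∂stripMeasure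
        = ∫ z, G t z * Ψ (z.1, z.2, t) ∂stripMeasure := by
      intro t ht
      rw [hfint]
      refine integral_congr_ae ?_
      filter_upwards [ae_restrict_mem measurableSet_strip] with z hz
      rw [mem_strip] at hz
      rw [atTime, hΨ (x := (z.1, z.2, t)) (mem_closedCyl.2 ⟨⟨hz.1.le, hz.2.le⟩, ht⟩)]
    refine ContinuousOn.congr ?_ heq
    intro t₀ ht₀
    -- For a time-dependent test function, freeze it at `t₀` and use weak continuity; the change of
    -- the test function is uniformly small and is paired with mass at most `A`.
    have hwc := hW.weak_continuity hT hM hF hGd hG0 (LΨ t₀ 2) t₀ ht₀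
    rw [Metric.continuousWithinAt_iff] at hwc ⊢
    intro ε hε
    obtain ⟨δ₁, hδ₁, H1⟩ := hwc (ε / 2) (by positivity)
    obtain ⟨δ₂, hδ₂, H2⟩ := Metric.uniformContinuous_iff.1 hj.uc (ε / (2 * (A + 1)))
      (by positivity)
    refine ⟨min δ₁ δ₂, by positivity, fun t ht htd => ?_⟩
    have e1 := H1 ht (htd.trans_le (min_le_left _ _))
    have hd : ∀ z : ℝ × ℝ, |Ψ (z.1, z.2, t) - Ψ (z.1, z.2, t₀)| ≤ ε / (2 * (A + 1)) := by
      intro z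
      refine (H2 (a := (z.1, z.2, t)) (b := (z.1, z.2, t₀)) ?_).le
      simp only [Prod.dist_eq, dist_self]
      exact max_lt hδ₂ (max_lt hδ₂ (htd.trans_le (min_le_right _ _)))
    have i1 : ∀ r, Integrable (fun z => G t z * Ψ (z.1, z.2, r)) stripMeasure := fun r =>
      (hGd t).memLp_two.integrable_mul (LΨ r 2)
    have e2 : |(∫ z, G t z * Ψ (z.1, z.2, t) ∂stripMeasure)
        - ∫ z, G t z * Ψ (z.1, z.2, t₀) ∂stripMeasure| ≤ A * (ε / (2 * (A + 1))) := by
      rw [← integral_sub (i1 t) (i1 t₀), ← Real.norm_eq_abs]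
      refine (norm_integral_le_of_norm_le (g := fun z => G t z * (ε / (2 * (A + 1))))
        ((hGd t).int.mul_const _) (.of_forall fun z => ?_)).trans ?_
      · rw [← mul_sub, norm_mul, Real.norm_eq_abs, Real.norm_eq_abs,
          abs_of_nonneg ((hGd t).nonneg z)]
        exact mul_le_mul_of_nonneg_left (hd z) ((hGd t).nonneg z)
      · rw [integral_mul_const]
        exact mul_le_mul_of_nonneg_right (hGd t).mass (by positivity)
    have e3 : A * (ε / (2 * (A + 1))) < ε / 2 := by
      rw [mul_div_assoc', div_lt_div_iff₀ (by positivity) (by positivity)]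
      nlinarith
    rw [Real.dist_eq] at e1 ⊢
    calc _ ≤ |(∫ z, G t z * Ψ (z.1, z.2, t) ∂stripMeasure)
          - ∫ z, G t z * Ψ (z.1, z.2, t₀) ∂stripMeasure|
          + |(∫ z, G t z * Ψ (z.1, z.2, t₀) ∂stripMeasure)
          - ∫ z, G t₀ z * Ψ (z.1, z.2, t₀) ∂stripMeasure| := abs_sub_le _ _ _
      _ < ε := by linarith
  · intro t ht ψ hψ hout
    rcases ht.1.eq_or_lt with h0 | h0
    · subst h0
      simp [cyl]
    · rw [hfint, setIntegral_cyl]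
      have e0 : ∫ z, atTime f 0 z * atTime ψ 0 z ∂stripMeasure
          = ∫ z, q z * atTime ψ 0 z ∂stripMeasure :=
        integral_congr_ae (by filter_upwards [(hfG 0).trans hG0] with z hz; rw [hz])
      rw [e0, hW t h0 ht.2 ψ hψ hout]
      refine integral_congr_ae ?_
      filter_upwards [hfF t ht.2] with p hp
      rw [hp]
      rfl
  · filter_upwards [hfG t] with z hz
    rw [hz]
    exact (hGd t).nonneg z

end FokkerPlanck

namespace FokkerPlanck

open Filter Topology ProbabilityTheory

/-! ### The Kolmogorov semigroup -/

/-- The law of a pair of independent standard normal variables. -/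
noncomputable def gaussPair : Measure (ℝ × ℝ) := (gaussianReal 0 1).prod (gaussianReal 0 1)

instance : IsProbabilityMeasure gaussPair := by unfold gaussPair; infer_instance

/-- Displacement in position, up to the factor `s^{3/2}`. -/
noncomputable def posNoise (z : ℝ × ℝ) : ℝ := z.1 / √2 + z.2 / √6

/-- The position and velocity at time `s` of a particle starting at `p`, if `r² = s`. -/
noncomputable def flow (r : ℝ) (p z : ℝ × ℝ) : ℝ × ℝ :=
  (p.1 + r ^ 2 * p.2 + r ^ 3 * posNoise z, p.2 + √2 * r * z.1)

/-- The semigroup generated by `v ∂ₓ + ∂ᵥᵥ` (for `s ≥ 0`). -/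
noncomputable def kolmogorov (s : ℝ) (g : ℝ × ℝ → ℝ) (p : ℝ × ℝ) : ℝ :=
  ∫ z, g (p.1 + s * p.2 + √s ^ 3 * posNoise z, p.2 + √2 * √s * z.1) ∂gaussPair

/-- The noise is that of velocity `√2 B_s` and position `√2 ∫ B`: variances `2s` and `2s³/3`,
covariance `s²`, which fixes the weights `1/√2` and `1/√6`. In the variable `r = √s` the flow is
polynomial, so it can be differentiated without a singularity. -/
lemma kolmogorov_eq_flow {s : ℝ} (hs : 0 ≤ s) (g : ℝ × ℝ → ℝ) (p : ℝ × ℝ) :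
    kolmogorov s g p = ∫ z, g (flow (√s) p z) ∂gaussPair := by
  simp only [kolmogorov, flow, Real.sq_sqrt hs]

lemma continuous_posNoise : Continuous posNoise := by unfold posNoise; fun_prop

lemma integrable_bdd_gaussPair {f : ℝ × ℝ → ℝ} (hf : Continuous f) {C : ℝ} (hC : ∀ z, |f z| ≤ C) :
    Integrable f gaussPair :=
  (integrable_const C).mono' hf.aestronglyMeasurable (.of_forall hC)

lemma continuous_kolmogorov {g : ℝ × ℝ → ℝ} (hg : Continuous g) {C : ℝ} (hC : ∀ z, |g z| ≤ C) :
    Continuous fun q : ℝ × ℝ × ℝ => kolmogorov q.2.2 g (q.1, q.2.1) := by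
  have := continuous_posNoise
  refine continuous_of_dominated (F := fun (q : ℝ × ℝ × ℝ) (z : ℝ × ℝ) =>
      g ((q.1, q.2.1).1 + q.2.2 * (q.1, q.2.1).2 + √q.2.2 ^ 3 * posNoise z,
        (q.1, q.2.1).2 + √2 * √q.2.2 * z.1))
    (bound := fun _ => C) (fun q => ?_) (fun q => ?_) (integrable_const C)
    (.of_forall fun z => ?_)
  · exact (by fun_prop : Continuous fun z : ℝ × ℝ => g ((q.1, q.2.1).1 + q.2.2 * (q.1, q.2.1).2
      + √q.2.2 ^ 3 * posNoise z, (q.1, q.2.1).2 + √2 * √q.2.2 * z.1)).aestronglyMeasurable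
  · exact .of_forall fun z => hC _
  · fun_prop

lemma continuous_kolmogorov_slice {g : ℝ × ℝ → ℝ} (hg : Continuous g) {C : ℝ}
    (hC : ∀ z, |g z| ≤ C) (s : ℝ) : Continuous (kolmogorov s g) :=
  (continuous_kolmogorov hg hC).comp (by fun_prop : Continuous fun p : ℝ × ℝ => (p.1, p.2, s))

lemma abs_kolmogorov_le {g : ℝ × ℝ → ℝ} {C : ℝ} (hC : ∀ z, |g z| ≤ C) (s : ℝ) (p : ℝ × ℝ) :
    |kolmogorov s g p| ≤ C := by
  rw [← Real.norm_eq_abs, kolmogorov]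
  refine (norm_integral_le_of_norm_le_const (μ := gaussPair) (C := C)
    (.of_forall fun z => hC _)).trans ?_
  simp

lemma kolmogorov_zero (g : ℝ × ℝ → ℝ) : kolmogorov 0 g = g := by
  funext p
  simp [kolmogorov]

/-- `g` is continuously differentiable, with partial derivatives `g₁`, `g₂`, all bounded. -/
structure IsC1b (g g₁ g₂ : ℝ × ℝ → ℝ) : Prop where
  cont : Continuous g
  cont₁ : Continuous g₁
  cont₂ : Continuous g₂
  bdd : ∃ C, ∀ z, |g z| ≤ C
  bdd₁ : ∃ C, ∀ z, |g₁ z| ≤ C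
  bdd₂ : ∃ C, ∀ z, |g₂ z| ≤ C
  deriv : ∀ z, HasFDerivAt g
    (g₁ z • ContinuousLinearMap.fst ℝ ℝ ℝ + g₂ z • ContinuousLinearMap.snd ℝ ℝ ℝ) z

lemma IsC1b.hasDerivAt_fst {g g₁ g₂ : ℝ × ℝ → ℝ} (h : IsC1b g g₁ g₂) (x v : ℝ) :
    HasDerivAt (fun y => g (y, v)) (g₁ (x, v)) x := by
  have := (h.deriv (x, v)).comp_hasDerivAt x ((hasDerivAt_id x).prodMk (hasDerivAt_const x v))
  exact this.congr_deriv (by simp)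

lemma IsC1b.hasDerivAt_snd {g g₁ g₂ : ℝ × ℝ → ℝ} (h : IsC1b g g₁ g₂) (x v : ℝ) :
    HasDerivAt (fun w => g (x, w)) (g₂ (x, v)) v := by
  have := (h.deriv (x, v)).comp_hasDerivAt v ((hasDerivAt_const v x).prodMk (hasDerivAt_id v))
  exact this.congr_deriv (by simp)

lemma IsC1b.comp_hasDerivAt {g g₁ g₂ : ℝ × ℝ → ℝ} (h : IsC1b g g₁ g₂) {a b : ℝ → ℝ} {a' b' r : ℝ}
    (ha : HasDerivAt a a' r) (hb : HasDerivAt b b' r) :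
    HasDerivAt (fun r => g (a r, b r)) (g₁ (a r, b r) * a' + g₂ (a r, b r) * b') r := by
  have := (h.deriv (a r, b r)).comp_hasDerivAt r (ha.prodMk hb)
  exact this.congr_deriv (by simp)

/-- Differentiation under the integral sign. The semigroup commutes with `∂ₓ` but not with `∂ᵥ`: the
position reached depends on the initial velocity through `s v`, hence the extra term. -/
lemma IsC1b.kolmogorov {g g₁ g₂ : ℝ × ℝ → ℝ} (h : IsC1b g g₁ g₂) (s : ℝ) :
    IsC1b (kolmogorov s g) (kolmogorov s g₁)
      (fun p => kolmogorov s g₂ p + s * kolmogorov s g₁ p) := by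
  obtain ⟨C, hC⟩ := h.bdd
  obtain ⟨C₁, hC₁⟩ := h.bdd₁
  obtain ⟨C₂, hC₂⟩ := h.bdd₂
  have c0 := h.cont
  have c1 := h.cont₁
  have c2 := h.cont₂
  have cN := continuous_posNoise
  have k1 := continuous_kolmogorov_slice h.cont₁ hC₁ s
  have k2 := continuous_kolmogorov_slice h.cont₂ hC₂ s
  refine ⟨continuous_kolmogorov_slice h.cont hC s, k1, by fun_prop,
    ⟨C, abs_kolmogorov_le hC s⟩, ⟨C₁, abs_kolmogorov_le hC₁ s⟩,
    ⟨C₂ + |s| * C₁, fun p => ?_⟩, fun p => ?_⟩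
  · refine (abs_add_le _ _).trans ?_
    rw [abs_mul]
    exact add_le_add (abs_kolmogorov_le hC₂ s p)
      (mul_le_mul_of_nonneg_left (abs_kolmogorov_le hC₁ s p) (abs_nonneg _))
  · set pt : ℝ × ℝ → ℝ × ℝ → ℝ × ℝ := fun p z =>
      (p.1 + s * p.2 + √s ^ 3 * posNoise z, p.2 + √2 * √s * z.1) with hpt
    have cpt : Continuous (pt p) := by fun_prop
    set F' : ℝ × ℝ → ℝ × ℝ → (ℝ × ℝ →L[ℝ] ℝ) := fun p z =>
      g₁ (pt p z) • ContinuousLinearMap.fst ℝ ℝ ℝ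
        + (g₂ (pt p z) + s * g₁ (pt p z)) • ContinuousLinearMap.snd ℝ ℝ ℝ with hF'
    have hd := hasFDerivAt_integral_of_dominated_of_fderiv_le (μ := gaussPair)
      (F := fun p z => g (pt p z)) (F' := F') (x₀ := p) (s := univ)
      (bound := fun _ => C₁ + (C₂ + |s| * C₁)) univ_mem
      (.of_forall fun p => (by fun_prop : Continuous fun z => g (pt p z)).aestronglyMeasurable)
      (integrable_bdd_gaussPair (by fun_prop) (fun z => hC _))
      ((by fun_prop : Continuous (F' p)).aestronglyMeasurable) ?_ (integrable_const _) ?_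
    · have i1 : Integrable (fun z => g₁ (pt p z)) gaussPair :=
        integrable_bdd_gaussPair (by fun_prop) (fun z => hC₁ _)
      have i2 : Integrable (fun z => g₂ (pt p z)) gaussPair :=
        integrable_bdd_gaussPair (by fun_prop) (fun z => hC₂ _)
      have i3 : Integrable (fun z => g₂ (pt p z) + s * g₁ (pt p z)) gaussPair :=
        i2.add (i1.const_mul s)
      convert! hd using 1
      rw [hF']
      simp only
      rw [integral_add (i1.smul_const _) (i3.smul_const _), integral_smul_const,
        integral_smul_const (f := fun z => g₂ (pt p z) + s * g₁ (pt p z)),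
        integral_add i2 (i1.const_mul s), integral_const_mul]
      rfl
    · refine .of_forall fun z q _ => ?_
      refine (norm_add_le _ _).trans ?_
      rw [norm_smul, norm_smul]
      have n1 : ‖ContinuousLinearMap.fst ℝ ℝ ℝ‖ ≤ 1 := ContinuousLinearMap.norm_fst_le ℝ ℝ ℝ
      have n2 : ‖ContinuousLinearMap.snd ℝ ℝ ℝ‖ ≤ 1 := ContinuousLinearMap.norm_snd_le ℝ ℝ ℝ
      refine add_le_add ?_ ?_
      · exact (mul_le_of_le_one_right (norm_nonneg _) n1).trans (hC₁ _)
      · refine (mul_le_of_le_one_right (norm_nonneg _) n2).trans ?_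
        refine (norm_add_le _ _).trans (add_le_add (hC₂ _) ?_)
        rw [norm_mul]
        exact mul_le_mul_of_nonneg_left (hC₁ _) (norm_nonneg _)
    · refine .of_forall fun z q _ => ?_
      have hin : HasFDerivAt (fun q => pt q z)
          ((ContinuousLinearMap.fst ℝ ℝ ℝ + s • ContinuousLinearMap.snd ℝ ℝ ℝ).prod
            (ContinuousLinearMap.snd ℝ ℝ ℝ)) q := by
        refine HasFDerivAt.prodMk ?_ ?_
        · exact (hasFDerivAt_fst.add (hasFDerivAt_snd.const_mul s)).add_const _
        · exact hasFDerivAt_snd.add_const _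
      convert! (h.deriv (pt q z)).comp q hin using 1
      ext
      · simp [hF']
      · simp [hF']
        ring

lemma integral_gaussianReal (f : ℝ → ℝ) :
    ∫ x, f x ∂gaussianReal 0 1 = ∫ x, f x * gaussianPDFReal 0 1 x := by
  rw [integral_gaussianReal_eq_integral_smul one_ne_zero]
  simp only [smul_eq_mul, mul_comm]

lemma hasDerivAt_gaussianPDF (x : ℝ) :
    HasDerivAt (gaussianPDFReal 0 1) (-(x * gaussianPDFReal 0 1 x)) x := by
  have h1 : HasDerivAt (fun x : ℝ => -(x - 0) ^ 2 / (2 * ((1 : ℝ≥0) : ℝ))) (-x) x := by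
    have := (((hasDerivAt_id x).sub_const 0).pow 2).neg.div_const (2 * ((1 : ℝ≥0) : ℝ))
    convert! this using 1
    simp
    ring
  have h2 := (h1.exp).const_mul ((√(2 * Real.pi * ((1 : ℝ≥0) : ℝ)))⁻¹)
  rw [gaussianPDFReal_def]
  convert! h2 using 1
  ring

/-- Gaussian integration by parts. -/
lemma stein {f f' : ℝ → ℝ} (hf : ∀ x, HasDerivAt f (f' x) x) (hf' : Continuous f') {C C' : ℝ}
    (hC : ∀ x, |f x| ≤ C) (hC' : ∀ x, |f' x| ≤ C') :
    ∫ x, x * f x ∂gaussianReal 0 1 = ∫ x, f' x ∂gaussianReal 0 1 := by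
  have cf : Continuous f := continuous_iff_continuousAt.2 fun x => (hf x).continuousAt
  have ip := integrable_gaussianPDFReal 0 1
  have ixp : Integrable fun x : ℝ => x * gaussianPDFReal 0 1 x := by
    have h1 : Integrable (fun x : ℝ => x) (gaussianReal 0 1) :=
      (memLp_id_gaussianReal 1).integrable (by simp)
    rw [gaussianReal_of_var_ne_zero 0 one_ne_zero, integrable_withDensity_iff
      (measurable_gaussianPDF 0 1) (.of_forall fun x => gaussianPDF_lt_top)] at h1
    simpa only [toReal_gaussianPDF] using h1
  have := integral_mul_deriv_eq_deriv_mul_of_integrable (u := f) (u' := f')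
    (v := gaussianPDFReal 0 1) (v' := fun x => -(x * gaussianPDFReal 0 1 x))
    (fun x _ => hf x) (fun x _ => hasDerivAt_gaussianPDF x)
    (ixp.neg.bdd_mul cf.aestronglyMeasurable (.of_forall hC))
    (ip.bdd_mul hf'.aestronglyMeasurable (.of_forall hC'))
    (ip.bdd_mul cf.aestronglyMeasurable (.of_forall hC))
  rw [integral_gaussianReal, integral_gaussianReal]
  simp only [mul_neg, integral_neg, neg_inj] at this
  rw [← this]
  exact integral_congr_ae (.of_forall fun x => by simp only; ring)

lemma integrable_fst_gaussPair : Integrable (fun z : ℝ × ℝ => z.1) gaussPair := by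
  have h1 : Integrable (fun x : ℝ => x) (gaussianReal 0 1) :=
    (memLp_id_gaussianReal 1).integrable (by simp)
  exact h1.comp_fst _

lemma integrable_snd_gaussPair : Integrable (fun z : ℝ × ℝ => z.2) gaussPair := by
  have h1 : Integrable (fun x : ℝ => x) (gaussianReal 0 1) :=
    (memLp_id_gaussianReal 1).integrable (by simp)
  exact h1.comp_snd _

lemma stein_fst {f f' : ℝ × ℝ → ℝ} (hf : ∀ x y, HasDerivAt (fun x => f (x, y)) (f' (x, y)) x)
    (cf : Continuous f) (hf' : Continuous f') {C C' : ℝ} (hC : ∀ x, |f x| ≤ C)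
    (hC' : ∀ x, |f' x| ≤ C') :
    ∫ z, z.1 * f z ∂gaussPair = ∫ z, f' z ∂gaussPair := by
  have i1 : Integrable (fun z : ℝ × ℝ => z.1 * f z) gaussPair :=
    integrable_fst_gaussPair.mul_bdd cf.aestronglyMeasurable (.of_forall hC)
  have i2 := integrable_bdd_gaussPair hf' hC'
  unfold gaussPair at i1 i2 ⊢
  rw [integral_prod_symm _ i1, integral_prod_symm _ i2]
  refine integral_congr_ae (.of_forall fun y => ?_)
  exact stein (f := fun x => f (x, y)) (fun x => hf x y) (by fun_prop) (fun x => hC _)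
    (fun x => hC' _)

lemma stein_snd {f f' : ℝ × ℝ → ℝ} (hf : ∀ x y, HasDerivAt (fun y => f (x, y)) (f' (x, y)) y)
    (cf : Continuous f) (hf' : Continuous f') {C C' : ℝ} (hC : ∀ x, |f x| ≤ C)
    (hC' : ∀ x, |f' x| ≤ C') :
    ∫ z, z.2 * f z ∂gaussPair = ∫ z, f' z ∂gaussPair := by
  have i1 : Integrable (fun z : ℝ × ℝ => z.2 * f z) gaussPair :=
    integrable_snd_gaussPair.mul_bdd cf.aestronglyMeasurable (.of_forall hC)
  have i2 := integrable_bdd_gaussPair hf' hC'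
  unfold gaussPair at i1 i2 ⊢
  rw [integral_prod _ i1, integral_prod _ i2]
  refine integral_congr_ae (.of_forall fun x => ?_)
  exact stein (f := fun y => f (x, y)) (fun y => hf x y) (by fun_prop) (fun x => hC _)
    (fun x => hC' _)

end FokkerPlanck

/-! ### Evolution of `C²` functions and the Kolmogorov equation -/

namespace FokkerPlanck

open Filter Topology ProbabilityTheory

/-- A function of class `C²` with bounded derivatives, bundled with its derivatives. -/
structure Jet2 where
  f : ℝ × ℝ → ℝ
  f₁ : ℝ × ℝ → ℝ
  f₂ : ℝ × ℝ → ℝ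
  f₁₁ : ℝ × ℝ → ℝ
  f₁₂ : ℝ × ℝ → ℝ
  f₂₂ : ℝ × ℝ → ℝ
  d : IsC1b f f₁ f₂
  d₁ : IsC1b f₁ f₁₁ f₁₂
  d₂ : IsC1b f₂ f₁₂ f₂₂

lemma IsC1b.add_smul {g g₁ g₂ k k₁ k₂ : ℝ × ℝ → ℝ} (h : IsC1b g g₁ g₂) (h' : IsC1b k k₁ k₂)
    (c : ℝ) : IsC1b (fun z => g z + c * k z) (fun z => g₁ z + c * k₁ z)
      (fun z => g₂ z + c * k₂ z) := by
  have b : ∀ {u w : ℝ × ℝ → ℝ}, (∃ C, ∀ z, |u z| ≤ C) → (∃ C, ∀ z, |w z| ≤ C) →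
      ∃ C, ∀ z, |u z + c * w z| ≤ C := by
    rintro u w ⟨C, hC⟩ ⟨D, hD⟩
    refine ⟨C + |c| * D, fun z => (abs_add_le _ _).trans ?_⟩
    rw [abs_mul]
    exact add_le_add (hC z) (mul_le_mul_of_nonneg_left (hD z) (abs_nonneg _))
  refine ⟨h.cont.add (h'.cont.const_mul c), h.cont₁.add (h'.cont₁.const_mul c),
    h.cont₂.add (h'.cont₂.const_mul c), b h.bdd h'.bdd, b h.bdd₁ h'.bdd₁, b h.bdd₂ h'.bdd₂,
    fun z => ?_⟩
  refine ((h.deriv z).add ((h'.deriv z).const_mul c)).congr_fderiv ?_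
  ext <;> simp

/-- The Kolmogorov semigroup acting on `C²` functions. -/
noncomputable def Jet2.evolve (s : ℝ) (J : Jet2) : Jet2 where
  f := kolmogorov s J.f
  f₁ := kolmogorov s J.f₁
  f₂ := fun p => kolmogorov s J.f₂ p + s * kolmogorov s J.f₁ p
  f₁₁ := kolmogorov s J.f₁₁
  f₁₂ := fun p => kolmogorov s J.f₁₂ p + s * kolmogorov s J.f₁₁ p
  f₂₂ := fun p => kolmogorov s J.f₂₂ p + s * kolmogorov s J.f₁₂ p
    + s * (kolmogorov s J.f₁₂ p + s * kolmogorov s J.f₁₁ p)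
  d := J.d.kolmogorov s
  d₁ := J.d₁.kolmogorov s
  d₂ := (J.d₂.kolmogorov s).add_smul (J.d₁.kolmogorov s) s

/-- A function of the position, equal to `1` near `[0,1]`, and its first two derivatives. -/
structure IsCutoff (ε : ℝ) (θ θ' θ'' : ℝ → ℝ) : Prop where
  deriv : ∀ x, HasDerivAt θ (θ' x) x
  deriv' : ∀ x, HasDerivAt θ' (θ'' x) x
  cont'' : Continuous θ''
  bdd' : ∃ C, ∀ x, |θ' x| ≤ C
  bdd'' : ∃ C, ∀ x, |θ'' x| ≤ C
  nonneg : ∀ x, 0 ≤ θ x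
  le_one : ∀ x, θ x ≤ 1
  eq_one : ∀ x ∈ Icc (0 : ℝ) 1, θ x = 1
  eq_zero' : ∀ x ∈ Icc (0 : ℝ) 1, θ' x = 0
  eq_zero : ∀ x, x ≤ -ε ∨ 1 + ε ≤ x → θ x = 0

lemma exists_isCutoff {ε : ℝ} (hε : 0 < ε) : ∃ θ θ' θ'', IsCutoff ε θ θ' θ'' := by
  -- The inner radius exceeds `1/2`, so the bump is constant near the endpoints too and its
  -- derivative vanishes on the closed interval.
  let b : ContDiffBump (1 / 2 : ℝ) := ⟨1 / 2 + ε / 2, 1 / 2 + ε, by linarith, by linarith⟩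
  have hb : ContDiff ℝ 2 b := b.contDiff
  have hb1 : ContDiff ℝ 1 (deriv b) := (contDiff_succ_iff_deriv (n := 1)).1 (by exact_mod_cast hb) |>.2.2
  have hb2 : ContDiff ℝ 0 (deriv (deriv b)) :=
    (contDiff_succ_iff_deriv (n := 0)).1 (by simpa using hb1) |>.2.2
  have k0 : HasCompactSupport b := b.hasCompactSupport
  have one : ∀ x ∈ Icc (0 : ℝ) 1, b =ᶠ[𝓝 x] fun _ => 1 := by
    intro x hx
    have : Metric.ball (1 / 2 : ℝ) (1 / 2 + ε / 2) ∈ 𝓝 x := by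
      refine Metric.isOpen_ball.mem_nhds ?_
      rw [Metric.mem_ball, Real.dist_eq, abs_lt]
      constructor <;> linarith [hx.1, hx.2]
    filter_upwards [this] with y hy
    exact b.one_of_mem_closedBall (Metric.ball_subset_closedBall hy)
  have zero' : ∀ x ∈ Icc (0 : ℝ) 1, deriv b =ᶠ[𝓝 x] fun _ => 0 := by
    intro x hx
    have := (one x hx).deriv
    simpa using this
  refine ⟨b, deriv b, deriv (deriv b), ⟨fun x => ?_, fun x => ?_, hb2.continuous, ?_, ?_,
    fun x => b.nonneg, fun x => b.le_one, fun x hx => (one x hx).eq_of_nhds,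
    fun x hx => (zero' x hx).eq_of_nhds, fun x hx => ?_⟩⟩
  · exact (hb.differentiable (by norm_num) x).hasDerivAt
  · exact (hb1.differentiable (by norm_num) x).hasDerivAt
  · exact k0.deriv.exists_bound_of_continuous hb1.continuous
  · exact k0.deriv.deriv.exists_bound_of_continuous hb2.continuous
  · refine b.zero_of_le_dist ?_
    change 1 / 2 + ε ≤ _
    rw [Real.dist_eq, le_abs]
    rcases hx with h | h
    · right; linarith
    · left; linarith

lemma IsC1b.mul_fst {g g₁ g₂ : ℝ × ℝ → ℝ} (h : IsC1b g g₁ g₂) {θ θ' : ℝ → ℝ}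
    (hθ : ∀ x, HasDerivAt θ (θ' x) x) (cθ' : Continuous θ') (bθ : ∃ C, ∀ x, |θ x| ≤ C)
    (bθ' : ∃ C, ∀ x, |θ' x| ≤ C) :
    IsC1b (fun z => θ z.1 * g z) (fun z => θ' z.1 * g z + θ z.1 * g₁ z)
      (fun z => θ z.1 * g₂ z) := by
  have cθ : Continuous θ := continuous_iff_continuousAt.2 fun x => (hθ x).continuousAt
  have c0 := h.cont
  have c1 := h.cont₁
  have c2 := h.cont₂
  have bm : ∀ {u : ℝ → ℝ} {w : ℝ × ℝ → ℝ}, (∃ C, ∀ z, |u z| ≤ C) → (∃ C, ∀ z, |w z| ≤ C) →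
      ∃ C, ∀ z : ℝ × ℝ, |u z.1 * w z| ≤ C := by
    rintro u w ⟨C, hC⟩ ⟨D, hD⟩
    refine ⟨C * D, fun z => ?_⟩
    rw [abs_mul]
    exact mul_le_mul (hC _) (hD _) (abs_nonneg _) ((abs_nonneg _).trans (hC z.1))
  refine ⟨by fun_prop, by fun_prop, by fun_prop, bm bθ h.bdd, ?_, bm bθ h.bdd₂, fun z => ?_⟩
  · obtain ⟨C, hC⟩ := bm bθ' h.bdd
    obtain ⟨D, hD⟩ := bm bθ h.bdd₁
    exact ⟨C + D, fun z => (abs_add_le _ _).trans (add_le_add (hC z) (hD z))⟩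
  · have h1 : HasFDerivAt (fun z : ℝ × ℝ => θ z.1)
        (θ' z.1 • ContinuousLinearMap.fst ℝ ℝ ℝ) z :=
      (hθ z.1).comp_hasFDerivAt z hasFDerivAt_fst
    refine (h1.mul (h.deriv z)).congr_fderiv ?_
    ext <;> simp
    ring

/-- Multiplication of a `C²` function by a cutoff in position. -/
def Jet2.cut {ε : ℝ} {θ θ' θ'' : ℝ → ℝ} (hθ : IsCutoff ε θ θ' θ'') (J : Jet2) : Jet2 where
  f := fun z => θ z.1 * J.f z
  f₁ := fun z => θ' z.1 * J.f z + θ z.1 * J.f₁ z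
  f₂ := fun z => θ z.1 * J.f₂ z
  f₁₁ := fun z => (θ'' z.1 * J.f z + θ' z.1 * J.f₁ z) + (θ' z.1 * J.f₁ z + θ z.1 * J.f₁₁ z)
  f₁₂ := fun z => θ' z.1 * J.f₂ z + θ z.1 * J.f₁₂ z
  f₂₂ := fun z => θ z.1 * J.f₂₂ z
  d := J.d.mul_fst hθ.deriv (continuous_iff_continuousAt.2 fun x => (hθ.deriv' x).continuousAt)
    ⟨1, fun x => abs_le.2 ⟨by linarith [hθ.nonneg x], hθ.le_one x⟩⟩ hθ.bdd'
  d₁ := by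
    have := (J.d.mul_fst hθ.deriv' hθ.cont'' hθ.bdd' hθ.bdd'').add_smul
      (J.d₁.mul_fst hθ.deriv (continuous_iff_continuousAt.2 fun x => (hθ.deriv' x).continuousAt)
        ⟨1, fun x => abs_le.2 ⟨by linarith [hθ.nonneg x], hθ.le_one x⟩⟩ hθ.bdd') 1
    simpa only [one_mul] using this
  d₂ := J.d₂.mul_fst hθ.deriv
    (continuous_iff_continuousAt.2 fun x => (hθ.deriv' x).continuousAt)
    ⟨1, fun x => abs_le.2 ⟨by linarith [hθ.nonneg x], hθ.le_one x⟩⟩ hθ.bdd'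

/-- The generator `v ∂ₓ + ∂ᵥᵥ`. -/
def Jet2.gen (J : Jet2) (p : ℝ × ℝ) : ℝ := p.2 * J.f₁ p + J.f₂₂ p

/-- The Kolmogorov equation. -/
lemma Jet2.hasDerivAt_evolve (J : Jet2) (p : ℝ × ℝ) {s : ℝ} (hs : 0 < s) :
    HasDerivAt (fun r => (J.evolve r).f p) ((J.evolve s).gen p) s := by
  obtain ⟨C, hC⟩ := J.d.bdd
  obtain ⟨C₁, hC₁⟩ := J.d.bdd₁
  obtain ⟨C₂, hC₂⟩ := J.d.bdd₂
  obtain ⟨C₁₁, hC₁₁⟩ := J.d₁.bdd₁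
  obtain ⟨C₁₂, hC₁₂⟩ := J.d₁.bdd₂
  obtain ⟨C₂₂, hC₂₂⟩ := J.d₂.bdd₂
  have c0 := J.d.cont
  have c1 := J.d.cont₁
  have c2 := J.d.cont₂
  have c11 := J.d₁.cont₁
  have c12 := J.d₁.cont₂
  have c22 := J.d₂.cont₂
  have cN := continuous_posNoise
  have iN : Integrable posNoise gaussPair :=
    (integrable_fst_gaussPair.div_const _).add (integrable_snd_gaussPair.div_const _)
  have C₁0 : 0 ≤ C₁ := (abs_nonneg _).trans (hC₁ 0)
  have C₂0 : 0 ≤ C₂ := (abs_nonneg _).trans (hC₂ 0)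
  set σ := √s with hσ
  have hσ0 : 0 < σ := Real.sqrt_pos.2 hs
  have hσ2 : σ ^ 2 = s := Real.sq_sqrt hs.le
  set D : ℝ → ℝ × ℝ → ℝ := fun r z =>
    J.f₁ (flow r p z) * (2 * r * p.2 + 3 * r ^ 2 * posNoise z)
      + J.f₂ (flow r p z) * (√2 * z.1) with hD
  have cflow : ∀ r, Continuous (flow r p) := fun r => by unfold flow; fun_prop
  have hder := (hasDerivAt_integral_of_dominated_loc_of_deriv_le (μ := gaussPair)
    (F := fun r z => J.f (flow r p z)) (F' := D) (x₀ := σ) (s := Metric.ball σ 1)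
    (bound := fun z => C₁ * (2 * (σ + 1) * |p.2| + 3 * (σ + 1) ^ 2 * |posNoise z|)
      + C₂ * (√2 * |z.1|)) (Metric.ball_mem_nhds σ one_pos)
    (.of_forall fun r => ((c0.comp (cflow r))).aestronglyMeasurable)
    (integrable_bdd_gaussPair (c0.comp (cflow σ)) fun z => hC _)
    ?_ ?_ ?_ ?_).2
  rotate_left
  · have := cflow σ
    exact (by fun_prop : Continuous (D σ)).aestronglyMeasurable
  · refine .of_forall fun z r hr => ?_
    rw [Metric.mem_ball, Real.dist_eq, abs_lt] at hr
    have hr' : |r| ≤ σ + 1 := abs_le.2 ⟨by linarith, by linarith⟩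
    refine (norm_add_le _ _).trans (add_le_add ?_ ?_)
    · rw [norm_mul]
      refine mul_le_mul (hC₁ _) ?_ (norm_nonneg _) C₁0
      refine (norm_add_le _ _).trans ?_
      simp only [Real.norm_eq_abs, abs_mul, abs_pow, Nat.abs_ofNat]
      gcongr
    · rw [norm_mul]
      refine mul_le_mul (hC₂ _) (le_of_eq ?_) (norm_nonneg _) C₂0
      rw [norm_mul, Real.norm_eq_abs, Real.norm_eq_abs, abs_of_nonneg (Real.sqrt_nonneg 2)]
  · exact (((integrable_const _).add (iN.abs.const_mul _)).const_mul _).add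
      ((integrable_fst_gaussPair.abs.const_mul _).const_mul _)
  · refine .of_forall fun z r _ => ?_
    have ha : HasDerivAt (fun r => p.1 + r ^ 2 * p.2 + r ^ 3 * posNoise z)
        (2 * r * p.2 + 3 * r ^ 2 * posNoise z) r := by
      have h2 := ((hasDerivAt_id r).pow 2).mul_const p.2
      have h3 := ((hasDerivAt_id r).pow 3).mul_const (posNoise z)
      refine ((h2.const_add p.1).add h3).congr_deriv ?_
      simp
    have hb : HasDerivAt (fun r => p.2 + √2 * r * z.1) (√2 * z.1) r := by
      refine ((((hasDerivAt_id r).const_mul √2).mul_const z.1).const_add p.2).congr_deriv ?_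
      simp
    exact J.d.comp_hasDerivAt ha hb
  -- evaluate the derivative by Gaussian integration by parts
  have cf := cflow σ
  have I1 : Integrable (fun z => J.f₁ (flow σ p z)) gaussPair :=
    integrable_bdd_gaussPair (c1.comp cf) fun z => hC₁ _
  have I2 : Integrable (fun z => J.f₂ (flow σ p z)) gaussPair :=
    integrable_bdd_gaussPair (c2.comp cf) fun z => hC₂ _
  have I11 : Integrable (fun z => J.f₁₁ (flow σ p z)) gaussPair :=
    integrable_bdd_gaussPair (c11.comp cf) fun z => hC₁₁ _
  have I12 : Integrable (fun z => J.f₁₂ (flow σ p z)) gaussPair :=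
    integrable_bdd_gaussPair (c12.comp cf) fun z => hC₁₂ _
  have I22 : Integrable (fun z => J.f₂₂ (flow σ p z)) gaussPair :=
    integrable_bdd_gaussPair (c22.comp cf) fun z => hC₂₂ _
  have dx1 : ∀ x y : ℝ, HasDerivAt (fun x => p.1 + σ ^ 2 * p.2 + σ ^ 3 * posNoise (x, y))
      (σ ^ 3 / √2) x := by
    intro x y
    have := (((((hasDerivAt_id x).div_const √2).add_const (y / √6)).const_mul (σ ^ 3)).const_add
      (p.1 + σ ^ 2 * p.2))
    refine this.congr_deriv ?_
    ring
  have dx2 : ∀ x : ℝ, HasDerivAt (fun x => p.2 + √2 * σ * x) (√2 * σ) x := by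
    intro x
    refine (((hasDerivAt_id x).const_mul (√2 * σ)).const_add p.2).congr_deriv (mul_one _)
  have dy1 : ∀ x y : ℝ, HasDerivAt (fun y => p.1 + σ ^ 2 * p.2 + σ ^ 3 * posNoise (x, y))
      (σ ^ 3 / √6) y := by
    intro x y
    have := (((((hasDerivAt_id y).div_const √6).const_add (x / √2)).const_mul (σ ^ 3)).const_add
      (p.1 + σ ^ 2 * p.2))
    refine this.congr_deriv ?_
    ring
  have bd : ∀ {u w : ℝ × ℝ → ℝ} {A B : ℝ} (a b : ℝ), (∀ z, |u z| ≤ A) → (∀ z, |w z| ≤ B) →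
      ∀ z, |u (flow σ p z) * a + w (flow σ p z) * b| ≤ A * |a| + B * |b| := by
    intro u w A B a b hu hw z
    refine (abs_add_le _ _).trans ?_
    rw [abs_mul, abs_mul]
    exact add_le_add (mul_le_mul_of_nonneg_right (hu _) (abs_nonneg _))
      (mul_le_mul_of_nonneg_right (hw _) (abs_nonneg _))
  have S1 : ∫ z, z.1 * J.f₁ (flow σ p z) ∂gaussPair
      = ∫ z, (J.f₁₁ (flow σ p z) * (σ ^ 3 / √2) + J.f₁₂ (flow σ p z) * (√2 * σ)) ∂gaussPair :=
    stein_fst (fun x y => J.d₁.comp_hasDerivAt (dx1 x y) (dx2 x)) (c1.comp cf) (by fun_prop)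
      (fun z => hC₁ _) (bd _ _ hC₁₁ hC₁₂)
  have S2 : ∫ z, z.1 * J.f₂ (flow σ p z) ∂gaussPair
      = ∫ z, (J.f₁₂ (flow σ p z) * (σ ^ 3 / √2) + J.f₂₂ (flow σ p z) * (√2 * σ)) ∂gaussPair :=
    stein_fst (fun x y => J.d₂.comp_hasDerivAt (dx1 x y) (dx2 x)) (c2.comp cf) (by fun_prop)
      (fun z => hC₂ _) (bd _ _ hC₁₂ hC₂₂)
  have S3 : ∫ z, z.2 * J.f₁ (flow σ p z) ∂gaussPair
      = ∫ z, (J.f₁₁ (flow σ p z) * (σ ^ 3 / √6) + J.f₁₂ (flow σ p z) * 0) ∂gaussPair :=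
    stein_snd (fun x y => J.d₁.comp_hasDerivAt (dy1 x y) (hasDerivAt_const y (p.2 + √2 * σ * x)))
      (c1.comp cf)
      (by fun_prop) (fun z => hC₁ _) (bd _ _ hC₁₁ hC₁₂)
  rw [integral_add (I11.mul_const _) (I12.mul_const _), integral_mul_const, integral_mul_const]
    at S1 S3
  rw [integral_add (I12.mul_const _) (I22.mul_const _), integral_mul_const, integral_mul_const]
    at S2
  have J1 : Integrable (fun z : ℝ × ℝ => z.1 * J.f₁ (flow σ p z)) gaussPair :=
    integrable_fst_gaussPair.mul_bdd (c1.comp cf).aestronglyMeasurable (.of_forall fun z => hC₁ _)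
  have J2 : Integrable (fun z : ℝ × ℝ => z.1 * J.f₂ (flow σ p z)) gaussPair :=
    integrable_fst_gaussPair.mul_bdd (c2.comp cf).aestronglyMeasurable (.of_forall fun z => hC₂ _)
  have J3 : Integrable (fun z : ℝ × ℝ => z.2 * J.f₁ (flow σ p z)) gaussPair :=
    integrable_snd_gaussPair.mul_bdd (c1.comp cf).aestronglyMeasurable (.of_forall fun z => hC₁ _)
  have hDint : ∫ z, D σ z ∂gaussPair
      = 2 * σ * p.2 * ∫ z, J.f₁ (flow σ p z) ∂gaussPair
        + 3 * σ ^ 2 / √2 * ∫ z, z.1 * J.f₁ (flow σ p z) ∂gaussPair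
        + 3 * σ ^ 2 / √6 * ∫ z, z.2 * J.f₁ (flow σ p z) ∂gaussPair
        + √2 * ∫ z, z.1 * J.f₂ (flow σ p z) ∂gaussPair := by
    have Q2 : Integrable (fun z => 2 * σ * p.2 * J.f₁ (flow σ p z)
        + 3 * σ ^ 2 / √2 * (z.1 * J.f₁ (flow σ p z))) gaussPair :=
      (I1.const_mul _).add (J1.const_mul _)
    have Q3 : Integrable (fun z => 2 * σ * p.2 * J.f₁ (flow σ p z)
        + 3 * σ ^ 2 / √2 * (z.1 * J.f₁ (flow σ p z))
        + 3 * σ ^ 2 / √6 * (z.2 * J.f₁ (flow σ p z))) gaussPair := Q2.add (J3.const_mul _)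
    rw [← integral_const_mul, ← integral_const_mul, ← integral_const_mul, ← integral_const_mul,
      ← integral_add (I1.const_mul _) (J1.const_mul _), ← integral_add Q2 (J3.const_mul _),
      ← integral_add Q3 (J2.const_mul _)]
    refine integral_congr_ae (.of_forall fun z => ?_)
    simp only [hD, posNoise]
    ring
  have hsqrt : HasDerivAt (fun r => √r) (1 / (2 * σ)) s := Real.hasDerivAt_sqrt hs.ne'
  have hcomp := HasDerivAt.comp s (h₂ := fun r => ∫ z, J.f (flow r p z) ∂gaussPair) hder hsqrt
  have hev : (fun r => (J.evolve r).f p)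
      =ᶠ[𝓝 s] (fun r => ∫ z, J.f (flow r p z) ∂gaussPair) ∘ fun r => √r := by
    filter_upwards [lt_mem_nhds hs] with r hr
    exact kolmogorov_eq_flow hr.le J.f p
  refine (hcomp.congr_of_eventuallyEq hev).congr_deriv ?_
  -- After division by `2σ` the coefficients of `f₁₁`, `f₁₂`, `f₂₂` are `σ⁴ (3/2 + 1/2)/2`, `σ² (3 +
  -- 1)/2` and `1`: the `s²`, `2s` and `1` in the second velocity derivative of the evolved
  -- function.
  rw [hDint, S1, S2, S3]
  simp only [Jet2.gen, Jet2.evolve, kolmogorov_eq_flow hs.le, ← hσ]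
  have s2 : √2 ^ 2 = (2 : ℝ) := Real.sq_sqrt (by norm_num)
  have s6 : √6 ^ 2 = (6 : ℝ) := Real.sq_sqrt (by norm_num)
  have s2' : (√2 : ℝ) ≠ 0 := by positivity
  have s6' : (√6 : ℝ) ≠ 0 := by positivity
  rw [← hσ2]
  field_simp
  simp only [s2, s6]
  ring

end FokkerPlanck

namespace FokkerPlanck

open Filter Topology ProbabilityTheory

/-! ### Bounds for the Kolmogorov semigroup -/

lemma kolmogorov_nonneg {h : ℝ × ℝ → ℝ} (h0 : ∀ z, 0 ≤ h z) (s : ℝ) (p : ℝ × ℝ) :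
    0 ≤ kolmogorov s h p := integral_nonneg fun _ => h0 _

lemma kolmogorov_le_integral {h F : ℝ × ℝ → ℝ} (ch : Continuous h) {C : ℝ} (hC : ∀ z, |h z| ≤ C)
    {s : ℝ} {p : ℝ × ℝ} (hF : Integrable F gaussPair)
    (hle : ∀ z, h (p.1 + s * p.2 + √s ^ 3 * posNoise z, p.2 + √2 * √s * z.1) ≤ F z) :
    kolmogorov s h p ≤ ∫ z, F z ∂gaussPair := by
  have := continuous_posNoise
  exact integral_mono (integrable_bdd_gaussPair (by fun_prop) fun z => hC _) hF hle

lemma integrable_sq_gaussianReal : Integrable (fun x : ℝ => x ^ 2) (gaussianReal 0 1) :=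
  (memLp_id_gaussianReal 2).integrable_sq

lemma integral_sq_gaussianReal : ∫ x : ℝ, x ^ 2 ∂gaussianReal 0 1 = 1 := by
  have h := variance_id_gaussianReal (μ := 0) (v := 1)
  rw [variance_eq_integral aemeasurable_id] at h
  simpa using h

lemma integrable_sq_fst_gaussPair : Integrable (fun z : ℝ × ℝ => z.1 ^ 2) gaussPair :=
  integrable_sq_gaussianReal.comp_fst _

lemma integrable_sq_snd_gaussPair : Integrable (fun z : ℝ × ℝ => z.2 ^ 2) gaussPair :=
  integrable_sq_gaussianReal.comp_snd _

lemma integral_sq_fst_gaussPair : ∫ z : ℝ × ℝ, z.1 ^ 2 ∂gaussPair = 1 := by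
  have := integral_fun_fst (μ := gaussianReal 0 1) (ν := gaussianReal 0 1) (fun x : ℝ => x ^ 2)
  rw [gaussPair, this, integral_sq_gaussianReal]
  simp

lemma integral_sq_snd_gaussPair : ∫ z : ℝ × ℝ, z.2 ^ 2 ∂gaussPair = 1 := by
  have := integral_fun_snd (μ := gaussianReal 0 1) (ν := gaussianReal 0 1) (fun x : ℝ => x ^ 2)
  rw [gaussPair, this, integral_sq_gaussianReal]
  simp

lemma sq_posNoise_le (z : ℝ × ℝ) : posNoise z ^ 2 ≤ z.1 ^ 2 + z.2 ^ 2 := by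
  have s2 : √2 ^ 2 = (2 : ℝ) := Real.sq_sqrt (by norm_num)
  have s6 : √6 ^ 2 = (6 : ℝ) := Real.sq_sqrt (by norm_num)
  have h := sq_nonneg (z.1 / √2 - z.2 / √6)
  have e1 : (z.1 / √2) ^ 2 = z.1 ^ 2 / 2 := by rw [div_pow, s2]
  have e2 : (z.2 / √6) ^ 2 = z.2 ^ 2 / 6 := by rw [div_pow, s6]
  unfold posNoise
  nlinarith [sq_nonneg z.2]

lemma integrable_sq_posNoise : Integrable (fun z => posNoise z ^ 2) gaussPair :=
  (integrable_sq_fst_gaussPair.add integrable_sq_snd_gaussPair).mono'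
    (continuous_posNoise.pow 2).aestronglyMeasurable
    (.of_forall fun z => by
      rw [Real.norm_eq_abs, abs_of_nonneg (sq_nonneg _)]
      exact sq_posNoise_le z)

lemma integral_sq_posNoise_le : ∫ z, posNoise z ^ 2 ∂gaussPair ≤ 2 := by
  refine (integral_mono integrable_sq_posNoise
    (integrable_sq_fst_gaussPair.add integrable_sq_snd_gaussPair) sq_posNoise_le).trans ?_
  have := integral_add integrable_sq_fst_gaussPair integrable_sq_snd_gaussPair
  rw [integral_sq_fst_gaussPair, integral_sq_snd_gaussPair] at this
  simp only [Pi.add_apply]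
  linarith

/-- Chebyshev's inequality in the form used below: the noises have second moments at most `2` and
equal to `1`, so a quadratic majorant along the flow bounds the average. -/
lemma kolmogorov_le_quadratic {h : ℝ × ℝ → ℝ} (ch : Continuous h) {C : ℝ} (hC : ∀ z, |h z| ≤ C)
    {s a b c : ℝ} (hb : 0 ≤ b) {p : ℝ × ℝ}
    (hle : ∀ z, h (p.1 + s * p.2 + √s ^ 3 * posNoise z, p.2 + √2 * √s * z.1)
      ≤ a + b * posNoise z ^ 2 + c * z.1 ^ 2) :
    kolmogorov s h p ≤ a + 2 * b + c := by
  have i1 : Integrable (fun z => a + b * posNoise z ^ 2) gaussPair :=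
    (integrable_const a).add (integrable_sq_posNoise.const_mul b)
  refine (kolmogorov_le_integral ch hC (i1.add (integrable_sq_fst_gaussPair.const_mul c))
    hle).trans ?_
  have e : ∫ z, (a + b * posNoise z ^ 2 + c * z.1 ^ 2) ∂gaussPair
      = a + b * ∫ z, posNoise z ^ 2 ∂gaussPair + c := by
    rw [integral_add i1 (integrable_sq_fst_gaussPair.const_mul c),
      integral_add (integrable_const a) (integrable_sq_posNoise.const_mul b),
      integral_const_mul, integral_const_mul, integral_sq_fst_gaussPair]
    simp
  simp only [Pi.add_apply]
  rw [e]
  nlinarith [integral_sq_posNoise_le]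

/-- The functions `exp (± v)` are eigenfunctions of the semigroup with factor `exp s`, by the
Gaussian moment generating function. Both signs together propagate decay like `exp (-|v|)`. -/
lemma kolmogorov_le_exp {h : ℝ × ℝ → ℝ} (ch : Continuous h) {C : ℝ} (hC : ∀ z, |h z| ≤ C)
    {σ K s : ℝ} (hσ : σ = 1 ∨ σ = -1) (hs : 0 ≤ s) (hle : ∀ z, h z ≤ K * Real.exp (σ * z.2))
    (p : ℝ × ℝ) : kolmogorov s h p ≤ K * Real.exp s * Real.exp (σ * p.2) := by
  have ie : Integrable (fun z : ℝ × ℝ => Real.exp (σ * (√2 * √s) * z.1)) gaussPair :=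
    (integrable_exp_mul_gaussianReal (σ * (√2 * √s))).comp_fst _
  have s2 : √2 ^ 2 = (2 : ℝ) := Real.sq_sqrt (by norm_num)
  have ss : √s ^ 2 = s := Real.sq_sqrt hs
  have σ2 : σ ^ 2 = 1 := by rcases hσ with rfl | rfl <;> norm_num
  have ev : ∫ z : ℝ × ℝ, Real.exp (σ * (√2 * √s) * z.1) ∂gaussPair = Real.exp s := by
    have := integral_fun_fst (μ := gaussianReal 0 1) (ν := gaussianReal 0 1)
      (fun x : ℝ => Real.exp (σ * (√2 * √s) * x))
    rw [gaussPair, this]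
    have m := congrFun (mgf_id_gaussianReal (μ := 0) (v := 1)) (σ * (√2 * √s))
    rw [mgf] at m
    simp only [id] at m
    rw [m]
    simp only [probReal_univ, one_smul]
    congr 1
    rw [mul_pow, mul_pow, σ2, s2, ss]
    simp
  refine (kolmogorov_le_integral ch hC (ie.const_mul (K * Real.exp (σ * p.2)))
    fun z => (hle _).trans_eq ?_).trans_eq ?_
  · rw [mul_assoc K (Real.exp _), ← Real.exp_add]
    congr 2
    ring
  · rw [integral_const_mul, ev]
    ring

/-- A particle close to the wall and moving towards it leaves the domain with high probability. -/
lemma kolmogorov_le_of_near {h : ℝ × ℝ → ℝ} (ch : Continuous h) {M : ℝ} (hM0 : ∀ z, 0 ≤ h z)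
    (hM : ∀ z, h z ≤ M) {σ c τ δ : ℝ} (hσ : σ = 1 ∨ σ = -1) (hτ : 0 < τ) (hδ : 0 < δ)
    (hout : ∀ z : ℝ × ℝ, σ * (z.1 - c) ≤ -(τ * δ / 8) → h z = 0) {p : ℝ × ℝ}
    (hp1 : σ * (p.1 - c) ≤ τ * δ / 8) (hp2 : σ * p.2 ≤ -(δ / 2)) :
    kolmogorov τ h p ≤ 32 * M * τ / δ ^ 2 := by
  have M0 : 0 ≤ M := (hM0 0).trans (hM 0)
  have hC : ∀ z, |h z| ≤ M := fun z => by rw [abs_of_nonneg (hM0 z)]; exact hM z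
  -- The start is at most `τδ/8` inside and the drift carries the particle out by at least `τδ/2`,
  -- so ending above `-τδ/8` takes noise of at least `τδ/4`. The noise scale is `τ^{3/2}`, whence
  -- `16 τ / δ²`, doubled by the second moment.
  have hb : 0 ≤ 16 * M * τ / δ ^ 2 := by positivity
  refine (kolmogorov_le_quadratic ch hC (a := 0) (c := 0) hb fun z => ?_).trans_eq
    (by field_simp; ring)
  have hrhs : 0 ≤ 16 * M * τ / δ ^ 2 * posNoise z ^ 2 := by positivity
  rw [zero_add, zero_mul, add_zero]
  by_cases hz : σ * ((p.1 + τ * p.2 + √τ ^ 3 * posNoise z) - c) ≤ -(τ * δ / 8)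
  · rw [hout _ hz]
    exact hrhs
  · refine (hM _).trans ?_
    rw [not_le] at hz
    set a := √τ with ha
    have a0 : 0 < a := Real.sqrt_pos.2 hτ
    have a2 : a ^ 2 = τ := Real.sq_sqrt hτ.le
    set N := posNoise z
    have h1 : τ * (σ * p.2) ≤ τ * (-(δ / 2)) := mul_le_mul_of_nonneg_left hp2 hτ.le
    have h2 : a ^ 2 * (δ / 4) ≤ a ^ 2 * (a * (σ * N)) := by
      rw [a2]
      have : a ^ 3 * N = τ * (a * N) := by rw [← a2]; ring
      rw [this] at hz
      nlinarith
    have h3 : δ / 4 ≤ a * (σ * N) := le_of_mul_le_mul_left h2 (by positivity)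
    have h4 : (δ / 4) ^ 2 ≤ (a * (σ * N)) ^ 2 := by gcongr
    have h5 : (a * (σ * N)) ^ 2 = τ * N ^ 2 := by
      rw [← a2]
      rcases hσ with rfl | rfl <;> ring
    rw [h5] at h4
    rw [div_mul_eq_mul_div, le_div_iff₀ (by positivity)]
    nlinarith

/-- A particle at the wall moving out does not come back soon. -/
lemma kolmogorov_le_of_leaving {h : ℝ × ℝ → ℝ} (ch : Continuous h) {M κ : ℝ}
    (hM0 : ∀ z, 0 ≤ h z) (hM : ∀ z, h z ≤ M) (hκ : 0 ≤ κ) {σ c τ δ r : ℝ} (hσ : σ = 1 ∨ σ = -1)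
    (hδ : 0 < δ) (hr : 0 ≤ r) (hrτ : r ≤ τ) (hτ : 0 < τ)
    (hnear : ∀ z : ℝ × ℝ, σ * (z.1 - c) ≤ τ * δ / 8 → σ * z.2 ≤ -(δ / 2) → h z ≤ κ) {p : ℝ × ℝ}
    (hp1 : σ * (p.1 - c) ≤ 0) (hp2 : σ * p.2 ≤ -δ) :
    kolmogorov r h p ≤ κ + 136 * M * τ / δ ^ 2 := by
  have M0 : 0 ≤ M := (hM0 0).trans (hM 0)
  have hC : ∀ z, |h z| ≤ M := fun z => by rw [abs_of_nonneg (hM0 z)]; exact hM z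
  -- Leaving the region where `h ≤ κ` takes either position noise above `τδ/8` or velocity noise
  -- above `δ/2`. The two Chebyshev terms contribute `2 · 64` and `8`.
  have hb : 0 ≤ 64 * M * τ / δ ^ 2 := by positivity
  refine (kolmogorov_le_quadratic ch hC (a := κ) (c := 8 * M * τ / δ ^ 2) hb fun z => ?_).trans_eq
    (by field_simp; ring)
  have r1 : 0 ≤ 64 * M * τ / δ ^ 2 * posNoise z ^ 2 := by positivity
  have r2 : 0 ≤ 8 * M * τ / δ ^ 2 * z.1 ^ 2 := by positivity
  set a := √r with ha
  set b := √τ with hb'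
  have a0 : 0 ≤ a := Real.sqrt_nonneg _
  have b0 : 0 < b := Real.sqrt_pos.2 hτ
  have ab : a ≤ b := Real.sqrt_le_sqrt hrτ
  have a2 : a ^ 2 = r := Real.sq_sqrt hr
  have b2 : b ^ 2 = τ := Real.sq_sqrt hτ.le
  set N := posNoise z
  have hrv : r * (σ * p.2) ≤ 0 := mul_nonpos_of_nonneg_of_nonpos hr (by linarith)
  by_cases h1 : σ * (a ^ 3 * N) ≤ τ * δ / 8
  · by_cases h2 : σ * (√2 * a * z.1) ≤ δ / 2
    · have := hnear (p.1 + r * p.2 + a ^ 3 * N, p.2 + √2 * a * z.1) (by simp only; nlinarith)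
        (by simp only; nlinarith)
      linarith
    · refine (hM _).trans ?_
      rw [not_le] at h2
      have s2 : √2 ^ 2 = (2 : ℝ) := Real.sq_sqrt (by norm_num)
      have h4 : (δ / 2) ^ 2 ≤ (σ * (√2 * a * z.1)) ^ 2 := by gcongr
      have h5 : (σ * (√2 * a * z.1)) ^ 2 = 2 * r * z.1 ^ 2 := by
        have : (σ * (√2 * a * z.1)) ^ 2 = σ ^ 2 * √2 ^ 2 * a ^ 2 * z.1 ^ 2 := by ring
        rw [this, s2, a2]
        rcases hσ with rfl | rfl <;> ring
      rw [h5] at h4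
      have h6 : r * z.1 ^ 2 ≤ τ * z.1 ^ 2 := by gcongr
      have : M ≤ 8 * M * τ / δ ^ 2 * z.1 ^ 2 := by
        rw [div_mul_eq_mul_div, le_div_iff₀ (by positivity)]
        nlinarith
      linarith
  · refine (hM _).trans ?_
    rw [not_le] at h1
    have hN : 0 < σ * N := by
      by_contra hN
      rw [not_lt] at hN
      have : a ^ 3 * (σ * N) ≤ 0 := mul_nonpos_of_nonneg_of_nonpos (by positivity) hN
      have : 0 < τ * δ / 8 := by positivity
      nlinarith
    have h2 : a ^ 3 * (σ * N) ≤ b ^ 3 * (σ * N) := by gcongr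
    have h2' : b ^ 2 * (δ / 8) ≤ b ^ 2 * (b * (σ * N)) := by
      rw [← b2] at h1
      nlinarith
    have h3 : δ / 8 ≤ b * (σ * N) := le_of_mul_le_mul_left h2' (by positivity)
    have h4 : (δ / 8) ^ 2 ≤ (b * (σ * N)) ^ 2 := by gcongr
    have h5 : (b * (σ * N)) ^ 2 = τ * N ^ 2 := by
      rw [← b2]
      rcases hσ with rfl | rfl <;> ring
    rw [h5] at h4
    have : M ≤ 64 * M * τ / δ ^ 2 * N ^ 2 := by
      rw [div_mul_eq_mul_div, le_div_iff₀ (by positivity)]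
      nlinarith
    linarith

end FokkerPlanck

namespace FokkerPlanck

open Filter Topology ProbabilityTheory

/-! ### Solutions of the backward equation that are small on the outgoing boundary -/

/-- A continuous function of `(x, v, r)` with its first derivatives in `x`, `v` and its second
derivative in `v`. -/
structure Field where
  u : ℝ × ℝ × ℝ → ℝ
  u₁ : ℝ × ℝ × ℝ → ℝ
  u₂ : ℝ × ℝ × ℝ → ℝ
  u₂₂ : ℝ × ℝ × ℝ → ℝ
  cont : Continuous u
  cont₁ : Continuous u₁
  cont₂ : Continuous u₂
  cont₂₂ : Continuous u₂₂
  hasDerivAt_x : ∀ x v r, HasDerivAt (fun y => u (y, v, r)) (u₁ (x, v, r)) x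
  hasDerivAt_v : ∀ x v r, HasDerivAt (fun w => u (x, w, r)) (u₂ (x, v, r)) v
  hasDerivAt_vv : ∀ x v r, HasDerivAt (fun w => u₂ (x, w, r)) (u₂₂ (x, v, r)) v

/-- The generator `v ∂ₓ + ∂ᵥᵥ` applied to a field. -/
def Field.gen (F : Field) (p : ℝ × ℝ × ℝ) : ℝ := p.2.1 * F.u₁ p + F.u₂₂ p

lemma Field.continuous_gen (F : Field) : Continuous F.gen := by
  have := F.cont₁
  have := F.cont₂₂
  unfold Field.gen
  fun_prop

/-- The field solves `∂ᵣ u = v ∂ₓ u + ∂ᵥᵥ u` on `[0,1] × ℝ × [0,t]`, in integrated form. -/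
def Field.Solves (F : Field) (t : ℝ) : Prop :=
  ∀ x ∈ Icc (0 : ℝ) 1, ∀ v, ∀ r ∈ Icc 0 t,
    F.u (x, v, r) = F.u (x, v, 0) + ∫ ρ in (0 : ℝ)..r, F.gen (x, v, ρ)

/-- The integrated form is convenient for concatenation, and because the generator is continuous in
time the classical derivative is recovered at every interior time, junctions included. -/
lemma Field.Solves.hasDerivAt {F : Field} {t : ℝ} (hF : F.Solves t) {x v r : ℝ}
    (hx : x ∈ Icc (0 : ℝ) 1) (hr : r ∈ Ioo 0 t) :
    HasDerivAt (fun ρ => F.u (x, v, ρ)) (F.gen (x, v, r)) r := by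
  have hc : Continuous fun ρ => F.gen (x, v, ρ) :=
    F.continuous_gen.comp (by fun_prop : Continuous fun ρ : ℝ => (x, v, ρ))
  refine ((hc.integral_hasStrictDerivAt 0 r).hasDerivAt.const_add (F.u (x, v, 0))).congr_of_eventuallyEq
    ?_
  filter_upwards [isOpen_Ioo.mem_nhds hr] with ρ hρ
  exact hF x hx v ρ (Ioo_subset_Icc_self hρ)

/-- The evolution of a `C²` function as a field. -/
noncomputable def Jet2.field (J : Jet2) : Field where
  u := fun p => (J.evolve p.2.2).f (p.1, p.2.1)
  u₁ := fun p => (J.evolve p.2.2).f₁ (p.1, p.2.1)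
  u₂ := fun p => (J.evolve p.2.2).f₂ (p.1, p.2.1)
  u₂₂ := fun p => (J.evolve p.2.2).f₂₂ (p.1, p.2.1)
  cont := by
    obtain ⟨C, hC⟩ := J.d.bdd
    exact continuous_kolmogorov J.d.cont hC
  cont₁ := by
    obtain ⟨C, hC⟩ := J.d.bdd₁
    exact continuous_kolmogorov J.d.cont₁ hC
  cont₂ := by
    obtain ⟨C, hC⟩ := J.d.bdd₁
    obtain ⟨D, hD⟩ := J.d.bdd₂
    have h1 := continuous_kolmogorov J.d.cont₁ hC
    have h2 := continuous_kolmogorov J.d.cont₂ hD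
    exact h2.add ((by fun_prop : Continuous fun p : ℝ × ℝ × ℝ => p.2.2).mul h1)
  cont₂₂ := by
    obtain ⟨C, hC⟩ := J.d₁.bdd₁
    obtain ⟨D, hD⟩ := J.d₁.bdd₂
    obtain ⟨E, hE⟩ := J.d₂.bdd₂
    have h1 := continuous_kolmogorov J.d₁.cont₁ hC
    have h2 := continuous_kolmogorov J.d₁.cont₂ hD
    have h3 := continuous_kolmogorov J.d₂.cont₂ hE
    have hr : Continuous fun p : ℝ × ℝ × ℝ => p.2.2 := by fun_prop
    exact (h3.add (hr.mul h2)).add (hr.mul (h2.add (hr.mul h1)))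
  hasDerivAt_x := fun x v r => (J.evolve r).d.hasDerivAt_fst x v
  hasDerivAt_v := fun x v r => (J.evolve r).d.hasDerivAt_snd x v
  hasDerivAt_vv := fun x v r => (J.evolve r).d₂.hasDerivAt_snd x v

lemma Jet2.solves_field (J : Jet2) (t : ℝ) : J.field.Solves t := by
  intro x _ v r hr
  have hp : Continuous fun ρ : ℝ => (x, v, ρ) := by fun_prop
  have := intervalIntegral.integral_eq_sub_of_hasDerivAt_of_le
    (f := fun ρ => J.field.u (x, v, ρ)) (f' := fun ρ => J.field.gen (x, v, ρ)) hr.1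
    (J.field.cont.comp hp).continuousOn (fun ρ hρ => J.hasDerivAt_evolve (x, v) hρ.1)
    ((J.field.continuous_gen.comp hp).intervalIntegrable 0 r)
  rw [this]
  ring

lemma Jet2.evolve_zero (J : Jet2) : (J.evolve 0).f = J.f ∧ (J.evolve 0).f₁ = J.f₁ ∧
    (J.evolve 0).f₂ = J.f₂ ∧ (J.evolve 0).f₂₂ = J.f₂₂ := by
  refine ⟨kolmogorov_zero _, kolmogorov_zero _, ?_, ?_⟩ <;>
  · funext p
    simp [Jet2.evolve, kolmogorov_zero]

/-- Run `F` up to time `a` and then `G`. -/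
noncomputable def Field.glue (a : ℝ) (F G : Field) : Field where
  -- Adding the increment of `G` to the stopped `F` gives a continuous field on all of `ℝ³`, even at
  -- positions outside `[0,1]`, where the two need not match. Where they match it is the
  -- concatenation.
  u := fun p => F.u (p.1, p.2.1, min p.2.2 a)
    + (G.u (p.1, p.2.1, max 0 (p.2.2 - a)) - G.u (p.1, p.2.1, 0))
  u₁ := fun p => F.u₁ (p.1, p.2.1, min p.2.2 a)
    + (G.u₁ (p.1, p.2.1, max 0 (p.2.2 - a)) - G.u₁ (p.1, p.2.1, 0))
  u₂ := fun p => F.u₂ (p.1, p.2.1, min p.2.2 a)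
    + (G.u₂ (p.1, p.2.1, max 0 (p.2.2 - a)) - G.u₂ (p.1, p.2.1, 0))
  u₂₂ := fun p => F.u₂₂ (p.1, p.2.1, min p.2.2 a)
    + (G.u₂₂ (p.1, p.2.1, max 0 (p.2.2 - a)) - G.u₂₂ (p.1, p.2.1, 0))
  cont := by have := F.cont; have := G.cont; fun_prop
  cont₁ := by have := F.cont₁; have := G.cont₁; fun_prop
  cont₂ := by have := F.cont₂; have := G.cont₂; fun_prop
  cont₂₂ := by have := F.cont₂₂; have := G.cont₂₂; fun_prop
  hasDerivAt_x := fun x v r => (F.hasDerivAt_x x v (min r a)).add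
    ((G.hasDerivAt_x x v (max 0 (r - a))).sub (G.hasDerivAt_x x v 0))
  hasDerivAt_v := fun x v r => (F.hasDerivAt_v x v (min r a)).add
    ((G.hasDerivAt_v x v (max 0 (r - a))).sub (G.hasDerivAt_v x v 0))
  hasDerivAt_vv := fun x v r => (F.hasDerivAt_vv x v (min r a)).add
    ((G.hasDerivAt_vv x v (max 0 (r - a))).sub (G.hasDerivAt_vv x v 0))

/-- The value of `F` at time `a` is the initial value of `G`. -/
structure Field.Matches (a : ℝ) (F G : Field) : Prop where
  u : ∀ x ∈ Icc (0 : ℝ) 1, ∀ v, F.u (x, v, a) = G.u (x, v, 0)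
  u₁ : ∀ x ∈ Icc (0 : ℝ) 1, ∀ v, F.u₁ (x, v, a) = G.u₁ (x, v, 0)
  u₂ : ∀ x ∈ Icc (0 : ℝ) 1, ∀ v, F.u₂ (x, v, a) = G.u₂ (x, v, 0)
  u₂₂ : ∀ x ∈ Icc (0 : ℝ) 1, ∀ v, F.u₂₂ (x, v, a) = G.u₂₂ (x, v, 0)

section glue

variable {a : ℝ} {F G : Field}

lemma Field.glue_u_of_le {r : ℝ} (hr : r ≤ a) (x v : ℝ) :
    (F.glue a G).u (x, v, r) = F.u (x, v, r) := by
  simp [Field.glue, hr]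

lemma Field.glue_gen_of_le {r : ℝ} (hr : r ≤ a) (x v : ℝ) :
    (F.glue a G).gen (x, v, r) = F.gen (x, v, r) := by
  simp [Field.glue, Field.gen, hr]

lemma Field.Matches.glue_of_ge (h : F.Matches a G) {r : ℝ} (hr : a ≤ r) {x : ℝ}
    (hx : x ∈ Icc (0 : ℝ) 1) (v : ℝ) :
    (F.glue a G).u (x, v, r) = G.u (x, v, r - a) ∧ (F.glue a G).u₁ (x, v, r) = G.u₁ (x, v, r - a) ∧
    (F.glue a G).u₂ (x, v, r) = G.u₂ (x, v, r - a) ∧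
    (F.glue a G).u₂₂ (x, v, r) = G.u₂₂ (x, v, r - a) := by
  simp [Field.glue, hr, h.u x hx v, h.u₁ x hx v, h.u₂ x hx v, h.u₂₂ x hx v]

lemma Field.Matches.solves_glue (h : F.Matches a G) (ha : 0 ≤ a) {τ : ℝ} (hF : F.Solves a)
    (hG : G.Solves τ) : (F.glue a G).Solves (a + τ) := by
  intro x hx v r hr
  have e0 : (F.glue a G).u (x, v, 0) = F.u (x, v, 0) := Field.glue_u_of_le ha x v
  have hp : Continuous fun ρ : ℝ => (x, v, ρ) := by fun_prop
  have hle : ∀ b ∈ Icc 0 a, ∫ ρ in (0 : ℝ)..b, (F.glue a G).gen (x, v, ρ)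
      = ∫ ρ in (0 : ℝ)..b, F.gen (x, v, ρ) := by
    intro b hb
    refine intervalIntegral.integral_congr fun ρ hρ => ?_
    rw [uIcc_of_le hb.1] at hρ
    exact Field.glue_gen_of_le (hρ.2.trans hb.2) x v
  rcases le_total r a with hra | hra
  · rw [e0, Field.glue_u_of_le hra, hle r ⟨hr.1, hra⟩]
    exact hF x hx v r ⟨hr.1, hra⟩
  · have i : ∀ b c, IntervalIntegrable (fun ρ => (F.glue a G).gen (x, v, ρ)) volume b c :=
      fun b c => ((F.glue a G).continuous_gen.comp hp).intervalIntegrable b c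
    rw [e0, (h.glue_of_ge hra hx v).1, ← intervalIntegral.integral_add_adjacent_intervals (i 0 a)
      (i a r), hle a ⟨ha, le_rfl⟩, ← add_assoc, ← hF x hx v a ⟨ha, le_rfl⟩, h.u x hx v,
      hG x hx v (r - a) ⟨by linarith, by linarith [hr.2]⟩]
    congr 1
    have := intervalIntegral.integral_comp_sub_right (a := a) (b := r)
      (fun ρ => G.gen (x, v, ρ)) a
    rw [sub_self] at this
    rw [← this]
    refine intervalIntegral.integral_congr fun ρ hρ => ?_
    rw [uIcc_of_le hra] at hρ
    have g := h.glue_of_ge hρ.1 hx v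
    simp only [Field.gen, g.2.1, g.2.2.2]

end glue

/-- The two walls: `σ (x - c)` is the distance from the wall at `c` inside the domain. -/
def IsWall (σ c : ℝ) : Prop := (σ = 1 ∧ c = 0) ∨ (σ = -1 ∧ c = 1)

lemma IsWall.sign {σ c : ℝ} (h : IsWall σ c) : σ = 1 ∨ σ = -1 := h.imp And.left And.left

lemma IsWall.mem_Icc {σ c : ℝ} (h : IsWall σ c) : c ∈ Icc (0 : ℝ) 1 := by
  rcases h with ⟨-, rfl⟩ | ⟨-, rfl⟩ <;> simp

/-- Bounds for a profile in the approximation of the killed evolution. -/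
structure Jet2.IsProfile (M K ε δ κ : ℝ) (J : Jet2) : Prop where
  nonneg : ∀ z, 0 ≤ J.f z
  le : ∀ z, J.f z ≤ M
  le_exp : ∀ σ : ℝ, σ = 1 ∨ σ = -1 → ∀ z, J.f z ≤ K * Real.exp (σ * z.2)
  zero : ∀ σ c, IsWall σ c → ∀ z : ℝ × ℝ, σ * (z.1 - c) ≤ -ε → J.f z = 0
  near : ∀ σ c, IsWall σ c → ∀ z : ℝ × ℝ, σ * (z.1 - c) ≤ ε → σ * z.2 ≤ -(δ / 2) → J.f z ≤ κ

/-- Bounds for the approximation of the killed evolution. -/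
structure Field.IsKilled (M K δ κ t : ℝ) (F : Field) : Prop where
  nonneg : ∀ x ∈ Icc (0 : ℝ) 1, ∀ v, ∀ r ∈ Icc 0 t, 0 ≤ F.u (x, v, r)
  le : ∀ x ∈ Icc (0 : ℝ) 1, ∀ v, ∀ r ∈ Icc 0 t, F.u (x, v, r) ≤ M
  le_exp : ∀ σ : ℝ, σ = 1 ∨ σ = -1 → ∀ x ∈ Icc (0 : ℝ) 1, ∀ v, ∀ r ∈ Icc 0 t,
    F.u (x, v, r) ≤ K * Real.exp r * Real.exp (σ * v)
  wall : ∀ σ c, IsWall σ c → ∀ v, σ * v ≤ -δ → ∀ r ∈ Icc 0 t, F.u (c, v, r) ≤ κ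

/-- During one period without killing, a particle started on the wall and moving outwards ends, up
to probability `136 τ / δ²`, where the profile is at most `32 M τ / δ²`; the sum gives `168`. -/
lemma Jet2.IsProfile.isKilled {M K δ τ : ℝ} {J : Jet2} (hδ : 0 < δ) (hτ : 0 < τ)
    (h : J.IsProfile M K (τ * δ / 8) δ (32 * M * τ / δ ^ 2)) :
    J.field.IsKilled M K δ (168 * M * τ / δ ^ 2) τ := by
  have M0 : 0 ≤ M := (h.nonneg 0).trans (h.le 0)
  have hC : ∀ z, |J.f z| ≤ M := fun z => by rw [abs_of_nonneg (h.nonneg z)]; exact h.le z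
  refine ⟨fun x _ v r _ => kolmogorov_nonneg h.nonneg _ _,
    fun x _ v r _ => (le_abs_self _).trans (abs_kolmogorov_le hC r (x, v)),
    fun σ hσ x _ v r hr => kolmogorov_le_exp J.d.cont hC hσ hr.1 (h.le_exp σ hσ) (x, v),
    fun σ c hc v hv r hr => ?_⟩
  refine (kolmogorov_le_of_leaving (p := (c, v)) J.d.cont h.nonneg h.le
    (by positivity : 0 ≤ 32 * M * τ / δ ^ 2) hc.sign hδ hr.1 hr.2 hτ (h.near σ c hc) (by simp)
    hv).trans_eq ?_
  ring

/-- The cutoff restores the vanishing outside, and smallness near the wall is regenerated from the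
vanishing of the old profile by `kolmogorov_le_of_near`, not from its smallness. Hence the bounds do
not deteriorate with the number of periods, except that `K` gains `exp τ`. -/
lemma Jet2.IsProfile.cut_evolve {M K δ τ : ℝ} {J : Jet2} (hδ : 0 < δ) (hτ : 0 < τ)
    (h : J.IsProfile M K (τ * δ / 8) δ (32 * M * τ / δ ^ 2)) {θ θ' θ'' : ℝ → ℝ}
    (hθ : IsCutoff (τ * δ / 8) θ θ' θ'') :
    ((J.evolve τ).cut hθ).IsProfile M (K * Real.exp τ) (τ * δ / 8) δ (32 * M * τ / δ ^ 2) := by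
  have M0 : 0 ≤ M := (h.nonneg 0).trans (h.le 0)
  have hC : ∀ z, |J.f z| ≤ M := fun z => by rw [abs_of_nonneg (h.nonneg z)]; exact h.le z
  have n : ∀ z, 0 ≤ (J.evolve τ).f z := fun z => kolmogorov_nonneg h.nonneg _ _
  have l : ∀ z, ((J.evolve τ).cut hθ).f z ≤ (J.evolve τ).f z := fun z =>
    mul_le_of_le_one_left (n z) (hθ.le_one _)
  refine ⟨fun z => mul_nonneg (hθ.nonneg _) (n z),
    fun z => (l z).trans ((le_abs_self _).trans (abs_kolmogorov_le hC τ z)),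
    fun σ hσ z => (l z).trans (kolmogorov_le_exp J.d.cont hC hσ hτ.le (h.le_exp σ hσ) z),
    fun σ c hc z hz => ?_, fun σ c hc z hz hv => (l z).trans ?_⟩
  · have : θ z.1 = 0 := by
      refine hθ.eq_zero _ ?_
      rcases hc with ⟨rfl, rfl⟩ | ⟨rfl, rfl⟩
      · left; linarith
      · right; linarith
    simp [Jet2.cut, this]
  · exact kolmogorov_le_of_near J.d.cont h.nonneg h.le hc.sign hτ hδ (h.zero σ c hc) hz hv

lemma Field.IsKilled.glue {M K δ κ a τ : ℝ} {F G : Field} (hF : F.IsKilled M K δ κ a)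
    (hG : G.IsKilled M (K * Real.exp a) δ κ τ) (h : F.Matches a G) :
    (F.glue a G).IsKilled M K δ κ (a + τ) := by
  have key : ∀ (P : ℝ → ℝ → ℝ → ℝ → Prop), ∀ x ∈ Icc (0 : ℝ) 1, ∀ v,
      (∀ r ∈ Icc 0 a, P x v r (F.u (x, v, r))) →
      (∀ r ∈ Icc 0 τ, P x v (a + r) (G.u (x, v, r))) →
      ∀ r ∈ Icc 0 (a + τ), P x v r ((F.glue a G).u (x, v, r)) := by
    intro P x hx v h1 h2 r hr
    rcases le_total r a with hra | hra
    · rw [Field.glue_u_of_le hra]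
      exact h1 r ⟨hr.1, hra⟩
    · rw [(h.glue_of_ge hra hx v).1]
      have := h2 (r - a) ⟨by linarith, by linarith [hr.2]⟩
      rwa [add_sub_cancel] at this
  refine ⟨fun x hx v => key (fun _ _ _ y => 0 ≤ y) x hx v (hF.nonneg x hx v) (hG.nonneg x hx v),
    fun x hx v => key (fun _ _ _ y => y ≤ M) x hx v (hF.le x hx v) (hG.le x hx v),
    fun σ hσ x hx v => key (fun _ v r y => y ≤ K * Real.exp r * Real.exp (σ * v)) x hx v
      (hF.le_exp σ hσ x hx v) fun r hr => ?_,
    fun σ c hc v hv => key (fun _ _ _ y => y ≤ κ) c hc.mem_Icc v (hF.wall σ c hc v hv)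
      (hG.wall σ c hc v hv)⟩
  rw [Real.exp_add, ← mul_assoc]
  exact hG.le_exp σ hσ x hx v r hr

/-- Alternates evolution and cutoff. The cutoff is one on `[0,1]` with vanishing derivative, so it
alters neither the function nor the derivatives that must match over the closed strip; the equation
there is solved without error across the junctions. -/
lemma exists_isKilled_mul {M K δ τ : ℝ} {J₀ : Jet2} (hδ : 0 < δ) (hτ : 0 < τ)
    (h : J₀.IsProfile M K (τ * δ / 8) δ (32 * M * τ / δ ^ 2)) (n : ℕ) :
    ∃ (F : Field) (J : Jet2), F.Solves (n * τ) ∧ F.IsKilled M K δ (168 * M * τ / δ ^ 2) (n * τ) ∧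
      (∀ x ∈ Icc (0 : ℝ) 1, ∀ v, F.u (x, v, 0) = J₀.f (x, v)) ∧
      J.IsProfile M (K * Real.exp (n * τ)) (τ * δ / 8) δ (32 * M * τ / δ ^ 2) ∧
      F.Matches (n * τ) J.field := by
  obtain ⟨θ, θ', θ'', hθ⟩ := exists_isCutoff (ε := τ * δ / 8) (by positivity)
  induction n with
  | zero =>
    refine ⟨J₀.field, J₀, ?_, ?_, fun x hx v => ?_, by simpa using h, ?_⟩
    · exact J₀.solves_field _
    · have k := h.isKilled hδ hτ
      have hs : Icc 0 (((0 : ℕ) : ℝ) * τ) ⊆ Icc 0 τ := Icc_subset_Icc_right (by simpa using hτ.le)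
      exact ⟨fun x hx v r hr => k.nonneg x hx v r (hs hr), fun x hx v r hr => k.le x hx v r (hs hr),
        fun σ hσ x hx v r hr => k.le_exp σ hσ x hx v r (hs hr),
        fun σ c hc v hv r hr => k.wall σ c hc v hv r (hs hr)⟩
    · exact congrFun J₀.evolve_zero.1 (x, v)
    · constructor <;> simp
  | succ n ih =>
    obtain ⟨F, J, hF, hK, h0, hJ, hm⟩ := ih
    have hnτ : 0 ≤ n * τ := by positivity
    have e : ((n + 1 : ℕ) : ℝ) * τ = n * τ + τ := by push_cast; ring
    refine ⟨F.glue (n * τ) J.field, (J.evolve τ).cut hθ, ?_, ?_, fun x hx v => ?_, ?_, ?_⟩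
    · rw [e]
      exact hm.solves_glue hnτ hF (J.solves_field τ)
    · rw [e]
      exact hK.glue (hJ.isKilled hδ hτ) hm
    · rw [Field.glue_u_of_le hnτ]
      exact h0 x hx v
    · rw [e, Real.exp_add, ← mul_assoc]
      exact hJ.cut_evolve hδ hτ hθ
    · have z := ((J.evolve τ).cut hθ).evolve_zero
      have g : ∀ x ∈ Icc (0 : ℝ) 1, ∀ v, _ := fun x hx v =>
        hm.glue_of_ge (r := n * τ + τ) (by linarith) hx v
      rw [add_sub_cancel_left] at g
      rw [e]
      refine ⟨fun x hx v => ?_, fun x hx v => ?_, fun x hx v => ?_, fun x hx v => ?_⟩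
      · rw [(g x hx v).1]
        change _ = (((J.evolve τ).cut hθ).evolve 0).f (x, v)
        rw [z.1]
        simp [Jet2.cut, Jet2.field, hθ.eq_one x hx]
      · rw [(g x hx v).2.1]
        change _ = (((J.evolve τ).cut hθ).evolve 0).f₁ (x, v)
        rw [z.2.1]
        simp [Jet2.cut, Jet2.field, hθ.eq_one x hx, hθ.eq_zero' x hx]
      · rw [(g x hx v).2.2.1]
        change _ = (((J.evolve τ).cut hθ).evolve 0).f₂ (x, v)
        rw [z.2.2.1]
        simp [Jet2.cut, Jet2.field, hθ.eq_one x hx]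
      · rw [(g x hx v).2.2.2]
        change _ = (((J.evolve τ).cut hθ).evolve 0).f₂₂ (x, v)
        rw [z.2.2.2]
        simp [Jet2.cut, Jet2.field, hθ.eq_one x hx]

/-- A solution of the backward equation with prescribed initial value that is as small as we please
on the outgoing boundary away from the corners. -/
theorem exists_isKilled {M K η t δ κ : ℝ} {J : Jet2} (hη : 0 < η) (ht : 0 < t) (hδ : 0 < δ)
    (hκ : 0 < κ) (h0 : ∀ z, 0 ≤ J.f z) (hM : ∀ z, J.f z ≤ M)
    (hK : ∀ σ : ℝ, σ = 1 ∨ σ = -1 → ∀ z, J.f z ≤ K * Real.exp (σ * z.2))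
    (hz : ∀ z : ℝ × ℝ, z.1 ≤ η ∨ 1 - η ≤ z.1 → J.f z = 0) :
    ∃ F : Field, F.Solves t ∧ F.IsKilled M K δ κ t ∧
      ∀ x ∈ Icc (0 : ℝ) 1, ∀ v, F.u (x, v, 0) = J.f (x, v) := by
  have M0 : 0 ≤ M := (h0 0).trans (hM 0)
  have hlim : Tendsto (fun n : ℕ => t / (n : ℝ)) atTop (𝓝 0) :=
    tendsto_const_div_atTop_nhds_zero_nat t
  have l1 : Tendsto (fun n : ℕ => t / (n : ℝ) * δ / 8) atTop (𝓝 0) := by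
    simpa using (hlim.mul_const δ).div_const 8
  have l2 : Tendsto (fun n : ℕ => 168 * M * (t / (n : ℝ)) / δ ^ 2) atTop (𝓝 0) := by
    simpa using (hlim.const_mul (168 * M)).div_const (δ ^ 2)
  -- The period `t / n` must make the layer `τδ/8` thinner than the margin of the support, and the
  -- wall bound smaller than `κ`.
  obtain ⟨n, hn1, hn2, hn3⟩ := ((l1.eventually (gt_mem_nhds hη)).and
    ((l2.eventually (gt_mem_nhds hκ)).and (eventually_gt_atTop 0))).exists
  have n0 : (0 : ℝ) < n := by exact_mod_cast hn3
  set τ := t / (n : ℝ) with hτ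
  have τ0 : 0 < τ := by positivity
  have zer : ∀ σ c, IsWall σ c → ∀ z : ℝ × ℝ, σ * (z.1 - c) ≤ η → J.f z = 0 := by
    rintro σ c (⟨rfl, rfl⟩ | ⟨rfl, rfl⟩) z h
    · exact hz z (Or.inl (by linarith))
    · exact hz z (Or.inr (by linarith))
  have τδ : 0 < τ * δ / 8 := by positivity
  have hp : J.IsProfile M K (τ * δ / 8) δ (32 * M * τ / δ ^ 2) :=
    ⟨h0, hM, hK, fun σ c hc z h => zer σ c hc z (by linarith),
      fun σ c hc z h _ => by
        rw [zer σ c hc z (by linarith)]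
        positivity⟩
  obtain ⟨F, -, hF, hk, hi, -⟩ := exists_isKilled_mul hδ τ0 hp n
  have e : n * τ = t := by rw [hτ]; field_simp
  rw [e] at hF hk
  exact ⟨F, hF, ⟨hk.nonneg, hk.le, hk.le_exp,
    fun σ c hc v hv r hr => (hk.wall σ c hc v hv r hr).trans hn2.le⟩, hi⟩

end FokkerPlanck

namespace FokkerPlanck

open Filter Topology ProbabilityTheory

/-! ### Smooth truncation -/

/-- The kink of the positive part at `a` is harmless because `f` has slope zero there. -/
lemma hasDerivAt_comp_max {f f' : ℝ → ℝ} (hf : ∀ y, 0 ≤ y → HasDerivAt f (f' y) y)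
    (h0 : f' 0 = 0) (a z : ℝ) :
    HasDerivAt (fun z => f (max (z - a) 0)) (f' (max (z - a) 0)) z := by
  rcases lt_trichotomy z a with h | rfl | h
  · have e : (fun z => f (max (z - a) 0)) =ᶠ[𝓝 z] fun _ => f 0 := by
      filter_upwards [gt_mem_nhds h] with y hy
      rw [max_eq_right (by linarith)]
    rw [max_eq_right (by linarith), h0]
    exact (hasDerivAt_const z (f 0)).congr_of_eventuallyEq e
  · rw [sub_self, max_self, h0, hasDerivAt_iff_isLittleO]
    have h1 := hasDerivAt_iff_isLittleO.1 (hf 0 le_rfl)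
    have ht : Tendsto (fun y => max (y - z) 0) (𝓝 z) (𝓝 0) := by
      have : Continuous fun y : ℝ => max (y - z) 0 := by fun_prop
      simpa using this.tendsto z
    have h2 := h1.comp_tendsto ht
    have h3 : (fun y => max (y - z) 0) =O[𝓝 z] fun y => y - z := by
      refine Asymptotics.IsBigO.of_bound 1 (.of_forall fun y => ?_)
      rw [one_mul, Real.norm_eq_abs, Real.norm_eq_abs, abs_of_nonneg (le_max_right _ _)]
      exact max_le (le_abs_self _) (abs_nonneg _)
    refine (h2.trans_isBigO (by simpa [Function.comp_def] using h3)).congr_left fun y => ?_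
    simp [h0]
  · have e : (fun z => f (max (z - a) 0)) =ᶠ[𝓝 z] fun y => f (y - a) := by
      filter_upwards [lt_mem_nhds h] with y hy
      rw [max_eq_left (by linarith)]
    rw [max_eq_left (by linarith)]
    have := (hf (z - a) (by linarith)).comp_sub_const z a
    exact this.congr_of_eventuallyEq e

/-- A convex `C²` approximation of the positive part, vanishing up to `κ`. -/
structure IsTrunc (κ : ℝ) (β β' β'' : ℝ → ℝ) : Prop where
  deriv : ∀ z, HasDerivAt β (β' z) z
  deriv' : ∀ z, HasDerivAt β' (β'' z) z
  cont'' : Continuous β''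
  eq_zero : ∀ z ≤ κ, β z = 0
  eq_zero'' : ∀ z ≤ κ, β'' z = 0
  nonneg' : ∀ z, 0 ≤ β' z
  le_one' : ∀ z, β' z ≤ 1
  nonneg'' : ∀ z, 0 ≤ β'' z
  nonneg : ∀ z, 0 ≤ β z
  le : ∀ z, 0 ≤ z → β z ≤ z
  sub_le : ∀ z, 0 ≤ z → z - β z ≤ 3 * κ

/-- With `y = (z - κ)₊` take `y³ / (y + κ)²`: the cubic contact makes it `C²`, and both derivatives
are explicit nonnegative fractions. It falls short of `y` by at most `2κ`, hence of `z` by at most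
`3κ`. -/
lemma exists_isTrunc {κ : ℝ} (hκ : 0 < κ) : ∃ β β' β'', IsTrunc κ β β' β'' := by
  set y : ℝ → ℝ := fun z => max (z - κ) 0 with hy
  have y0 : ∀ z, 0 ≤ y z := fun z => le_max_right _ _
  have yz : ∀ z ≤ κ, y z = 0 := fun z hz => max_eq_right (by linarith)
  have pos : ∀ z, 0 < y z + κ := fun z => by linarith [y0 z]
  have ratio : ∀ r, 0 ≤ r → r ^ 3 / (r + κ) ^ 2 ≤ r ∧ r - r ^ 3 / (r + κ) ^ 2 ≤ 2 * κ := by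
    intro r hr
    have : 0 < (r + κ) ^ 2 := by positivity
    refine ⟨?_, ?_⟩
    · rw [div_le_iff₀ this]
      have : 0 ≤ r * (2 * r * κ + κ ^ 2) := by positivity
      nlinarith
    · rw [sub_le_iff_le_add', ← sub_le_iff_le_add, le_div_iff₀ this]
      have : 0 ≤ 3 * r * κ ^ 2 + 2 * κ ^ 3 := by positivity
      nlinarith
  refine ⟨fun z => y z ^ 3 / (y z + κ) ^ 2, fun z => (y z ^ 3 + 3 * κ * y z ^ 2) / (y z + κ) ^ 3,
    fun z => 6 * κ ^ 2 * y z / (y z + κ) ^ 4, ⟨fun z => ?_, fun z => ?_, ?_, fun z hz => ?_,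
    fun z hz => ?_, fun z => ?_, fun z => ?_, fun z => ?_, fun z => ?_, fun z hz => ?_,
    fun z hz => ?_⟩⟩
  · refine hasDerivAt_comp_max (f := fun y => y ^ 3 / (y + κ) ^ 2)
      (f' := fun y => (y ^ 3 + 3 * κ * y ^ 2) / (y + κ) ^ 3) (fun r hr => ?_) (by simp) κ z
    have hne : r + κ ≠ 0 := by linarith
    refine (((hasDerivAt_id r).pow 3).div (((hasDerivAt_id r).add_const κ).pow 2)
      (pow_ne_zero 2 hne)).congr_deriv ?_
    simp only [id, Pi.pow_apply]
    field_simp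
    push_cast
    ring
  · refine hasDerivAt_comp_max (f := fun y => (y ^ 3 + 3 * κ * y ^ 2) / (y + κ) ^ 3)
      (f' := fun y => 6 * κ ^ 2 * y / (y + κ) ^ 4) (fun r hr => ?_) (by simp) κ z
    have hne : r + κ ≠ 0 := by linarith
    refine ((((hasDerivAt_id r).pow 3).add (((hasDerivAt_id r).pow 2).const_mul (3 * κ))).div
      (((hasDerivAt_id r).add_const κ).pow 3) (pow_ne_zero 3 hne)).congr_deriv ?_
    simp only [id, Pi.pow_apply, Pi.add_apply]
    field_simp
    push_cast
    ring
  · have : Continuous y := by fun_prop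
    exact (by fun_prop : Continuous fun z => 6 * κ ^ 2 * y z).div (by fun_prop)
      fun z => pow_ne_zero 4 (pos z).ne'
  · simp [yz z hz]
  · simp [yz z hz]
  · have := pos z
    have := y0 z
    positivity
  · rw [div_le_one (pow_pos (pos z) 3)]
    have : 0 ≤ 3 * y z * κ ^ 2 + κ ^ 3 := by have := y0 z; positivity
    nlinarith
  · have := pos z
    have := y0 z
    positivity
  · have := pos z
    have := y0 z
    positivity
  · exact (ratio _ (y0 z)).1.trans (max_le (by linarith) hz)
  · have h1 := (ratio _ (y0 z)).2
    have h2 : z - κ ≤ y z := le_max_left _ _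
    linarith

/-- A function equal to `1` on `[-1,1]` and supported in `[-2,2]`, with its derivatives. -/
structure IsPlateau (C : ℝ) (b b' b'' : ℝ → ℝ) : Prop where
  deriv : ∀ x, HasDerivAt b (b' x) x
  deriv' : ∀ x, HasDerivAt b' (b'' x) x
  cont'' : Continuous b''
  nonneg : ∀ x, 0 ≤ b x
  le_one : ∀ x, b x ≤ 1
  bdd' : ∀ x, |b' x| ≤ C
  bdd'' : ∀ x, |b'' x| ≤ C
  eq_one : ∀ x, |x| ≤ 1 → b x = 1
  eq_zero : ∀ x, 2 < |x| → b x = 0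
  eq_zero' : ∀ x, 2 < |x| → b' x = 0
  eq_zero'' : ∀ x, 2 < |x| → b'' x = 0

lemma exists_isPlateau : ∃ C b b' b'', IsPlateau C b b' b'' := by
  let b : ContDiffBump (0 : ℝ) := ⟨1, 2, by norm_num, by norm_num⟩
  have hb : ContDiff ℝ 2 b := b.contDiff
  have hb1 : ContDiff ℝ 1 (deriv b) :=
    (contDiff_succ_iff_deriv (n := 1)).1 (by exact_mod_cast hb) |>.2.2
  have hb2 : ContDiff ℝ 0 (deriv (deriv b)) :=
    (contDiff_succ_iff_deriv (n := 0)).1 (by simpa using hb1) |>.2.2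
  have k0 : HasCompactSupport b := b.hasCompactSupport
  have z0 : ∀ x : ℝ, 2 < |x| → b =ᶠ[𝓝 x] fun _ => 0 := by
    intro x hx
    filter_upwards [(isOpen_lt continuous_const continuous_abs).mem_nhds hx] with y hy
    refine b.zero_of_le_dist ?_
    rw [Real.dist_eq, sub_zero]
    exact le_of_lt hy
  have z1 : ∀ x : ℝ, 2 < |x| → deriv b =ᶠ[𝓝 x] fun _ => 0 := fun x hx => by
    simpa using (z0 x hx).deriv
  obtain ⟨C, hC⟩ := k0.deriv.exists_bound_of_continuous hb1.continuous
  obtain ⟨D, hD⟩ := k0.deriv.deriv.exists_bound_of_continuous hb2.continuous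
  refine ⟨max C D, b, deriv b, deriv (deriv b), ⟨fun x => ?_, fun x => ?_, hb2.continuous,
    fun x => b.nonneg, fun x => b.le_one, fun x => (hC x).trans (le_max_left _ _),
    fun x => (hD x).trans (le_max_right _ _), fun x hx => ?_, fun x hx => (z0 x hx).eq_of_nhds,
    fun x hx => (z1 x hx).eq_of_nhds, fun x hx => ?_⟩⟩
  · exact (hb.differentiable (by norm_num) x).hasDerivAt
  · exact (hb1.differentiable (by norm_num) x).hasDerivAt
  · refine b.one_of_mem_closedBall ?_
    rw [Metric.mem_closedBall, Real.dist_eq, sub_zero]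
    exact hx
  · simpa using (z1 x hx).deriv.eq_of_nhds

/-! ### Operations on fields -/

/-- Composition of a field with a `C²` function. -/
def Field.comp (F : Field) (β β' β'' : ℝ → ℝ) (h : ∀ z, HasDerivAt β (β' z) z)
    (h' : ∀ z, HasDerivAt β' (β'' z) z) (c : Continuous β'') : Field where
  u := fun p => β (F.u p)
  u₁ := fun p => β' (F.u p) * F.u₁ p
  u₂ := fun p => β' (F.u p) * F.u₂ p
  u₂₂ := fun p => β'' (F.u p) * F.u₂ p * F.u₂ p + β' (F.u p) * F.u₂₂ p
  cont := (continuous_iff_continuousAt.2 fun z => (h z).continuousAt).comp F.cont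
  cont₁ := ((continuous_iff_continuousAt.2 fun z => (h' z).continuousAt).comp F.cont).mul F.cont₁
  cont₂ := ((continuous_iff_continuousAt.2 fun z => (h' z).continuousAt).comp F.cont).mul F.cont₂
  cont₂₂ := (((c.comp F.cont).mul F.cont₂).mul F.cont₂).add
    (((continuous_iff_continuousAt.2 fun z => (h' z).continuousAt).comp F.cont).mul F.cont₂₂)
  hasDerivAt_x := fun x v r => (h (F.u (x, v, r))).comp x (F.hasDerivAt_x x v r)
  hasDerivAt_v := fun x v r => (h (F.u (x, v, r))).comp v (F.hasDerivAt_v x v r)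
  hasDerivAt_vv := fun x v r =>
    ((h' (F.u (x, v, r))).comp v (F.hasDerivAt_v x v r)).mul (F.hasDerivAt_vv x v r)

/-- `F (x, v, t - s) - W (x, v, s)`. -/
def Field.reverseSub (t : ℝ) (F W : Field) : Field where
  u := fun p => F.u (p.1, p.2.1, t - p.2.2) - W.u p
  u₁ := fun p => F.u₁ (p.1, p.2.1, t - p.2.2) - W.u₁ p
  u₂ := fun p => F.u₂ (p.1, p.2.1, t - p.2.2) - W.u₂ p
  u₂₂ := fun p => F.u₂₂ (p.1, p.2.1, t - p.2.2) - W.u₂₂ p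
  cont := by have := F.cont; have := W.cont; fun_prop
  cont₁ := by have := F.cont₁; have := W.cont₁; fun_prop
  cont₂ := by have := F.cont₂; have := W.cont₂; fun_prop
  cont₂₂ := by have := F.cont₂₂; have := W.cont₂₂; fun_prop
  hasDerivAt_x := fun x v r => (F.hasDerivAt_x x v (t - r)).sub (W.hasDerivAt_x x v r)
  hasDerivAt_v := fun x v r => (F.hasDerivAt_v x v (t - r)).sub (W.hasDerivAt_v x v r)
  hasDerivAt_vv := fun x v r => (F.hasDerivAt_vv x v (t - r)).sub (W.hasDerivAt_vv x v r)

/-- The field is differentiable in time, with derivative `d`. -/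
structure Field.HasTime (t : ℝ) (F : Field) (d : ℝ × ℝ × ℝ → ℝ) : Prop where
  cont : Continuous d
  deriv : ∀ x ∈ Icc (0 : ℝ) 1, ∀ v, ∀ s ∈ Ioo 0 t,
    HasDerivAt (fun s => F.u (x, v, s)) (d (x, v, s)) s

lemma Field.HasTime.comp {t : ℝ} {F : Field} {d : ℝ × ℝ × ℝ → ℝ} (hF : F.HasTime t d)
    {β β' β'' : ℝ → ℝ} (h : ∀ z, HasDerivAt β (β' z) z) (h' : ∀ z, HasDerivAt β' (β'' z) z)
    (c : Continuous β'') : (F.comp β β' β'' h h' c).HasTime t fun p => β' (F.u p) * d p :=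
  ⟨((continuous_iff_continuousAt.2 fun z => (h' z).continuousAt).comp F.cont).mul hF.cont,
    fun x hx v s hs => (h (F.u (x, v, s))).comp s (hF.deriv x hx v s hs)⟩

lemma Field.Solves.hasTime_reverseSub {t : ℝ} {F W : Field} (hF : F.Solves t)
    (hW : ∀ x v s, W.u (x, v, s) = W.u (x, v, 0)) :
    (F.reverseSub t W).HasTime t fun p => -F.gen (p.1, p.2.1, t - p.2.2) := by
  refine ⟨?_, fun x hx v s hs => ?_⟩
  · have := F.continuous_gen
    fun_prop
  · have h1 := hF.hasDerivAt (v := v) (r := t - s) hx ⟨by linarith [hs.2], by linarith [hs.1]⟩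
    have h2 := (h1.comp_const_sub t s).sub_const (W.u (x, v, 0))
    refine h2.congr_of_eventuallyEq (.of_forall fun r => ?_)
    simp only [Field.reverseSub, hW x v r]

/-! ### Integration by parts on the cylinder -/

lemma stripMeasure_eq_prod : stripMeasure = (volume.restrict (Ioo (0 : ℝ) 1)).prod volume := by
  rw [stripMeasure, strip, Measure.volume_eq_prod, ← Measure.prod_restrict, Measure.restrict_univ]

lemma integral_strip_snd (m : ℝ → ℝ) : ∫ z, m z.2 ∂stripMeasure = ∫ v, m v := by
  rw [stripMeasure_eq_prod, integral_fun_snd]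
  simp

lemma integrable_strip_snd {m : ℝ → ℝ} (hm : Integrable m) :
    Integrable (fun z => m z.2) stripMeasure := by
  rw [stripMeasure_eq_prod]
  exact hm.comp_snd _

lemma integrable_cyl_of_band {g : ℝ × ℝ × ℝ → ℝ} (hg : Continuous g) {R : ℝ}
    (h0 : ∀ p, R < |p.2.1| → g p = 0) (t : ℝ) :
    Integrable (fun p => g (p.1.1, p.1.2, p.2)) (cylMeasure t) := by
  obtain ⟨C, hC⟩ := (isCompact_Icc.prod (isCompact_Icc.prod isCompact_Icc) :
    IsCompact (Icc (0 : ℝ) 1 ×ˢ Icc (-R) R ×ˢ Icc 0 t)).exists_bound_of_continuousOn hg.continuousOn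
  have hs : MeasurableSet {p : (ℝ × ℝ) × ℝ | |p.1.2| ≤ R} :=
    measurableSet_le (by fun_prop) measurable_const
  have hb : Integrable (indicator {p : (ℝ × ℝ) × ℝ | |p.1.2| ≤ R} fun _ => |C|) (cylMeasure t) := by
    refine memLp_one_iff_integrable.1 (memLp_cyl_of_band (R := R) (C := |C|)
      (measurable_const.indicator hs) (fun p hp => ?_) (fun p => ?_) 1 t)
    · exact indicator_of_notMem (by simpa using hp) _
    · by_cases hp : p ∈ {p : (ℝ × ℝ) × ℝ | |p.1.2| ≤ R}
      · simp [indicator_of_mem hp]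
      · simp [indicator_of_notMem hp]
  refine hb.mono' ((hg.comp (by fun_prop : Continuous fun p : (ℝ × ℝ) × ℝ =>
    (p.1.1, p.1.2, p.2))).aestronglyMeasurable) ?_
  filter_upwards [ae_mem_cyl t] with p hp
  by_cases hpR : |p.1.2| ≤ R
  · rw [indicator_of_mem (by exact hpR)]
    have := mem_cyl.1 hp
    refine (hC _ ⟨?_, ?_, ?_⟩).trans (le_abs_self _)
    · exact Ioo_subset_Icc_self this.1
    · exact abs_le.1 hpR
    · exact Ioo_subset_Icc_self this.2
  · rw [h0 _ (not_le.1 hpR), norm_zero]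
    exact indicator_nonneg (fun _ _ => abs_nonneg _) _

lemma integrable_strip_of_band {g : ℝ × ℝ → ℝ} (hg : Continuous g) {R : ℝ}
    (h0 : ∀ z, R < |z.2| → g z = 0) : Integrable g stripMeasure := by
  obtain ⟨C, hC⟩ := (isCompact_Icc.prod isCompact_Icc :
    IsCompact (Icc (0 : ℝ) 1 ×ˢ Icc (-R) R)).exists_bound_of_continuousOn hg.continuousOn
  have hs : MeasurableSet {z : ℝ × ℝ | |z.2| ≤ R} :=
    measurableSet_le (by fun_prop) measurable_const
  have hb : Integrable (indicator {z : ℝ × ℝ | |z.2| ≤ R} fun _ => |C|) stripMeasure := by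
    rw [integrable_indicator_iff hs]
    exact integrableOn_const (measure_band_lt_top R).ne
  refine hb.mono' hg.aestronglyMeasurable ?_
  filter_upwards [ae_restrict_mem measurableSet_strip] with z hz
  by_cases hzR : |z.2| ≤ R
  · rw [indicator_of_mem (by exact hzR)]
    refine (hC _ ⟨?_, ?_⟩).trans (le_abs_self _)
    · exact Ioo_subset_Icc_self (mem_strip.1 hz)
    · exact abs_le.1 hzR
  · rw [h0 _ (not_le.1 hzR), norm_zero]
    exact indicator_nonneg (fun _ _ => abs_nonneg _) _

/-- A cutoff in velocity with its first two derivatives. -/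
structure IsVelCutoff (R C : ℝ) (ζ ζ' ζ'' : ℝ → ℝ) : Prop where
  deriv : ∀ x, HasDerivAt ζ (ζ' x) x
  deriv' : ∀ x, HasDerivAt ζ' (ζ'' x) x
  cont'' : Continuous ζ''
  nonneg : ∀ x, 0 ≤ ζ x
  le_one : ∀ x, ζ x ≤ 1
  bdd'' : ∀ x, |ζ'' x| ≤ C
  eq_one : ∀ x, |x| ≤ R → ζ x = 1
  eq_zero : ∀ x, 2 * R < |x| → ζ x = 0
  eq_zero' : ∀ x, 2 * R < |x| → ζ' x = 0
  eq_zero'' : ∀ x, 2 * R < |x| → ζ'' x = 0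

/-- Stretching by `R ≥ 1` only shrinks the derivatives, so the constant is independent of `R`. This
matters because the radius will grow as `δ` decreases. -/
lemma IsPlateau.velCutoff {C : ℝ} {b b' b'' : ℝ → ℝ} (h : IsPlateau C b b' b'') {R : ℝ}
    (hR : 1 ≤ R) :
    IsVelCutoff R C (fun v => b (v / R)) (fun v => b' (v / R) / R) (fun v => b'' (v / R) / R / R) := by
  have R0 : 0 < R := by linarith
  have d : ∀ v, HasDerivAt (fun v : ℝ => v / R) (1 / R) v := fun v => (hasDerivAt_id v).div_const R
  have far : ∀ v, 2 * R < |v| → 2 < |v / R| := fun v hv => by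
    rw [abs_div, abs_of_pos R0, lt_div_iff₀ R0]
    exact hv
  have c := h.cont''
  refine ⟨fun v => ?_, fun v => ?_, by fun_prop, fun v => h.nonneg _, fun v => h.le_one _,
    fun v => ?_, fun v hv => ?_, fun v hv => h.eq_zero _ (far v hv), fun v hv => ?_, fun v hv => ?_⟩
  · exact ((h.deriv (v / R)).comp v (d v)).congr_deriv (by ring)
  · exact (((h.deriv' (v / R)).comp v (d v)).div_const R).congr_deriv (by ring)
  · rw [abs_div, abs_div, abs_of_pos R0]
    have h1 : |b'' (v / R)| / R ≤ |b'' (v / R)| := div_le_self (abs_nonneg _) hR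
    exact ((div_le_self (by positivity) hR).trans h1).trans (h.bdd'' _)
  · refine h.eq_one _ ?_
    rw [abs_div, abs_of_pos R0, div_le_one R0]
    exact hv
  · rw [h.eq_zero' _ (far v hv), zero_div]
  · rw [h.eq_zero'' _ (far v hv), zero_div, zero_div]

lemma setIntegral_Ioo_deriv {f f' : ℝ → ℝ} {a b : ℝ} (hab : a ≤ b) (hc : Continuous f)
    (hc' : Continuous f') (hd : ∀ x ∈ Ioo a b, HasDerivAt f (f' x) x) :
    ∫ x in Ioo a b, f' x = f b - f a := by
  rw [← integral_Ioc_eq_integral_Ioo, ← intervalIntegral.integral_of_le hab]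
  exact intervalIntegral.integral_eq_sub_of_hasDerivAt_of_le hab hc.continuousOn hd
    (hc'.intervalIntegrable a b)

/-- The integral of the adjoint operator over the cylinder is controlled by the size of the
field. -/
lemma Field.HasTime.abs_integral_le {t : ℝ} (ht : 0 ≤ t) {G : Field} {d : ℝ × ℝ × ℝ → ℝ}
    (hG : G.HasTime t d) {m : ℝ → ℝ} (hm : Integrable m) (hm1 : Integrable fun v => |v| * m v)
    (hle : ∀ x ∈ Icc (0 : ℝ) 1, ∀ v, ∀ s ∈ Icc 0 t, |G.u (x, v, s)| ≤ m v) {R C : ℝ}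
    {ζ ζ' ζ'' : ℝ → ℝ} (hζ : IsVelCutoff R C ζ ζ' ζ'') :
    |∫ p, ζ p.1.2 * (d (p.1.1, p.1.2, p.2) + G.gen (p.1.1, p.1.2, p.2)) ∂cylMeasure t|
      ≤ (2 + t * C) * (∫ v, m v) + 2 * t * ∫ v, |v| * m v := by
  have m0 : ∀ v, 0 ≤ m v := fun v =>
    (abs_nonneg _).trans (hle 0 (by simp) v 0 ⟨le_rfl, ht⟩)
  have C0 : 0 ≤ C := (abs_nonneg _).trans (hζ.bdd'' 0)
  have cζ : Continuous ζ := continuous_iff_continuousAt.2 fun x => (hζ.deriv x).continuousAt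
  have cζ' : Continuous ζ' := continuous_iff_continuousAt.2 fun x => (hζ.deriv' x).continuousAt
  have cζ'' := hζ.cont''
  have cd := hG.cont
  have c0 := G.cont
  have c1 := G.cont₁
  have c2 := G.cont₂
  have c22 := G.cont₂₂
  have ζabs : ∀ v, |ζ v| ≤ 1 := fun v => by
    rw [abs_of_nonneg (hζ.nonneg v)]
    exact hζ.le_one v
  set fs : ℝ × ℝ × ℝ → ℝ := fun p => ζ p.2.1 * d p with hfs
  set fx : ℝ × ℝ × ℝ → ℝ := fun p => ζ p.2.1 * (p.2.1 * G.u₁ p) with hfx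
  set fv : ℝ × ℝ × ℝ → ℝ := fun p => ζ p.2.1 * G.u₂₂ p with hfv
  have cs : Continuous fs := by fun_prop
  have cx : Continuous fx := by fun_prop
  have cv : Continuous fv := by fun_prop
  have zs : ∀ p, 2 * R < |p.2.1| → fs p = 0 := fun p hp => by simp [hfs, hζ.eq_zero _ hp]
  have zx : ∀ p, 2 * R < |p.2.1| → fx p = 0 := fun p hp => by simp [hfx, hζ.eq_zero _ hp]
  have zv : ∀ p, 2 * R < |p.2.1| → fv p = 0 := fun p hp => by simp [hfv, hζ.eq_zero _ hp]
  have is := integrable_cyl_of_band cs zs t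
  have ix := integrable_cyl_of_band cx zx t
  have iv := integrable_cyl_of_band cv zv t
  -- Integrating in time first leaves the values at times `0` and `t`.
  have Bs : |∫ p, fs (p.1.1, p.1.2, p.2) ∂cylMeasure t| ≤ 2 * ∫ v, m v := by
    rw [cylMeasure] at is ⊢
    rw [integral_prod _ is, ← integral_const_mul, ← integral_strip_snd, ← Real.norm_eq_abs]
    refine norm_integral_le_of_norm_le (integrable_strip_snd (hm.const_mul 2)) ?_
    filter_upwards [ae_restrict_mem measurableSet_strip] with z hz
    have hx : z.1 ∈ Icc (0 : ℝ) 1 := Ioo_subset_Icc_self (mem_strip.1 hz)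
    simp only [hfs]
    rw [integral_const_mul, setIntegral_Ioo_deriv ht (f := fun s => G.u (z.1, z.2, s))
      (by fun_prop) (by fun_prop) (fun s hs => hG.deriv z.1 hx z.2 s hs), norm_mul]
    have h1 := hle z.1 hx z.2 t ⟨ht, le_rfl⟩
    have h2 := hle z.1 hx z.2 0 ⟨le_rfl, ht⟩
    refine (mul_le_of_le_one_left (norm_nonneg _) (ζabs _)).trans ((norm_sub_le _ _).trans ?_)
    rw [Real.norm_eq_abs, Real.norm_eq_abs]
    linarith
  -- Integrating in position first leaves the values at the two walls, weighted by `|v|`; no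
  -- boundary condition is needed, only the bound by `m`.
  have Bx : |∫ p, fx (p.1.1, p.1.2, p.2) ∂cylMeasure t| ≤ 2 * t * ∫ v, |v| * m v := by
    rw [cylMeasure] at ix ⊢
    rw [integral_prod_symm _ ix, ← Real.norm_eq_abs]
    refine (norm_integral_le_of_norm_le_const (C := 2 * ∫ v, |v| * m v) ?_).trans_eq ?_
    · filter_upwards [ae_restrict_mem measurableSet_Ioo] with s hs
      have hs' := Ioo_subset_Icc_self hs
      have i1 : Integrable (fun z : ℝ × ℝ => fx (z.1, z.2, s)) stripMeasure :=
        integrable_strip_of_band (by fun_prop) (R := 2 * R) fun z hz => zx _ hz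
      rw [stripMeasure_eq_prod] at i1 ⊢
      rw [integral_prod_symm _ i1, ← integral_const_mul]
      refine norm_integral_le_of_norm_le (hm1.const_mul 2) (.of_forall fun v => ?_)
      simp only [hfx]
      rw [integral_const_mul, integral_const_mul, setIntegral_Ioo_deriv zero_le_one
        (f := fun x => G.u (x, v, s)) (by fun_prop) (by fun_prop)
        (fun x _ => G.hasDerivAt_x x v s), norm_mul, norm_mul]
      refine (mul_le_of_le_one_left (by positivity) (ζabs _)).trans ?_
      have h1 := hle 1 (by simp) v s hs'
      have h2 := hle 0 (by simp) v s hs'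
      have h3 : ‖G.u (1, v, s) - G.u (0, v, s)‖ ≤ 2 * m v := by
        refine (norm_sub_le _ _).trans ?_
        rw [Real.norm_eq_abs, Real.norm_eq_abs]
        linarith
      refine (mul_le_mul_of_nonneg_left h3 (norm_nonneg _)).trans_eq ?_
      rw [Real.norm_eq_abs]
      ring
    · simp [Measure.real, ht]
      ring
  -- Two integrations by parts move both velocity derivatives onto the cutoff.
  have Bv : |∫ p, fv (p.1.1, p.1.2, p.2) ∂cylMeasure t| ≤ t * C * ∫ v, m v := by
    rw [cylMeasure] at iv ⊢
    rw [integral_prod_symm _ iv, ← Real.norm_eq_abs]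
    refine (norm_integral_le_of_norm_le_const (C := C * ∫ v, m v) ?_).trans_eq ?_
    · filter_upwards [ae_restrict_mem measurableSet_Ioo] with s hs
      have hs' := Ioo_subset_Icc_self hs
      have i1 : Integrable (fun z : ℝ × ℝ => fv (z.1, z.2, s)) stripMeasure :=
        integrable_strip_of_band (by fun_prop) (R := 2 * R) fun z hz => zv _ hz
      rw [stripMeasure_eq_prod] at i1 ⊢
      rw [integral_prod _ i1]
      refine (norm_integral_le_of_norm_le_const (C := C * ∫ v, m v) ?_).trans_eq (by simp)
      filter_upwards [ae_restrict_mem measurableSet_Ioo] with x hx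
      have hx' := Ioo_subset_Icc_self hx
      have int : ∀ {g : ℝ → ℝ}, Continuous g → (∀ v, 2 * R < |v| → g v = 0) → Integrable g := by
        intro g hg h0
        refine hg.integrable_of_hasCompactSupport (HasCompactSupport.intro
          (isCompact_Icc (a := -(2 * R)) (b := 2 * R)) fun v hv => h0 v ?_)
        by_contra hc
        exact hv (abs_le.1 (not_lt.1 hc))
      have p1 := integral_mul_deriv_eq_deriv_mul_of_integrable (u := ζ) (u' := ζ')
        (v := fun v => G.u₂ (x, v, s)) (v' := fun v => G.u₂₂ (x, v, s))
        (fun v _ => hζ.deriv v) (fun v _ => G.hasDerivAt_vv x v s)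
        (int (by fun_prop) fun v hv => by simp [hζ.eq_zero v hv])
        (int (by fun_prop) fun v hv => by simp [hζ.eq_zero' v hv])
        (int (by fun_prop) fun v hv => by simp [hζ.eq_zero v hv])
      have p2 := integral_mul_deriv_eq_deriv_mul_of_integrable (u := ζ') (u' := ζ'')
        (v := fun v => G.u (x, v, s)) (v' := fun v => G.u₂ (x, v, s))
        (fun v _ => hζ.deriv' v) (fun v _ => G.hasDerivAt_v x v s)
        (int (by fun_prop) fun v hv => by simp [hζ.eq_zero' v hv])
        (int (by fun_prop) fun v hv => by simp [hζ.eq_zero'' v hv])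
        (int (by fun_prop) fun v hv => by simp [hζ.eq_zero' v hv])
      simp only [hfv]
      rw [p1, p2, neg_neg, ← integral_const_mul]
      refine norm_integral_le_of_norm_le (hm.const_mul C) (.of_forall fun v => ?_)
      rw [norm_mul]
      exact mul_le_mul (hζ.bdd'' v) (hle x hx' v s hs') (norm_nonneg _) C0
    · simp [Measure.real, ht]
      ring
  have e : ∫ p, ζ p.1.2 * (d (p.1.1, p.1.2, p.2) + G.gen (p.1.1, p.1.2, p.2)) ∂cylMeasure t
      = (∫ p, fs (p.1.1, p.1.2, p.2) ∂cylMeasure t) + (∫ p, fx (p.1.1, p.1.2, p.2) ∂cylMeasure t)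
        + ∫ p, fv (p.1.1, p.1.2, p.2) ∂cylMeasure t := by
    have isx : Integrable (fun p : (ℝ × ℝ) × ℝ => fs (p.1.1, p.1.2, p.2) + fx (p.1.1, p.1.2, p.2))
      (cylMeasure t) := is.add ix
    rw [← integral_add is ix, ← integral_add isx iv]
    refine integral_congr_ae (.of_forall fun p => ?_)
    simp only [hfs, hfx, hfv, Field.gen]
    ring
  rw [e]
  refine (abs_add_le _ _).trans ?_
  have := abs_add_le (∫ p, fs (p.1.1, p.1.2, p.2) ∂cylMeasure t)
    (∫ p, fx (p.1.1, p.1.2, p.2) ∂cylMeasure t)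
  linarith

end FokkerPlanck

/-! ### Bump functions as data for the backward equation -/

namespace FokkerPlanck

open Filter Topology ProbabilityTheory

open scoped ContDiff in
lemma isC1b_of_contDiff {g : ℝ × ℝ → ℝ} (hg : ContDiff ℝ ∞ g) (hc : HasCompactSupport g) :
    IsC1b g (fun z => fderiv ℝ g z (1, 0)) (fun z => fderiv ℝ g z (0, 1)) := by
  have hd : ContDiff ℝ ∞ (fderiv ℝ g) := hg.fderiv_right (by simp)
  have k : ∀ e, Continuous (fun z => fderiv ℝ g z e) := fun e =>
    (hd.clm_apply contDiff_const).continuous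
  have b : ∀ e, ∃ C, ∀ z, |fderiv ℝ g z e| ≤ C := fun e =>
    (hc.fderiv_apply ℝ e).exists_bound_of_continuous (k e)
  refine ⟨hg.continuous, k _, k _, hc.exists_bound_of_continuous hg.continuous, b _, b _,
    fun z => ((hg.differentiable (by simp)) z).hasFDerivAt.congr_fderiv ?_⟩
  ext <;> simp

open scoped ContDiff in
lemma IsBump.exists_jet2 {φ : ℝ × ℝ → ℝ} (hφ : IsBump φ) : ∃ J : Jet2, J.f = φ := by
  have hd : ContDiff ℝ ∞ (fderiv ℝ φ) := hφ.smooth.fderiv_right (by simp)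
  have s : ∀ e, ContDiff ℝ ∞ fun z => fderiv ℝ φ z e := fun e => hd.clm_apply contDiff_const
  have c : ∀ e, HasCompactSupport fun z => fderiv ℝ φ z e := fun e => hφ.compact.fderiv_apply ℝ e
  -- A `Jet2` carries a single mixed derivative, so symmetry of second derivatives is needed.
  have sym : ∀ z, fderiv ℝ (fun z => fderiv ℝ φ z (0, 1)) z (1, 0)
      = fderiv ℝ (fun z => fderiv ℝ φ z (1, 0)) z (0, 1) := by
    intro z
    have h : IsSymmSndFDerivAt ℝ φ z := hφ.smooth.contDiffAt.isSymmSndFDerivAt (by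
      simp only [minSmoothness_of_isRCLikeNormedField]
      exact WithTop.coe_le_coe.2 (le_top : (2 : ℕ∞) ≤ ⊤))
    have e : ∀ a b, fderiv ℝ (fun z => fderiv ℝ φ z a) z b = fderiv ℝ (fderiv ℝ φ) z b a := by
      intro a b
      rw [fderiv_clm_apply (hd.differentiable (by simp) z) (differentiableAt_const a)]
      simp
    rw [e, e]
    exact h.eq _ _
  have h2 := isC1b_of_contDiff (s (0, 1)) (c (0, 1))
  simp only [sym] at h2
  exact ⟨⟨φ, _, _, _, _, _, isC1b_of_contDiff hφ.smooth hφ.compact,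
    isC1b_of_contDiff (s (1, 0)) (c (1, 0)), h2⟩, rfl⟩

lemma IsBump.exists_margin {φ : ℝ × ℝ → ℝ} (hφ : IsBump φ) :
    ∃ η > 0, ∀ z : ℝ × ℝ, z.1 ≤ η ∨ 1 - η ≤ z.1 → φ z = 0 := by
  obtain ⟨a, ha, h⟩ := hφ.compact.isCompact.exists_forall_le' (f := fun z : ℝ × ℝ => min z.1 (1 - z.1))
    (by fun_prop) (a := 0) fun z hz => by
      have := mem_strip.1 (hφ.supp hz)
      exact lt_min this.1 (by linarith [this.2])
  refine ⟨a / 2, by positivity, fun z hz => image_eq_zero_of_notMem_tsupport fun hm => ?_⟩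
  have h1 := le_min_iff.1 (h z hm)
  rcases hz with h2 | h2 <;> linarith [h1.1, h1.2]

/-! ### Test functions from fields -/

lemma Field.HasTime.isTest {t : ℝ} {F : Field} {d : ℝ × ℝ × ℝ → ℝ} (hF : F.HasTime t d) {R : ℝ}
    (hR : 0 < R) (h0 : ∀ p ∈ closedCyl t, R < |p.2.1| → F.u p = 0) : IsTest t F.u := by
  refine ⟨⟨F.cont.continuousOn, F.u₁, F.u₂, F.u₂₂, d, F.cont₁.continuousOn, F.cont₂.continuousOn,
    F.cont₂₂.continuousOn, hF.cont.continuousOn, fun x v s hp => ?_⟩, R, hR, h0⟩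
  have h := mem_cyl.1 hp
  exact ⟨F.hasDerivAt_x x v s, F.hasDerivAt_v x v s, F.hasDerivAt_vv x v s,
    hF.deriv x (Ioo_subset_Icc_self h.1) v s h.2⟩

lemma Field.HasTime.operator_eq {t : ℝ} {F : Field} {d : ℝ × ℝ × ℝ → ℝ} (hF : F.HasTime t d)
    {p : ℝ × ℝ × ℝ} (hp : p ∈ cyl t) :
    dt F.u p + p.2.1 * dx F.u p + dv (dv F.u) p = d p + F.gen p := by
  obtain ⟨x, v, s⟩ := p
  have h := mem_cyl.1 hp
  have e : dv F.u = F.u₂ := funext fun p => (F.hasDerivAt_v p.1 p.2.1 p.2.2).deriv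
  rw [e]
  have e1 : dt F.u (x, v, s) = d (x, v, s) :=
    (hF.deriv x (Ioo_subset_Icc_self h.1) v s h.2).deriv
  have e2 : dx F.u (x, v, s) = F.u₁ (x, v, s) := (F.hasDerivAt_x x v s).deriv
  have e3 : dv F.u₂ (x, v, s) = F.u₂₂ (x, v, s) := (F.hasDerivAt_vv x v s).deriv
  rw [e1, e2, e3, Field.gen]
  ring

/-! ### Correction at the corners -/

/-- A function of position times a function of velocity. -/
def Field.tensor {X X' V V' V'' : ℝ → ℝ} (hX : ∀ x, HasDerivAt X (X' x) x) (cX' : Continuous X')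
    (hV : ∀ x, HasDerivAt V (V' x) x) (hV' : ∀ x, HasDerivAt V' (V'' x) x) (cV'' : Continuous V'') :
    Field :=
  have cX : Continuous X := continuous_iff_continuousAt.2 fun x => (hX x).continuousAt
  have cV : Continuous V := continuous_iff_continuousAt.2 fun x => (hV x).continuousAt
  have cV' : Continuous V' := continuous_iff_continuousAt.2 fun x => (hV' x).continuousAt
  { u := fun p => X p.1 * V p.2.1
    u₁ := fun p => X' p.1 * V p.2.1
    u₂ := fun p => X p.1 * V' p.2.1
    u₂₂ := fun p => X p.1 * V'' p.2.1
    cont := by fun_prop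
    cont₁ := by fun_prop
    cont₂ := by fun_prop
    cont₂₂ := by fun_prop
    hasDerivAt_x := fun x v _ => (hX x).mul_const (V v)
    hasDerivAt_v := fun x v _ => (hV v).const_mul (X x)
    hasDerivAt_vv := fun x v _ => (hV' v).const_mul (X x) }

/-- A correction which is large at the corners and has a small generator. -/
structure Field.IsCorner (M C δ : ℝ) (W : Field) (ℓ : ℝ × ℝ → ℝ) : Prop where
  const : ∀ x v s, W.u (x, v, s) = W.u (x, v, 0)
  nonneg : ∀ p, 0 ≤ W.u p
  le : ∀ p, W.u p ≤ 2 * M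
  zero : ∀ p, 2 * δ < |p.2.1| → W.u p = 0
  wall : ∀ σ c, IsWall σ c → ∀ v s, |v| ≤ δ → M ≤ W.u (c, v, s)
  integrable : Integrable ℓ stripMeasure
  gen_le : ∀ p, |W.gen p| ≤ ℓ (p.1, p.2.1)
  integral_le : ∫ z, ℓ z ∂stripMeasure ≤ C * δ

/-- A product of plateaus of width `δ³` around the walls and `δ` in velocity, of height `M`. Its
generator is `O(δ⁻²)` on a set of area `O(δ⁴)`, so its integral is `O(δ²)`; the weaker `O(δ)`
suffices. -/
lemma exists_isCorner {M : ℝ} (hM : 0 ≤ M) :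
    ∃ C, ∀ δ, 0 < δ → δ ≤ 1 → ∃ W ℓ, Field.IsCorner M C δ W ℓ := by
  obtain ⟨C, b, b', b'', hb⟩ := exists_isPlateau
  have C0 : 0 ≤ C := (abs_nonneg _).trans (hb.bdd' 0)
  refine ⟨192 * M * C, fun δ hδ hδ1 => ?_⟩
  -- The kinetic scaling: `v ∂ₓ` has size `δ / ρ` and `∂ᵥᵥ` size `δ⁻²`, which agree for `ρ = δ³`.
  set ρ := δ ^ 3 with hρ
  have ρ0 : 0 < ρ := by positivity
  have cb' : Continuous b' := continuous_iff_continuousAt.2 fun x => (hb.deriv' x).continuousAt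
  have cb'' := hb.cont''
  have d : ∀ a c v : ℝ, HasDerivAt (fun v : ℝ => (v - c) / a) (1 / a) v := fun a c v =>
    ((hasDerivAt_id v).sub_const c).div_const a
  have far : ∀ {a c : ℝ}, 0 < a → ∀ v, 2 * a < |v - c| → 2 < |(v - c) / a| := fun {a c} ha v hv => by
    rw [abs_div, abs_of_pos ha, lt_div_iff₀ ha]
    exact hv
  set X : ℝ → ℝ := fun x => M * (b ((x - 0) / ρ) + b ((x - 1) / ρ)) with hX
  set X' : ℝ → ℝ := fun x => M * (b' ((x - 0) / ρ) * (1 / ρ) + b' ((x - 1) / ρ) * (1 / ρ)) with hX'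
  set V : ℝ → ℝ := fun v => b ((v - 0) / δ) with hV
  set V' : ℝ → ℝ := fun v => b' ((v - 0) / δ) * (1 / δ) with hV'
  set V'' : ℝ → ℝ := fun v => b'' ((v - 0) / δ) * (1 / δ) * (1 / δ) with hV''
  have dX : ∀ x, HasDerivAt X (X' x) x := fun x =>
    (((hb.deriv _).comp x (d ρ 0 x)).add ((hb.deriv _).comp x (d ρ 1 x))).const_mul M
  have dV : ∀ x, HasDerivAt V (V' x) x := fun x => (hb.deriv _).comp x (d δ 0 x)
  have dV' : ∀ x, HasDerivAt V' (V'' x) x := fun x =>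
    ((hb.deriv' _).comp x (d δ 0 x)).mul_const (1 / δ)
  set W : Field := Field.tensor dX (by fun_prop) dV dV' (by fun_prop) with hW
  set A : Set ℝ := Icc (-(2 * ρ)) (2 * ρ) ∪ Icc (1 - 2 * ρ) (1 + 2 * ρ) with hA
  set S : Set (ℝ × ℝ) := A ×ˢ Icc (-(2 * δ)) (2 * δ) with hS
  have mS : MeasurableSet S := (measurableSet_Icc.union measurableSet_Icc).prod measurableSet_Icc
  have vS : volume S ≤ ENNReal.ofReal (8 * ρ * (4 * δ)) := by
    rw [hS, Measure.volume_eq_prod, Measure.prod_prod, ENNReal.ofReal_mul (by positivity)]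
    refine mul_le_mul' ((measure_union_le _ _).trans ?_) ?_
    · rw [Real.volume_Icc, Real.volume_Icc, ← ENNReal.ofReal_add (by linarith) (by linarith)]
      exact ENNReal.ofReal_le_ofReal (by linarith)
    · rw [Real.volume_Icc]
      exact ENNReal.ofReal_le_ofReal (by linarith)
  have sS : stripMeasure S ≤ ENNReal.ofReal (8 * ρ * (4 * δ)) :=
    (Measure.restrict_apply_le _ _).trans vS
  have fS : stripMeasure S ≠ ⊤ := (sS.trans_lt ENNReal.ofReal_lt_top).ne
  have V1 : ∀ v, |V v| ≤ 1 := fun v => by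
    rw [abs_of_nonneg (hb.nonneg _)]
    exact hb.le_one _
  have X1 : ∀ x, 0 ≤ X x ∧ X x ≤ 2 * M := fun x => by
    have h1 := hb.nonneg ((x - 0) / ρ)
    have h2 := hb.nonneg ((x - 1) / ρ)
    have h3 := hb.le_one ((x - 0) / ρ)
    have h4 := hb.le_one ((x - 1) / ρ)
    constructor
    · simp only [hX]; positivity
    · simp only [hX]; nlinarith
  have V0 : ∀ v, 2 * δ < |v| → V v = 0 := fun v hv =>
    hb.eq_zero _ (far hδ v (by rwa [sub_zero]))
  refine ⟨W, S.indicator fun _ => 6 * M * C / δ ^ 2, ⟨fun x v s => rfl,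
    fun p => mul_nonneg (X1 _).1 (hb.nonneg _), fun p => ?_, fun p hp => ?_, fun σ c hc v s hv => ?_,
    ?_, fun p => ?_, ?_⟩⟩
  · exact (mul_le_of_le_one_right (X1 _).1 (hb.le_one _)).trans (X1 _).2
  · change X p.1 * V p.2.1 = 0
    rw [V0 _ hp, mul_zero]
  · change M ≤ X c * V v
    have hV1 : V v = 1 := by
      refine hb.eq_one _ ?_
      rw [sub_zero, abs_div, abs_of_pos hδ, div_le_one hδ]
      exact hv
    rw [hV1, mul_one]
    have h1 := hb.nonneg ((c - 0) / ρ)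
    have h2 := hb.nonneg ((c - 1) / ρ)
    have b0 : b 0 = 1 := hb.eq_one 0 (by simp)
    rcases hc with ⟨-, rfl⟩ | ⟨-, rfl⟩
    · simp only [hX]
      rw [sub_self, zero_div, b0]
      nlinarith
    · simp only [hX]
      rw [sub_self, zero_div, b0]
      nlinarith
  · rw [integrable_indicator_iff mS]
    exact integrableOn_const fS
  · change |p.2.1 * (X' p.1 * V p.2.1) + X p.1 * V'' p.2.1| ≤ _
    by_cases hp : (p.1, p.2.1) ∈ S
    · rw [indicator_of_mem hp]
      have hv : |p.2.1| ≤ 2 * δ := abs_le.2 hp.2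
      have hX'1 : |X' p.1| ≤ 2 * M * C / ρ := by
        simp only [hX']
        rw [← add_mul, abs_mul, abs_mul, abs_of_nonneg hM, abs_of_nonneg (by positivity : 0 ≤ 1 / ρ)]
        have : |b' ((p.1 - 0) / ρ) + b' ((p.1 - 1) / ρ)| ≤ C + C :=
          (abs_add_le _ _).trans (add_le_add (hb.bdd' _) (hb.bdd' _))
        calc M * (|b' ((p.1 - 0) / ρ) + b' ((p.1 - 1) / ρ)| * (1 / ρ))
            ≤ M * ((C + C) * (1 / ρ)) := by gcongr
          _ = _ := by ring
      have hV2 : |V'' p.2.1| ≤ C / δ ^ 2 := by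
        simp only [hV'']
        rw [abs_mul, abs_mul, abs_of_nonneg (by positivity : 0 ≤ 1 / δ)]
        calc |b'' ((p.2.1 - 0) / δ)| * (1 / δ) * (1 / δ) ≤ C * (1 / δ) * (1 / δ) := by
              gcongr
              exact hb.bdd'' _
          _ = _ := by field_simp
      refine (abs_add_le _ _).trans ?_
      rw [abs_mul p.2.1, abs_mul (X' p.1), abs_mul (X p.1), abs_of_nonneg (X1 p.1).1]
      calc |p.2.1| * (|X' p.1| * |V p.2.1|) + X p.1 * |V'' p.2.1|
          ≤ 2 * δ * (2 * M * C / ρ * 1) + 2 * M * (C / δ ^ 2) := by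
            gcongr
            · exact V1 _
            · exact (X1 _).2
        _ = 6 * M * C / δ ^ 2 := by
            rw [hρ]
            field_simp
            ring
    · rw [indicator_of_notMem hp]
      refine le_of_eq (abs_eq_zero.2 ?_)
      by_cases hv : 2 * δ < |p.2.1|
      · rw [V0 _ hv]
        have : V'' p.2.1 = 0 := by
          simp only [hV'']
          rw [hb.eq_zero'' _ (far hδ _ (by rwa [sub_zero]))]
          ring
        rw [this]
        ring
      · have hv' : p.2.1 ∈ Icc (-(2 * δ)) (2 * δ) := abs_le.1 (not_lt.1 hv)
        have hx : p.1 ∉ A := fun h => hp ⟨h, hv'⟩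
        have hx0 : 2 * ρ < |p.1 - 0| := by
          by_contra h
          refine hx (Or.inl ?_)
          rw [not_lt, sub_zero] at h
          exact abs_le.1 h
        have hx1 : 2 * ρ < |p.1 - 1| := by
          by_contra h
          refine hx (Or.inr ?_)
          have := abs_le.1 (not_lt.1 h)
          exact ⟨by linarith [this.1], by linarith [this.2]⟩
        have e1 : X p.1 = 0 := by
          simp only [hX]
          rw [hb.eq_zero _ (far ρ0 _ hx0), hb.eq_zero _ (far ρ0 _ hx1)]
          ring
        have e2 : X' p.1 = 0 := by
          simp only [hX']
          rw [hb.eq_zero' _ (far ρ0 _ hx0), hb.eq_zero' _ (far ρ0 _ hx1)]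
          ring
        rw [e1, e2]
        ring
  · rw [integral_indicator_const _ mS, smul_eq_mul]
    have h1 : stripMeasure.real S ≤ 8 * ρ * (4 * δ) :=
      ENNReal.toReal_le_of_le_ofReal (by positivity) sS
    calc stripMeasure.real S * (6 * M * C / δ ^ 2) ≤ 8 * ρ * (4 * δ) * (6 * M * C / δ ^ 2) := by
          gcongr
      _ = 192 * M * C * δ * δ := by
          rw [hρ]
          field_simp
          ring
      _ ≤ 192 * M * C * δ := mul_le_of_le_one_right (by positivity) hδ1

end FokkerPlanck

namespace FokkerPlanck

open Filter Topology ProbabilityTheory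

/-! ### The envelope of the truncation error -/

/-- A function of velocity of size `δ` in mass. -/
noncomputable def envelope (a c δ v : ℝ) : ℝ :=
  a * δ * Real.exp (-|v| / 2) + (Icc (-(2 * δ)) (2 * δ)).indicator (fun _ => c) v

lemma exp_neg_abs_le (v : ℝ) : (1 + |v|) * Real.exp (-|v| / 2) ≤ 4096 * (1 + v ^ 2)⁻¹ := by
  set y := |v| with hy
  have y0 : 0 ≤ y := abs_nonneg v
  have e1 : v ^ 2 = y ^ 2 := (sq_abs v).symm
  have h1 : 1 + y / 8 ≤ Real.exp (y / 8) := by linarith [Real.add_one_le_exp (y / 8)]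
  have h2 : (1 + y / 8) ^ 4 ≤ Real.exp (y / 2) := by
    have : Real.exp (y / 2) = Real.exp (y / 8) ^ 4 := by
      rw [← Real.exp_nat_mul]
      congr 1
      push_cast
      ring
    rw [this]
    gcongr
  have h3 : -y / 2 = -(y / 2) := by ring
  rw [h3, Real.exp_neg, e1, ← div_eq_mul_inv, ← div_eq_mul_inv,
    div_le_div_iff₀ (Real.exp_pos _) (by positivity)]
  have : (1 + y) * (1 + y ^ 2) ≤ 4096 * (1 + y / 8) ^ 4 := by
    nlinarith [pow_nonneg y0 2, pow_nonneg y0 3, pow_nonneg y0 4]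
  linarith

lemma integrable_exp_neg_abs : Integrable (fun v : ℝ => (1 + |v|) * Real.exp (-|v| / 2)) :=
  (integrable_inv_one_add_sq.const_mul 4096).mono' (by fun_prop) (.of_forall fun v => by
    rw [Real.norm_eq_abs, abs_of_nonneg (by positivity)]
    exact exp_neg_abs_le v)

lemma envelope_nonneg {a c δ : ℝ} (ha : 0 ≤ a) (hc : 0 ≤ c) (hδ : 0 ≤ δ) (v : ℝ) :
    0 ≤ envelope a c δ v :=
  add_nonneg (by positivity) (indicator_nonneg (fun _ _ => hc) v)

lemma measurable_envelope (a c δ : ℝ) : Measurable (envelope a c δ) :=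
  (by fun_prop : Measurable fun v => a * δ * Real.exp (-|v| / 2)).add
    (measurable_const.indicator measurableSet_Icc)

/-- The exponential part carries a factor `δ`, the indicator a support of length `4δ`; on that
support `1 + |v| ≤ 3`, so one majorant `B` serves the mass and the first moment. -/
lemma envelope_bounds {a c : ℝ} (ha : 0 ≤ a) (hc : 0 ≤ c) : ∃ E, 0 ≤ E ∧ ∀ δ, 0 < δ → δ ≤ 1 →
    Integrable (envelope a c δ) ∧ Integrable (fun v => |v| * envelope a c δ v) ∧
    ∫ v, envelope a c δ v ≤ E * δ ∧ ∫ v, |v| * envelope a c δ v ≤ E * δ := by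
  set E₀ := ∫ v : ℝ, (1 + |v|) * Real.exp (-|v| / 2) with hE
  have E0 : 0 ≤ E₀ := integral_nonneg fun v => by positivity
  refine ⟨a * E₀ + 12 * c, by positivity, fun δ hδ hδ1 => ?_⟩
  set B : ℝ → ℝ := fun v => a * δ * ((1 + |v|) * Real.exp (-|v| / 2))
    + (Icc (-(2 * δ)) (2 * δ)).indicator (fun _ => 3 * c) v with hB
  have i2 : Integrable ((Icc (-(2 * δ)) (2 * δ)).indicator fun _ : ℝ => 3 * c) := by
    rw [integrable_indicator_iff measurableSet_Icc]
    exact integrableOn_const (by simp)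
  have i1 := integrable_exp_neg_abs.const_mul (a * δ)
  have iB : Integrable B := i1.add i2
  have eB : ∫ v, B v = (a * E₀ + 12 * c) * δ := by
    rw [hB, integral_add i1 i2, integral_const_mul, integral_indicator_const _ measurableSet_Icc,
      ← hE]
    simp only [Measure.real, Real.volume_Icc, smul_eq_mul]
    rw [ENNReal.toReal_ofReal (by linarith)]
    ring
  have key : ∀ w v : ℝ, 0 ≤ w → w ≤ 1 + |v| → w * envelope a c δ v ≤ B v := by
    intro w v hw hwv
    simp only [hB, envelope]
    rw [mul_add]
    refine add_le_add ?_ ?_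
    · calc w * (a * δ * Real.exp (-|v| / 2)) ≤ (1 + |v|) * (a * δ * Real.exp (-|v| / 2)) := by
            gcongr
        _ = _ := by ring
    · by_cases hv : v ∈ Icc (-(2 * δ)) (2 * δ)
      · rw [indicator_of_mem hv, indicator_of_mem hv]
        have : |v| ≤ 2 * δ := abs_le.2 hv
        exact mul_le_mul_of_nonneg_right (by linarith) hc
      · rw [indicator_of_notMem hv, indicator_of_notMem hv, mul_zero]
  have k0 : ∀ v, envelope a c δ v ≤ B v := fun v => by
    simpa using key 1 v zero_le_one (by linarith [abs_nonneg v])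
  have k1 : ∀ v, |v| * envelope a c δ v ≤ B v := fun v =>
    key |v| v (abs_nonneg v) (by linarith)
  have n0 := envelope_nonneg ha hc hδ.le
  have j0 : Integrable (envelope a c δ) :=
    iB.mono' (measurable_envelope a c δ).aestronglyMeasurable (.of_forall fun v => by
      rw [Real.norm_eq_abs, abs_of_nonneg (n0 v)]
      exact k0 v)
  have j1 : Integrable fun v => |v| * envelope a c δ v :=
    iB.mono' ((measurable_id.abs.mul (measurable_envelope a c δ)).aestronglyMeasurable)
      (.of_forall fun v => by
        rw [Real.norm_eq_abs, abs_of_nonneg (mul_nonneg (abs_nonneg v) (n0 v))]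
        exact k1 v)
  exact ⟨j0, j1, (integral_mono j0 iB k0).trans_eq eB, (integral_mono j1 iB k1).trans_eq eB⟩

/-! ### The test function -/

/-- Test functions adapted to a solution of the backward equation. -/
lemma Field.Solves.exists_test {t M K C C' δ : ℝ} (ht : 0 < t) (hδ : 0 < δ)
    (hM : 0 ≤ M) (hK : 0 ≤ K) {F W : Field} (hF : F.Solves t) (hk : F.IsKilled M K δ (δ ^ 2) t)
    {ℓ : ℝ × ℝ → ℝ} (hW : W.IsCorner M C δ ℓ) {b b' b'' : ℝ → ℝ} (hb : IsPlateau C' b b' b'')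
    {m : ℝ → ℝ} (hm : m = envelope √(3 * (K * Real.exp t)) (2 * M) δ) (im : Integrable m)
    (im1 : Integrable fun v => |v| * m v) :
    ∃ (Ψ : Field) (d : ℝ × ℝ × ℝ → ℝ) (Q : (ℝ × ℝ) × ℝ → ℝ), Ψ.HasTime t d ∧ IsTest t Ψ.u ∧
      (∀ p ∈ outgoing t, Ψ.u p = 0) ∧ Integrable Q (cylMeasure t) ∧
      (∀ᵐ p ∂cylMeasure t,
        |d (p.1.1, p.1.2, p.2) + Ψ.gen (p.1.1, p.1.2, p.2)| ≤ Q p) ∧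
      ∫ p, Q p ∂cylMeasure t
        ≤ 2 * t * (C * δ) + ((2 + t * C') * (∫ v, m v) + 2 * t * ∫ v, |v| * m v) ∧
      ∀ x ∈ Icc (0 : ℝ) 1, ∀ v, |F.u (x, v, 0) - Ψ.u (x, v, t)| ≤ 2 * m v := by
  obtain ⟨β, β', β'', hβ⟩ := exists_isTrunc (κ := δ ^ 2) (by positivity)
  set K' := K * Real.exp t with hK'
  have K'0 : 0 ≤ K' := by positivity
  have m0 : ∀ v, 0 ≤ m v := fun v => by
    rw [hm]
    exact envelope_nonneg (Real.sqrt_nonneg _) (by positivity) hδ.le v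
  -- Time reversal turns the solution `F` into a null function of `∂ₛ + v ∂ₓ + ∂ᵥᵥ`, so only the
  -- generator of `W` remains.
  set Z := F.reverseSub t W with hZ
  set dZ : ℝ × ℝ × ℝ → ℝ := fun p => -F.gen (p.1, p.2.1, t - p.2.2) with hdZ
  have tZ : Z.HasTime t dZ := hF.hasTime_reverseSub hW.const
  have LZ : ∀ p, dZ p + Z.gen p = -W.gen p := fun p => by
    simp only [hdZ, hZ, Field.gen, Field.reverseSub]
    ring
  have hγ : ∀ z, HasDerivAt (fun z => z - β z) (1 - β' z) z := fun z =>
    (hasDerivAt_id z).sub (hβ.deriv z)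
  have hγ' : ∀ z, HasDerivAt (fun z => 1 - β' z) (-β'' z) z := fun z => (hβ.deriv' z).const_sub 1
  set Ψ := Z.comp β β' β'' hβ.deriv hβ.deriv' hβ.cont'' with hΨ
  -- The part removed by truncation. The operator applied to it contains `-β''(Z) Z_v²`, the
  -- opposite of the uncontrolled term of the test function.
  set Γ := Z.comp _ _ _ hγ hγ' hβ.cont''.neg with hΓ
  have tΨ := tZ.comp hβ.deriv hβ.deriv' hβ.cont''
  have tΓ := tZ.comp hγ hγ' hβ.cont''.neg
  have LΨ : ∀ p, β' (Z.u p) * dZ p + Ψ.gen p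
      = -(β' (Z.u p) * W.gen p) + β'' (Z.u p) * Z.u₂ p ^ 2 := fun p => by
    have := LZ p
    simp only [hΨ, Field.gen, Field.comp] at this ⊢
    linear_combination β' (Z.u p) * this
  have LΓ : ∀ p, (1 - β' (Z.u p)) * dZ p + Γ.gen p
      = -((1 - β' (Z.u p)) * W.gen p) - β'' (Z.u p) * Z.u₂ p ^ 2 := fun p => by
    have := LZ p
    simp only [hΓ, Field.gen, Field.comp] at this ⊢
    linear_combination (1 - β' (Z.u p)) * this
  have decay : ∀ x ∈ Icc (0 : ℝ) 1, ∀ v, ∀ r ∈ Icc 0 t,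
      F.u (x, v, r) ≤ K' * Real.exp (-|v|) := by
    intro x hx v r hr
    have hσ : ∃ σ : ℝ, (σ = 1 ∨ σ = -1) ∧ σ * v = -|v| := by
      rcases le_total 0 v with h | h
      · exact ⟨-1, Or.inr rfl, by rw [abs_of_nonneg h]; ring⟩
      · exact ⟨1, Or.inl rfl, by rw [abs_of_nonpos h]; ring⟩
    obtain ⟨σ, h1, h2⟩ := hσ
    have := hk.le_exp σ h1 x hx v r hr
    rw [h2] at this
    refine this.trans ?_
    rw [hK']
    gcongr
    exact hr.2
  have Wle : ∀ p, W.u p ≤ m p.2.1 := by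
    intro p
    rw [hm, envelope]
    have h0 : 0 ≤ √(3 * K') * δ * Real.exp (-|p.2.1| / 2) := by positivity
    by_cases hp : p.2.1 ∈ Icc (-(2 * δ)) (2 * δ)
    · rw [indicator_of_mem hp]
      linarith [hW.le p]
    · rw [indicator_of_notMem hp, hW.zero p (not_le.1 fun h => hp (abs_le.1 h))]
      linarith
  have γle : ∀ x ∈ Icc (0 : ℝ) 1, ∀ v, ∀ s ∈ Icc 0 t, |Γ.u (x, v, s)| ≤ m v := by
    intro x hx v s hs
    have hs' : t - s ∈ Icc 0 t := ⟨by linarith [hs.2], by linarith [hs.1]⟩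
    change |Z.u (x, v, s) - β (Z.u (x, v, s))| ≤ m v
    have hZe : Z.u (x, v, s) = F.u (x, v, t - s) - W.u (x, v, s) := rfl
    rcases le_total 0 (Z.u (x, v, s)) with h | h
    · have h1 := hβ.le _ h
      have h2 := hβ.sub_le _ h
      have h3 := hβ.nonneg (Z.u (x, v, s))
      have h4 : Z.u (x, v, s) ≤ K' * Real.exp (-|v|) := by
        rw [hZe]
        linarith [decay x hx v _ hs', hW.nonneg (x, v, s)]
      -- The removed part is at most `3δ²` and at most `K' exp (-|v|)`; the geometric mean of the
      -- two is both small and integrable in `v`.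
      have h5 : |Z.u (x, v, s) - β (Z.u (x, v, s))| ≤ √(3 * K') * δ * Real.exp (-|v| / 2) := by
        refine abs_le_of_sq_le_sq ?_ (by positivity)
        have e1 : Real.exp (-|v| / 2) ^ 2 = Real.exp (-|v|) := by
          rw [← Real.exp_nat_mul]
          congr 1
          push_cast
          ring
        have e2 : √(3 * K') ^ 2 = 3 * K' := Real.sq_sqrt (by positivity)
        rw [mul_pow, mul_pow, e1, e2]
        calc (Z.u (x, v, s) - β (Z.u (x, v, s))) ^ 2
            = (Z.u (x, v, s) - β (Z.u (x, v, s))) * (Z.u (x, v, s) - β (Z.u (x, v, s))) := by ring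
          _ ≤ (3 * δ ^ 2) * (K' * Real.exp (-|v|)) :=
              mul_le_mul h2 (by linarith) (by linarith) (by positivity)
          _ = _ := by ring
      refine h5.trans ?_
      rw [hm, envelope]
      linarith [indicator_nonneg (s := Icc (-(2 * δ)) (2 * δ)) (f := fun _ => 2 * M)
        (fun _ _ => by positivity) v]
    · rw [hβ.eq_zero _ (h.trans (by positivity)), sub_zero, abs_of_nonpos h, hZe]
      linarith [hk.nonneg x hx v _ hs', Wle (x, v, s)]
  -- Beyond `K' / δ²` the decay makes `Z ≤ δ²`, so the truncation also produces compact velocity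
  -- support.
  set R : ℝ := max (max 1 (2 * δ)) (K' / δ ^ 2) with hR
  have R1 : 1 ≤ R := (le_max_left _ _).trans (le_max_left _ _)
  have R2 : 2 * δ ≤ R := (le_max_right _ _).trans (le_max_left _ _)
  have small : ∀ x ∈ Icc (0 : ℝ) 1, ∀ v, R < |v| → ∀ s ∈ Icc 0 t, Z.u (x, v, s) ≤ δ ^ 2 := by
    intro x hx v hv s hs
    have hs' : t - s ∈ Icc 0 t := ⟨by linarith [hs.2], by linarith [hs.1]⟩
    have hZe : Z.u (x, v, s) = F.u (x, v, t - s) - W.u (x, v, s) := rfl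
    have h1 := decay x hx v _ hs'
    have h2 := hW.nonneg (x, v, s)
    have h3 : K' / δ ^ 2 < |v| := (le_max_right _ _).trans_lt hv
    have h4 : K' * Real.exp (-|v|) ≤ δ ^ 2 := by
      rw [Real.exp_neg, ← div_eq_mul_inv, div_le_iff₀ (Real.exp_pos _)]
      rw [div_lt_iff₀ (by positivity)] at h3
      have h5 : |v| ≤ Real.exp |v| := by linarith [Real.add_one_le_exp |v|]
      nlinarith [mul_le_mul_of_nonneg_left h5 (sq_nonneg δ)]
    linarith
  have hζ := hb.velCutoff R1
  set ζ : ℝ → ℝ := fun v => b (v / R) with hζd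
  have cζ : Continuous ζ := continuous_iff_continuousAt.2 fun x => (hζ.deriv x).continuousAt
  have cβ' : Continuous β' := continuous_iff_continuousAt.2 fun x => (hβ.deriv' x).continuousAt
  have cβ'' := hβ.cont''
  have cZ := Z.cont
  have cZ₂ := Z.cont₂
  have cW := W.continuous_gen
  have cdΓ := tΓ.cont
  have cΓ := Γ.continuous_gen
  set q : ℝ × ℝ × ℝ → ℝ := fun p => ζ p.2.1 * (β'' (Z.u p) * Z.u₂ p ^ 2) with hq
  set w : ℝ × ℝ × ℝ → ℝ := fun p => ζ p.2.1 * (-((1 - β' (Z.u p)) * W.gen p)) with hw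
  set g : ℝ × ℝ × ℝ → ℝ := fun p => ζ p.2.1 * ((1 - β' (Z.u p)) * dZ p + Γ.gen p) with hg
  have cq : Continuous q := by fun_prop
  have cw : Continuous w := by fun_prop
  have cg : Continuous g := by fun_prop
  have iq := integrable_cyl_of_band cq (R := 2 * R) (fun p hp => by simp [hq, hζ.eq_zero _ hp]) t
  have iw := integrable_cyl_of_band cw (R := 2 * R) (fun p hp => by simp [hw, hζ.eq_zero _ hp]) t
  have ig := integrable_cyl_of_band cg (R := 2 * R) (fun p hp => by simp [hg, hζ.eq_zero _ hp]) t
  have iℓ : Integrable (fun p : (ℝ × ℝ) × ℝ => ℓ p.1) (cylMeasure t) := hW.integrable.comp_fst _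
  have eℓ : ∫ p, ℓ p.1 ∂cylMeasure t ≤ t * (C * δ) := by
    rw [cylMeasure, integral_fun_fst]
    simp only [Measure.real, Measure.restrict_apply_univ, Real.volume_Ioo, sub_zero, smul_eq_mul]
    rw [ENNReal.toReal_ofReal ht.le]
    exact mul_le_mul_of_nonneg_left hW.integral_le ht.le
  have qwg : ∀ p, q p = w p - g p := fun p => by
    simp only [hq, hw, hg]
    linear_combination ζ p.2.1 * LΓ p
  -- Integrating the equation of the removed part bounds the integral of `ζ β''(Z) Z_v²` by the
  -- envelope and the generator of `W`, without any estimate on `Z_v`.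
  have green := tΓ.abs_integral_le ht.le im im1 γle hζ
  refine ⟨Ψ, fun p => β' (Z.u p) * dZ p, fun p => ℓ p.1 + q (p.1.1, p.1.2, p.2), tΨ,
    tΨ.isTest (R := R) (by linarith) fun p hp hv => ?_, fun p hp => ?_, iℓ.add iq, ?_, ?_,
    fun x hx v => ?_⟩
  · obtain ⟨x, v, s⟩ := p
    have h := mem_closedCyl.1 hp
    exact hβ.eq_zero _ (small x h.1 v hv s h.2)
  · obtain ⟨x, v, s⟩ := p
    have hw : ∃ σ, IsWall σ x ∧ σ * v < 0 ∧ s ∈ Ioo 0 t := by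
      rcases hp with ⟨h1, h2, h3⟩ | ⟨h1, h2, h3⟩
      · exact ⟨1, Or.inl ⟨rfl, h1⟩, by rw [one_mul]; exact h2, h3⟩
      · exact ⟨-1, Or.inr ⟨rfl, h1⟩, by simpa using h2, h3⟩
    obtain ⟨σ, h1, h2, h3⟩ := hw
    have hs' : t - s ∈ Icc 0 t := ⟨by linarith [h3.2], by linarith [h3.1]⟩
    refine hβ.eq_zero _ ?_
    change F.u (x, v, t - s) - W.u (x, v, s) ≤ δ ^ 2
    -- On the outgoing wall, near the corner `F ≤ M ≤ W`; away from it the killed evolution is at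
    -- most `δ²`. Either way `β(Z) = 0`.
    by_cases hv : |v| ≤ δ
    · have := hk.le x h1.mem_Icc v _ hs'
      have := hW.wall σ x h1 v s hv
      have : 0 < δ ^ 2 := by positivity
      linarith
    · have h4 : σ * v ≤ -δ := by
        have : |v| = -(σ * v) := by
          rcases h1.sign with rfl | rfl
          · rw [one_mul] at h2 ⊢
            exact abs_of_neg h2
          · rw [abs_of_pos (by linarith)]
            ring
        linarith
      have := hk.wall σ x h1 v h4 _ hs'
      linarith [hW.nonneg (x, v, s)]
  · filter_upwards [ae_mem_cyl t] with p hp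
    rw [LΨ]
    have h := mem_cyl.1 hp
    refine (abs_add_le _ _).trans (add_le_add ?_ ?_)
    · rw [abs_neg, abs_mul, abs_of_nonneg (hβ.nonneg' _)]
      exact (mul_le_of_le_one_left (abs_nonneg _) (hβ.le_one' _)).trans (hW.gen_le _)
    · rw [abs_of_nonneg (mul_nonneg (hβ.nonneg'' _) (sq_nonneg _))]
      simp only [hq]
      by_cases hv : |p.1.2| ≤ R
      · rw [hζ.eq_one _ hv, one_mul]
      · rw [hβ.eq_zero'' _ (small p.1.1 (Ioo_subset_Icc_self h.1) p.1.2 (not_le.1 hv) p.2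
          (Ioo_subset_Icc_self h.2))]
        simp
  · rw [integral_add iℓ iq]
    have e1 : ∫ p, q (p.1.1, p.1.2, p.2) ∂cylMeasure t
        = (∫ p, w (p.1.1, p.1.2, p.2) ∂cylMeasure t)
          - ∫ p, g (p.1.1, p.1.2, p.2) ∂cylMeasure t := by
      rw [← integral_sub iw ig]
      exact integral_congr_ae (.of_forall fun p => qwg _)
    have e2 : ∫ p, w (p.1.1, p.1.2, p.2) ∂cylMeasure t ≤ ∫ p, ℓ p.1 ∂cylMeasure t := by
      refine integral_mono iw iℓ fun p => (le_abs_self _).trans ?_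
      simp only [hw]
      rw [abs_mul, abs_neg, abs_mul, abs_of_nonneg (hζ.nonneg _),
        abs_of_nonneg (by linarith [hβ.le_one' (Z.u (p.1.1, p.1.2, p.2))] :
          0 ≤ 1 - β' (Z.u (p.1.1, p.1.2, p.2)))]
      refine (mul_le_of_le_one_left (mul_nonneg ?_ (abs_nonneg _)) (hζ.le_one _)).trans
        ((mul_le_of_le_one_left (abs_nonneg _) ?_).trans (hW.gen_le _))
      · linarith [hβ.le_one' (Z.u (p.1.1, p.1.2, p.2))]
      · linarith [hβ.nonneg' (Z.u (p.1.1, p.1.2, p.2))]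
    have e3 : -∫ p, g (p.1.1, p.1.2, p.2) ∂cylMeasure t
        ≤ (2 + t * C') * (∫ v, m v) + 2 * t * ∫ v, |v| * m v :=
      (neg_le_abs _).trans green
    rw [e1]
    linarith
  · have h1 := γle x hx v t ⟨ht.le, le_rfl⟩
    have h2 := hW.nonneg (x, v, t)
    have h3 := Wle (x, v, t)
    have e : F.u (x, v, 0) - Ψ.u (x, v, t) = W.u (x, v, t) + Γ.u (x, v, t) := by
      change F.u (x, v, 0) - β (F.u (x, v, t - t) - W.u (x, v, t)) = W.u (x, v, t)
        + (F.u (x, v, t - t) - W.u (x, v, t) - β (F.u (x, v, t - t) - W.u (x, v, t)))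
      rw [sub_self]
      ring
    rw [e]
    refine (abs_add_le _ _).trans ?_
    rw [abs_of_nonneg h2]
    simp only at h3
    linarith

end FokkerPlanck

namespace FokkerPlanck

open Filter Topology ProbabilityTheory

/-! ### Duality -/

/-- The duality argument: the adapted test function is close in `L¹` to `φ` at time `t` and its
image under the backward operator is `O(δ)` in `L¹`, while `D` is merely bounded. The pairing is
therefore at most `A δ` for every `δ ≤ 1`. -/
lemma integral_mul_bump_eq_zero_of_nonneg {t N : ℝ} (ht : 0 < t) (hN : 0 ≤ N)
    {D : ℝ × ℝ × ℝ → ℝ} (hm : AEStronglyMeasurable (atTime D t) stripMeasure)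
    (hDt : ∀ᵐ z ∂stripMeasure, |atTime D t z| ≤ N)
    (hD : ∀ᵐ p ∂cylMeasure t, |D (p.1.1, p.1.2, p.2)| ≤ N)
    (weak : ∀ ψ : ℝ × ℝ × ℝ → ℝ, IsTest t ψ → (∀ p ∈ outgoing t, ψ p = 0) →
      ∫ z, atTime D t z * atTime ψ t z ∂stripMeasure
        = ∫ p in cyl t, D p * (dt ψ p + p.2.1 * dx ψ p + dv (dv ψ) p))
    {φ : ℝ × ℝ → ℝ} (hφ : IsBump φ) (h0 : ∀ z, 0 ≤ φ z) :
    ∫ z, atTime D t z * φ z ∂stripMeasure = 0 := by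
  obtain ⟨J, rfl⟩ := hφ.exists_jet2
  obtain ⟨η, hη, hz⟩ := hφ.exists_margin
  obtain ⟨R, hR, hv⟩ := exists_bound_snd hφ.compact
  obtain ⟨M, hM'⟩ := J.d.bdd
  have hM : ∀ z, J.f z ≤ M := fun z => (le_abs_self _).trans (hM' z)
  have M0 : 0 ≤ M := (h0 0).trans (hM 0)
  -- On the support `|v| ≤ R`, so `K exp (± v) ≥ M`.
  set K := M * Real.exp R with hK
  have K0 : 0 ≤ K := by positivity
  have hKe : ∀ σ : ℝ, σ = 1 ∨ σ = -1 → ∀ z, J.f z ≤ K * Real.exp (σ * z.2) := by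
    intro σ hσ z
    by_cases h : R < |z.2|
    · rw [hv z h]
      positivity
    · refine (hM z).trans ?_
      rw [hK, mul_assoc, ← Real.exp_add]
      refine le_mul_of_one_le_right M0 (Real.one_le_exp ?_)
      have := abs_le.1 (not_lt.1 h)
      rcases hσ with rfl | rfl <;> linarith [this.1, this.2]
  obtain ⟨C', b, b', b'', hb⟩ := exists_isPlateau
  have C'0 : 0 ≤ C' := (abs_nonneg _).trans (hb.bdd' 0)
  obtain ⟨C, hC⟩ := exists_isCorner M0
  obtain ⟨E, E0, hE⟩ := envelope_bounds (Real.sqrt_nonneg (3 * (K * Real.exp t)))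
    (by positivity : 0 ≤ 2 * M)
  set A := N * (2 * t * C + ((2 + t * C') * E + 2 * t * E) + 2 * E) with hA
  have key : ∀ δ, 0 < δ → δ ≤ 1 → |∫ z, atTime D t z * J.f z ∂stripMeasure| ≤ A * δ := by
    intro δ hδ hδ1
    obtain ⟨W, ℓ, hW⟩ := hC δ hδ hδ1
    obtain ⟨F, hF, hk, hi⟩ := exists_isKilled hη ht hδ (by positivity : 0 < δ ^ 2) h0 hM hKe hz
    obtain ⟨i0, i1, b0, b1⟩ := hE δ hδ hδ1
    obtain ⟨Ψ, d, Q, tΨ, hΨ, hout, iQ, hQ, bQ, hclose⟩ :=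
      hF.exists_test ht hδ M0 K0 hk hW hb rfl i0 i1
    set m := envelope √(3 * (K * Real.exp t)) (2 * M) δ with hmdef
    have close : ∀ᵐ z ∂stripMeasure, |J.f z - atTime Ψ.u t z| ≤ 2 * m z.2 := by
      filter_upwards [ae_restrict_mem measurableSet_strip] with z hz
      have hx : z.1 ∈ Icc (0 : ℝ) 1 := Ioo_subset_Icc_self (mem_strip.1 hz)
      have := hclose z.1 hx z.2
      rwa [hi z.1 hx z.2] at this
    have im2 : Integrable (fun z : ℝ × ℝ => 2 * m z.2) stripMeasure :=
      integrable_strip_snd (i0.const_mul 2)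
    have cΨ : Continuous (atTime Ψ.u t) :=
      Ψ.cont.comp (by fun_prop : Continuous fun z : ℝ × ℝ => (z.1, z.2, t))
    have iφ : Integrable (fun z => atTime D t z * J.f z) stripMeasure :=
      (memLp_one_iff_integrable.1 (hφ.memLp 1)).bdd_mul hm hDt
    have id : Integrable (fun z => J.f z - atTime Ψ.u t z) stripMeasure :=
      im2.mono' (J.d.cont.sub cΨ).aestronglyMeasurable close
    have iDd : Integrable (fun z => atTime D t z * (J.f z - atTime Ψ.u t z)) stripMeasure :=
      id.bdd_mul hm hDt
    have e : ∫ z, atTime D t z * J.f z ∂stripMeasure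
        = (∫ z, atTime D t z * atTime Ψ.u t z ∂stripMeasure)
          + ∫ z, atTime D t z * (J.f z - atTime Ψ.u t z) ∂stripMeasure := by
      rw [← sub_eq_iff_eq_add, ← integral_sub iφ iDd]
      exact integral_congr_ae (.of_forall fun z => by simp only; ring)
    have B1 : |∫ z, atTime D t z * (J.f z - atTime Ψ.u t z) ∂stripMeasure| ≤ N * (2 * (E * δ)) := by
      rw [← Real.norm_eq_abs]
      refine (norm_integral_le_of_norm_le (im2.const_mul N) ?_).trans ?_
      · filter_upwards [hDt, close] with z h1 h2
        rw [norm_mul]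
        exact mul_le_mul h1 h2 (norm_nonneg _) hN
      · rw [integral_const_mul, integral_const_mul, integral_strip_snd]
        gcongr
    have B2 : |∫ z, atTime D t z * atTime Ψ.u t z ∂stripMeasure|
        ≤ N * (2 * t * (C * δ) + ((2 + t * C') * (E * δ) + 2 * t * (E * δ))) := by
      rw [weak Ψ.u hΨ hout, setIntegral_cyl, ← Real.norm_eq_abs]
      refine (norm_integral_le_of_norm_le (iQ.const_mul N) ?_).trans ?_
      · filter_upwards [hD, hQ, ae_mem_cyl t] with p h1 h2 h3
        rw [tΨ.operator_eq h3, norm_mul]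
        exact mul_le_mul h1 h2 (norm_nonneg _) hN
      · rw [integral_const_mul]
        refine mul_le_mul_of_nonneg_left (bQ.trans ?_) hN
        gcongr
    rw [e]
    refine (abs_add_le _ _).trans ((add_le_add B2 B1).trans_eq ?_)
    rw [hA]
    ring
  by_contra hne
  have hpos := abs_pos.2 hne
  set I := |∫ z, atTime D t z * J.f z ∂stripMeasure| with hI
  have A0 : 0 < A := by
    have := key 1 one_pos le_rfl
    linarith
  have h1 := key (min 1 (I / (2 * A))) (lt_min one_pos (by positivity)) (min_le_left _ _)
  have h2 : A * min 1 (I / (2 * A)) ≤ A * (I / (2 * A)) :=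
    mul_le_mul_of_nonneg_left (min_le_right _ _) A0.le
  have h3 : A * (I / (2 * A)) = I / 2 := by field_simp
  linarith

open scoped ContDiff in
/-- Every bump function is dominated by a multiple of a nonnegative bump function. -/
lemma IsBump.exists_majorant {φ : ℝ × ℝ → ℝ} (hφ : IsBump φ) :
    ∃ χ, IsBump χ ∧ (∀ z, 0 ≤ χ z) ∧ ∀ z, 0 ≤ φ z + χ z := by
  obtain ⟨η, hη, hz⟩ := hφ.exists_margin
  obtain ⟨R, hR, hv⟩ := exists_bound_snd hφ.compact
  obtain ⟨M, hM⟩ := hφ.compact.exists_bound_of_continuous hφ.smooth.continuous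
  have M0 : 0 ≤ M := (norm_nonneg _).trans (hM 0)
  set ε := min η (1 / 4) with hε
  have ε0 : 0 < ε := lt_min hη (by norm_num)
  have ε1 : ε ≤ 1 / 4 := min_le_right _ _
  let b₁ : ContDiffBump (1 / 2 : ℝ) := ⟨1 / 2 - ε, 1 / 2 - ε / 2, by linarith, by linarith⟩
  let b₂ : ContDiffBump (0 : ℝ) := ⟨R, R + 1, hR, by linarith⟩
  have hs : tsupport (fun z : ℝ × ℝ => M * (b₁ z.1 * b₂ z.2))
      ⊆ Icc (ε / 2) (1 - ε / 2) ×ˢ Icc (-(R + 1)) (R + 1) := by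
    refine closure_minimal (fun z hz => ?_) (isClosed_Icc.prod isClosed_Icc)
    have hz' : M * (b₁ z.1 * b₂ z.2) ≠ 0 := hz
    have h1 : b₁ z.1 ≠ 0 := fun h => hz' (by rw [h]; ring)
    have h2 : b₂ z.2 ≠ 0 := fun h => hz' (by rw [h]; ring)
    have h1' : dist z.1 (1 / 2) < 1 / 2 - ε / 2 := by
      by_contra h
      exact h1 (b₁.zero_of_le_dist (not_lt.1 h))
    have h2' : dist z.2 0 < R + 1 := by
      by_contra h
      exact h2 (b₂.zero_of_le_dist (not_lt.1 h))
    rw [Real.dist_eq, abs_lt] at h1' h2'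
    exact ⟨⟨by linarith [h1'.1], by linarith [h1'.2]⟩, ⟨by linarith [h2'.1], by linarith [h2'.2]⟩⟩
  have n : ∀ z : ℝ × ℝ, 0 ≤ M * (b₁ z.1 * b₂ z.2) := fun z =>
    mul_nonneg M0 (mul_nonneg b₁.nonneg b₂.nonneg)
  refine ⟨fun z => M * (b₁ z.1 * b₂ z.2), ⟨?_, ?_, fun z hz => ?_⟩, n, fun z => ?_⟩
  · exact contDiff_const.mul ((b₁.contDiff.comp contDiff_fst).mul (b₂.contDiff.comp contDiff_snd))
  · exact (isCompact_Icc.prod isCompact_Icc).of_isClosed_subset (isClosed_tsupport _) hs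
  · have := (hs hz).1
    exact mem_strip.2 ⟨by linarith [this.1], by linarith [this.2]⟩
  · by_cases h : φ z = 0
    · rw [h, zero_add]
      exact n z
    · have hx : ¬(z.1 ≤ η ∨ 1 - η ≤ z.1) := fun hx => h (hz z hx)
      have hy : |z.2| ≤ R := by
        by_contra hy
        exact h (hv z (not_le.1 hy))
      rw [not_or, not_le, not_le] at hx
      have εη : ε ≤ η := min_le_left _ _
      have e1 : b₁ z.1 = 1 := by
        refine b₁.one_of_mem_closedBall ?_
        change dist z.1 (1 / 2) ≤ 1 / 2 - ε
        rw [Real.dist_eq, abs_le]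
        constructor <;> linarith [hx.1, hx.2]
      have e2 : b₂ z.2 = 1 := by
        refine b₂.one_of_mem_closedBall ?_
        change dist z.2 0 ≤ R
        rw [Real.dist_eq, sub_zero]
        exact hy
      simp only [e1, e2]
      have := (abs_le.1 (hM z)).1
      linarith

/-- The killed evolution needs nonnegative data; a general bump is the difference of the nonnegative
bumps `φ + χ` and `χ`. -/
lemma integral_mul_bump_eq_zero {d : ℝ × ℝ → ℝ} {N : ℝ}
    (hm : AEStronglyMeasurable d stripMeasure) (hd : ∀ᵐ z ∂stripMeasure, |d z| ≤ N)
    (h : ∀ φ, IsBump φ → (∀ z, 0 ≤ φ z) → ∫ z, d z * φ z ∂stripMeasure = 0) {φ : ℝ × ℝ → ℝ}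
    (hφ : IsBump φ) : ∫ z, d z * φ z ∂stripMeasure = 0 := by
  obtain ⟨χ, hχ, h1, h2⟩ := hφ.exists_majorant
  have hs : IsBump fun z => φ z + χ z :=
    ⟨hφ.smooth.add hχ.smooth, hφ.compact.add hχ.compact,
      (tsupport_add φ χ).trans (union_subset hφ.supp hχ.supp)⟩
  have i1 : Integrable (fun z => d z * φ z) stripMeasure :=
    (memLp_one_iff_integrable.1 (hφ.memLp 1)).bdd_mul hm hd
  have i2 : Integrable (fun z => d z * χ z) stripMeasure :=
    (memLp_one_iff_integrable.1 (hχ.memLp 1)).bdd_mul hm hd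
  have e := h _ hs h2
  simp only [mul_add] at e
  rwa [integral_add i1 i2, h χ hχ h1, add_zero] at e

/-! ### Uniqueness -/

lemma aestronglyMeasurable_cylMeasure {T : ℝ} {f : ℝ × ℝ × ℝ → ℝ}
    (hf : AEStronglyMeasurable f (volume.restrict (cyl T))) :
    AEStronglyMeasurable (fun p : (ℝ × ℝ) × ℝ => f (p.1.1, p.1.2, p.2)) (cylMeasure T) :=
  hf.comp_measurePreserving (measurePreserving_cyl T)

lemma ae_abs_le_of_eLpNorm_top_le {f : ℝ × ℝ → ℝ} {C : ℝ≥0} (h : eLpNorm f ∞ stripMeasure ≤ C) :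
    ∀ᵐ z ∂stripMeasure, |f z| ≤ C := by
  filter_upwards [ae_le_eLpNormEssSup (f := f) (μ := stripMeasure)] with z hz
  rw [eLpNorm_exponent_top] at h
  have := hz.trans h
  rw [← enorm_norm, Real.enorm_eq_ofReal (norm_nonneg _)] at this
  exact (ENNReal.ofReal_le_iff_le_toReal ENNReal.coe_ne_top).1 this

/-- Fubini turns the bounds at almost every time into one in space-time. The converse direction of
Fubini for null sets needs a measurable set, hence the detour through a measurable representative.
-/
lemma MemLinfty.exists_bound {T : ℝ} {f : ℝ × ℝ × ℝ → ℝ} (hf : MemLinfty T f) :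
    ∃ N : ℝ, ∀ᵐ p ∂cylMeasure T, |f (p.1.1, p.1.2, p.2)| ≤ N := by
  obtain ⟨C, hC⟩ := hf.bounded
  refine ⟨C, ?_⟩
  have hm := aestronglyMeasurable_cylMeasure hf.aestronglyMeasurable
  set F : (ℝ × ℝ) × ℝ → ℝ := fun p => f (p.1.1, p.1.2, p.2) with hF
  have hmk := hm.ae_eq_mk
  set G := hm.mk F with hG
  have sG : Measurable G := hm.stronglyMeasurable_mk.measurable
  have hsw : MeasurePreserving Prod.swap ((volume.restrict (Ioo 0 T)).prod stripMeasure)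
      (cylMeasure T) := Measure.measurePreserving_swap
  have h1 := Measure.ae_ae_of_ae_prod (hsw.quasiMeasurePreserving.ae hmk)
  have h2 : ∀ᵐ s ∂(volume.restrict (Ioo 0 T)), eLpNorm (atTime f s) ∞ stripMeasure ≤ C :=
    (ae_restrict_of_ae_restrict_of_subset Ioo_subset_Icc_self hC).mono fun s hs => hs.2
  have h3 : ∀ᵐ p ∂(volume.restrict (Ioo 0 T)).prod stripMeasure, |G p.swap| ≤ C := by
    refine (Measure.ae_prod_iff_ae_ae (measurableSet_le (by fun_prop) measurable_const)).2 ?_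
    filter_upwards [h1, h2] with s h1 h2
    filter_upwards [h1, ae_abs_le_of_eLpNorm_top_le h2] with z h1 h2
    rw [← h1]
    exact h2
  have h4 : ∀ᵐ p ∂cylMeasure T, |G p| ≤ C := by
    have hsw' : MeasurePreserving Prod.swap (cylMeasure T)
        ((volume.restrict (Ioo 0 T)).prod stripMeasure) := Measure.measurePreserving_swap
    exact hsw'.quasiMeasurePreserving.ae h3
  filter_upwards [hmk, h4] with p h5 h6
  change |F p| ≤ C
  rw [h5]
  exact h6

/-- The initial terms cancel in the difference of the two weak formulations, and the difference is
essentially bounded both in space-time and at time `t`; duality against bumps then makes it vanish.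
The integrability needed to subtract comes from the compact velocity support of the test functions.
-/
theorem IsWeakSolution.unique {T : ℝ} {f₀ : ℝ × ℝ → ℝ} {f g : ℝ × ℝ × ℝ → ℝ}
    (hf : IsWeakSolution T f₀ f) (hg : IsWeakSolution T f₀ g) {t : ℝ} (ht : t ∈ Icc 0 T) :
    atTime g t =ᵐ[stripMeasure] atTime f t := by
  rcases ht.1.eq_or_lt with rfl | ht0
  · exact hg.initial.trans hf.initial.symm
  set D : ℝ × ℝ × ℝ → ℝ := fun p => g p - f p with hD
  have hDm : MemLp (atTime D t) ∞ stripMeasure := (hg.mem.memLp_top t ht).sub (hf.mem.memLp_top t ht)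
  have hDs := hDm.aestronglyMeasurable
  obtain ⟨Nf, hNf⟩ := hf.mem.exists_bound
  obtain ⟨Ng, hNg⟩ := hg.mem.exists_bound
  have hDt : ∀ᵐ z ∂stripMeasure,
      |atTime D t z| ≤ (eLpNorm (atTime D t) ∞ stripMeasure).toNNReal :=
    ae_abs_le_of_eLpNorm_top_le (ENNReal.coe_toNNReal hDm.eLpNorm_ne_top).ge
  have restr : ∀ {P : (ℝ × ℝ) × ℝ → Prop}, (∀ᵐ p ∂cylMeasure T, P p) → ∀ᵐ p ∂cylMeasure t, P p := by
    intro P h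
    rw [← cylMeasure_restrict ht.2]
    exact ae_restrict_of_ae h
  have meas : ∀ {u : ℝ × ℝ × ℝ → ℝ}, AEStronglyMeasurable u (volume.restrict (cyl T)) →
      AEStronglyMeasurable (fun p : (ℝ × ℝ) × ℝ => u (p.1.1, p.1.2, p.2)) (cylMeasure t) := by
    intro u h
    rw [← cylMeasure_restrict ht.2]
    exact (aestronglyMeasurable_cylMeasure h).restrict
  set N : ℝ := max (max 0 (eLpNorm (atTime D t) ∞ stripMeasure).toNNReal) (Ng + Nf) with hN
  have weak : ∀ ψ : ℝ × ℝ × ℝ → ℝ, IsTest t ψ → (∀ p ∈ outgoing t, ψ p = 0) →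
      ∫ z, atTime D t z * atTime ψ t z ∂stripMeasure
        = ∫ p in cyl t, D p * (dt ψ p + p.2.1 * dx ψ p + dv (dv ψ) p) := by
    intro ψ hψ hout
    have h1 := hf.weak_form t ht ψ hψ hout
    have h2 := hg.weak_form t ht ψ hψ hout
    have e0 : ∫ z, atTime g 0 z * atTime ψ 0 z ∂stripMeasure
        = ∫ z, atTime f 0 z * atTime ψ 0 z ∂stripMeasure := by
      refine integral_congr_ae ?_
      filter_upwards [hg.initial, hf.initial] with z hz1 hz2
      rw [hz1, hz2]
    obtain ⟨R, C, Ψ, Ψx, Ψv, Ψvv, Ψs, hR, hJ, hEq, hop⟩ := hψ.exists_jet ht0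
    have cΨ := hJ.uc.continuous
    have cB : Continuous (backwardOp Ψx Ψvv Ψs) := by
      have := hJ.uc_x.continuous
      have := hJ.uc_vv.continuous
      have := hJ.uc_s.continuous
      unfold backwardOp
      fun_prop
    have iB := integrable_cyl_of_band cB (R := R) (fun p hp => by
      simp [backwardOp, hJ.supp_x p hp, hJ.supp_vv p hp, hJ.supp_s p hp]) t
    have iψ : Integrable (atTime ψ t) stripMeasure := by
      have : Integrable (fun z : ℝ × ℝ => Ψ (z.1, z.2, t)) stripMeasure :=
        integrable_strip_of_band (by fun_prop) (R := R) fun z hz => hJ.supp _ hz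
      refine this.congr ?_
      filter_upwards [ae_restrict_mem measurableSet_strip] with z hz
      exact hEq (mem_closedCyl.2 ⟨Ioo_subset_Icc_self (mem_strip.1 hz), ht.1, le_rfl⟩)
    have is : ∀ {u : ℝ × ℝ × ℝ → ℝ}, MemLp (atTime u t) ∞ stripMeasure →
        Integrable (fun z => atTime u t z * atTime ψ t z) stripMeasure := fun {u} hu =>
      iψ.bdd_mul hu.aestronglyMeasurable
        (ae_abs_le_of_eLpNorm_top_le (ENNReal.coe_toNNReal hu.eLpNorm_ne_top).ge)
    have ic : ∀ {u : ℝ × ℝ × ℝ → ℝ} {n : ℝ}, AEStronglyMeasurable u (volume.restrict (cyl T)) →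
        (∀ᵐ p ∂cylMeasure T, |u (p.1.1, p.1.2, p.2)| ≤ n) →
        Integrable (fun p : (ℝ × ℝ) × ℝ => u (p.1.1, p.1.2, p.2)
          * backwardOp Ψx Ψvv Ψs (p.1.1, p.1.2, p.2)) (cylMeasure t) := fun hu hn =>
      iB.bdd_mul (meas hu) (restr hn)
    have ec : ∀ u : ℝ × ℝ × ℝ → ℝ,
        ∫ p in cyl t, u p * (dt ψ p + p.2.1 * dx ψ p + dv (dv ψ) p)
          = ∫ p, u (p.1.1, p.1.2, p.2) * backwardOp Ψx Ψvv Ψs (p.1.1, p.1.2, p.2)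
            ∂cylMeasure t := by
      intro u
      rw [setIntegral_cyl]
      refine integral_congr_ae ?_
      filter_upwards [ae_mem_cyl t] with p hp
      rw [hop _ hp]
    have eD : ∫ z, atTime D t z * atTime ψ t z ∂stripMeasure
        = (∫ z, atTime g t z * atTime ψ t z ∂stripMeasure)
          - ∫ z, atTime f t z * atTime ψ t z ∂stripMeasure := by
      rw [← integral_sub (is (hg.mem.memLp_top t ht)) (is (hf.mem.memLp_top t ht))]
      exact integral_congr_ae (.of_forall fun z => by simp only [hD, atTime]; ring)
    have eC : ∫ p in cyl t, D p * (dt ψ p + p.2.1 * dx ψ p + dv (dv ψ) p)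
        = (∫ p in cyl t, g p * (dt ψ p + p.2.1 * dx ψ p + dv (dv ψ) p))
          - ∫ p in cyl t, f p * (dt ψ p + p.2.1 * dx ψ p + dv (dv ψ) p) := by
      rw [ec, ec, ec, ← integral_sub (ic hg.mem.aestronglyMeasurable hNg)
        (ic hf.mem.aestronglyMeasurable hNf)]
      exact integral_congr_ae (.of_forall fun p => by simp only [hD]; ring)
    rw [eD, eC]
    linarith
  have hz : atTime D t =ᵐ[stripMeasure] 0 := by
    refine ae_eq_zero_of_forall_bump (locallyIntegrableOn_strip hDm le_top) fun φ hφ => ?_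
    refine integral_mul_bump_eq_zero hDs hDt (fun φ hφ h0 => ?_) hφ
    refine integral_mul_bump_eq_zero_of_nonneg (N := N) ht0
      ((le_max_left _ _).trans (le_max_left _ _)) hDs ?_ ?_ weak hφ h0
    · filter_upwards [hDt] with z hz
      exact hz.trans ((le_max_right _ _).trans (le_max_left _ _))
    · filter_upwards [restr hNf, restr hNg] with p h1 h2
      refine ((abs_sub _ _).trans (add_le_add h2 h1)).trans (le_max_right _ _)
  filter_upwards [hz] with z hz
  exact sub_eq_zero.1 hz

/-! ### The initial datum as a density, and the theorem -/

/-- A bounded nonnegative integrable function on the strip is almost everywhere equal to a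
density. -/
lemma exists_isDensity {f₀ : ℝ × ℝ → ℝ} (h1 : MemLp f₀ 1 stripMeasure)
    (h2 : MemLp f₀ ∞ stripMeasure) (h0 : 0 ≤ᵐ[stripMeasure] f₀) :
    ∃ q, IsDensity (eLpNorm f₀ ∞ stripMeasure).toReal (eLpNorm f₀ 1 stripMeasure).toReal q ∧
      q =ᵐ[stripMeasure] f₀ := by
  set M := (eLpNorm f₀ ∞ stripMeasure).toReal with hM
  have M0 : 0 ≤ M := ENNReal.toReal_nonneg
  have hm := h1.aestronglyMeasurable
  set F := hm.mk f₀ with hF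
  have mF : Measurable F := hm.stronglyMeasurable_mk.measurable
  set q : ℝ × ℝ → ℝ := strip.indicator fun z => max 0 (min M (F z)) with hq
  have eq : q =ᵐ[stripMeasure] f₀ := by
    filter_upwards [hm.ae_eq_mk, h0, ae_restrict_mem measurableSet_strip,
      ae_abs_le_of_eLpNorm_top_le (ENNReal.coe_toNNReal h2.eLpNorm_ne_top).ge] with z e hz hs hle
    have hle' : f₀ z ≤ M := (le_abs_self _).trans hle
    rw [hq, indicator_of_mem hs, hF, ← e, min_eq_right hle']
    exact max_eq_right hz
  have iq : Integrable q := by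
    rw [hq, integrable_indicator_iff measurableSet_strip]
    refine (memLp_one_iff_integrable.1 h1).congr ?_
    filter_upwards [eq, ae_restrict_mem measurableSet_strip] with z e hs
    rw [← e, hq, indicator_of_mem hs]
  refine ⟨q, ⟨(measurable_const.max (measurable_const.min mF)).indicator measurableSet_strip,
    fun z => indicator_nonneg (fun _ _ => le_max_left _ _) z, fun z => ?_,
    fun z hz => indicator_of_notMem hz _, iq, ?_⟩, eq⟩
  · by_cases hz : z ∈ strip
    · rw [hq, indicator_of_mem hz]
      exact max_le M0 (min_le_left _ _)
    · rw [hq, indicator_of_notMem hz]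
      exact M0
  · have e1 : ∫ z, q z = ∫ z, q z ∂stripMeasure := by
      rw [stripMeasure, setIntegral_eq_integral_of_forall_compl_eq_zero]
      exact fun z hz => indicator_of_notMem hz _
    have e2 : ∫ z, q z ∂stripMeasure = ∫ z, ‖f₀ z‖ ∂stripMeasure := by
      refine integral_congr_ae ?_
      filter_upwards [eq, h0] with z e hz
      rw [e, Real.norm_eq_abs, abs_of_nonneg hz]
    rw [e1, e2, integral_norm_eq_lintegral_enorm hm, eLpNorm_one_eq_lintegral_enorm]

end FokkerPlanck

theorem theorem1p2 (T : ℝ) (hT : 0 < T) (f₀ : ℝ × ℝ → ℝ)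
    (hf₀_one : MemLp f₀ 1 FokkerPlanck.stripMeasure)
    (hf₀_top : MemLp f₀ ∞ FokkerPlanck.stripMeasure)
    (hf₀_nonneg : 0 ≤ᵐ[FokkerPlanck.stripMeasure] f₀) :
    ∃ f : ℝ × ℝ × ℝ → ℝ,
      FokkerPlanck.IsWeakSolution T f₀ f ∧
      (∀ t ∈ Icc 0 T, 0 ≤ᵐ[FokkerPlanck.stripMeasure] FokkerPlanck.atTime f t) ∧
      (∀ g : ℝ × ℝ × ℝ → ℝ, FokkerPlanck.IsWeakSolution T f₀ g →
        ∀ t ∈ Icc 0 T,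
          FokkerPlanck.atTime g t =ᵐ[FokkerPlanck.stripMeasure] FokkerPlanck.atTime f t) ∧
      (∀ t ∈ Icc 0 T,
        eLpNorm (FokkerPlanck.atTime f t) ∞ FokkerPlanck.stripMeasure
            ≤ eLpNorm f₀ ∞ FokkerPlanck.stripMeasure ∧
        eLpNorm (FokkerPlanck.atTime f t) 1 FokkerPlanck.stripMeasure
            ≤ eLpNorm f₀ 1 FokkerPlanck.stripMeasure) := by
  obtain ⟨q, hq, hqf⟩ := FokkerPlanck.exists_isDensity hf₀_one hf₀_top hf₀_nonneg
  -- The bound and the mass of the density are the norms of `f₀` themselves, so the bounds obtained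
  -- with existence are the asserted contractions.
  obtain ⟨f, hf, hb⟩ := FokkerPlanck.exists_isWeakSolution hT ENNReal.toReal_nonneg
    ENNReal.toReal_nonneg hq
  have hf' : FokkerPlanck.IsWeakSolution T f₀ f :=
    ⟨hf.mem, hf.initial.trans hqf, hf.weakly_continuous, hf.weak_form⟩
  refine ⟨f, hf', fun t ht => (hb t ht).1, fun g hg t ht => hf'.unique hg ht, fun t ht => ?_⟩
  have h := (hb t ht).2
  rwa [ENNReal.ofReal_toReal hf₀_top.eLpNorm_ne_top,
    ENNReal.ofReal_toReal hf₀_one.eLpNorm_ne_top] at h
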